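/- Let $F$ be a non-archimedean local field of characteristic $0$ with ring of integers $\mathfrak o$, maximal ideal $\mathfrak p=\pi\mathfrak o$ ($\pi$ a fixed prime element), residue field of odd cardinality $q$, and absolute value normalized by $|\pi|=q^{-1}$. Let $\psi$ be a continuous additive (unitary) character of $F$ of order $0$ (trivial on $\mathfrak o$ and on no larger fractional ideal), let $\chi(x)=\langle \pi,x\rangle$ (quadratic Hilbert symbol) on $F^\times$, and let $\alpha_\psi(a)$ ($a\in F^\times$) be the Weil constant, i.e. the complex number with $$\int_F\phi(x)\psi(ax^2)\,dx=\alpha_\psi(a)|2a|^{-1/2}\int_F\hat\phi(x)\,\psi\Big(-\frac{x^2}{4a}\Big)dx$$ for all Schwartz functions $\phi$ on $F$, where $\hat\phi(x)=\int_F\phi(y)\psi(xy)\,dy$ and $\mathfrak o$ has volume $1$. Let $n=2$, $G=\mathrm{Sp}_2(F)\subset \mathrm{GL}_4(F)$, let $\Gamma\subset \mathrm{Sp}_2(\mathfrak o)$ be the subgroup of the matrices $\begin{pmatrix}A&B\\C&D\end{pmatrix}$ with $C\equiv 0 \bmod \mathfrak p$, and for $0\le i\le 2$ let $w_i\in G$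 be the matrix with blocks $A=D=\mathrm{diag}(1_{2-i},0_i)$, $C=-B=\mathrm{diag}(0_{2-i},1_i)$. For $0\le t\le 2$ and $s\in\mathbb C$ let $f_t$ be the locally constant function on $G$ with $$f_t\Big(\begin{pmatrix}A&*\\0&{}^tA^{-1}\end{pmatrix}g\,k\Big)=\chi(\det A)\,|\det A|^{s}\,\chi(\det D_k)\,f_t(g)\qquad\Big(k=\begin{pmatrix}*&*\\ *&D_k\end{pmatrix}\in\Gamma\Big),\qquad f_t(w_j)=\delta_{tj}.$$ For $B\in\mathrm{Sym}_2(F)$ with $\det B\neq0$ the Siegel series is $$S_t(B,s)^\chi=\int_{\mathrm{Sym}_2(F)}f_t\Big(w_2\begin{pmatrix}1&X\\0&1\end{pmatrix}\Big)\psi(-\mathrm{tr}(BX))\,dX,\qquad \mathrm{vol}(\mathrm{Sym}_2(\mathfrak o))=1,$$ understood for general $s$ by meromorphic continuation. Let $B=\mathrm{diag}(\alpha_1\pi^{e_1},\alpha_2\pi^{e_2})$ with $\alpha_1,\alpha_2\in\mathfrak o^\times$ and integers $0\le e_1\le e_2$. For $t=0,1$ the integral converges absolutely when $\mathrm{Re}\,s>2$,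 and the following identities hold for all $s\in\mathbb C$ (those for $S_1$ whenever $q^{3-2s}\ne1$). (a) If $e_1+e_2$ is even, then $$S_0(B,s)^\chi=\chi(-1)\Big\{(q-1)\sum_{i=1}^{\frac{e_1+e_2}{2}}q^{(3-2s)i-2}-q^{(3-2s)(\frac{e_1+e_2}{2}+1)-2}\Big\},$$ $$S_1(B,s)^\chi=\alpha_\psi(\pi)\chi(-1)^{e_1+1}\chi(-\alpha_1)\,q^{(\frac32-s)(e_1+1)+\frac{e_1}{2}}\,\frac{(1-q^{2-2s})(1-q^{(\frac32-s)(e_2-e_1)})}{1-q^{3-2s}}.$$ (b) If $e_1+e_2$ is odd, then $$S_0(B,s)^\chi=\chi(-1)\Big\{(q-1)\sum_{i=1}^{\frac{e_1+e_2+1}{2}}q^{(3-2s)i-2}+\chi(\pi\alpha_1\alpha_2)\,q^{(3-2s)(\frac{e_1+e_2}{2}+1)-\frac32}\Big\},$$ $$S_1(B,s)^\chi=\alpha_\psi(\pi)\chi(-1)^{e_1+1}\chi(-\alpha_1)\,q^{(\frac32-s)(e_1+1)+\frac{e_1}{2}}\,\frac{1+\chi(-\alpha_1\alpha_2)q^{1-s}}{1-q^{3-2s}}\Big\{1-\chi(-\alpha_1\alpha_2)q^{1-s}+\chi(-\alpha_1\alpha_2)q^{(\frac32-s)(e_2-e_1)-\frac12}-q^{(\frac32-s)(e_2-e_1+1)}\Big\}.$$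 -/

import Mathlib

open MeasureTheory

noncomputable section

namespace RamifiedSiegel

/-! ### The local field

A non-archimedean local field is a nontrivially normed field `F` whose norm is ultrametric and
whose closed balls are compact.  Its ring of integers is the closed unit ball. -/

/-- The cardinality `q` of the residue field of `F`. -/
def residueCard (F : Type*) [NontriviallyNormedField F] [IsUltrametricDist F] : ℕ :=
  Nat.card (IsLocalRing.ResidueField (NormedField.valuation (K := F)).valuationSubring)

/-- `π` is a prime element: it generates the maximal ideal `{x | ‖x‖ < 1}`. -/
def IsUniformizer {F : Type*} [NontriviallyNormedField F] (π : F) : Prop :=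
  π ≠ 0 ∧ ‖π‖ < 1 ∧ ∀ x : F, ‖x‖ < 1 → ‖x‖ ≤ ‖π‖

/-- The additive character `ψ` has order `0`: the ring of integers is the largest fractional
ideal on which `ψ` is trivial. -/
def HasOrderZero {F : Type*} [NontriviallyNormedField F] (ψ : AddChar F Circle) : Prop :=
  (∀ x : F, ‖x‖ ≤ 1 → ψ x = 1) ∧
    ∀ y : F, 1 < ‖y‖ → ∃ x : F, ‖x‖ ≤ ‖y‖ ∧ ψ x ≠ 1

open Classical in
/-- The quadratic Hilbert symbol `⟨a, b⟩` (for nonzero `a`, `b`). -/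
def hilbertSymbol {F : Type*} [Field F] (a b : F) : ℂ :=
  if ∃ x y z : F, (x ≠ 0 ∨ y ≠ 0 ∨ z ≠ 0) ∧ z ^ 2 = a * x ^ 2 + b * y ^ 2 then 1 else -1

/-- The ramified quadratic character `χ(x) = ⟨π, x⟩`. -/
def chi {F : Type*} [Field F] (π : F) (x : F) : ℂ := hilbertSymbol π x

/-- The Haar measure on `F` giving the ring of integers volume `1`. -/
def haarF (F : Type*) [NontriviallyNormedField F] [ProperSpace F]
    [MeasurableSpace F] [BorelSpace F] : Measure F :=
  Measure.addHaarMeasure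
    ⟨⟨Metric.closedBall 0 1, isCompact_closedBall 0 1⟩,
      ⟨0, Metric.ball_subset_interior_closedBall (Metric.mem_ball_self one_pos)⟩⟩

/-! ### The Weil constant -/

section Weil

variable {F : Type*} [NontriviallyNormedField F] [ProperSpace F]
  [MeasurableSpace F] [BorelSpace F]

/-- The Fourier transform with respect to `ψ`. -/
def fourier (ψ : AddChar F Circle) (φ : F → ℂ) (x : F) : ℂ :=
  ∫ y, φ y * (ψ (x * y) : ℂ) ∂(haarF F)

/-- `c` is the Weil constant of `a`: the displayed identity holds for all
Schwartz (locally constant, compactly supported) functions `φ` on `F`. -/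
def IsWeilConstant (ψ : AddChar F Circle) (a : F) (c : ℂ) : Prop :=
  ∀ φ : F → ℂ, IsLocallyConstant φ → HasCompactSupport φ →
    ∫ x, φ x * (ψ (a * x ^ 2) : ℂ) ∂(haarF F) =
      c * ((‖2 * a‖ ^ (-(1 / 2) : ℝ) : ℝ) : ℂ) *
        ∫ x, fourier ψ φ x * (ψ (-(x ^ 2 / (4 * a))) : ℂ) ∂(haarF F)

open Classical in
/-- The Weil constant `α_ψ(a)`. -/
def weilConstant (ψ : AddChar F Circle) (a : F) : ℂ :=
  if h : ∃ c, IsWeilConstant ψ a c then h.choose else 0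

end Weil

/-! ### The symplectic group and the induced representation

`Matrix.symplecticGroup (Fin n) F` is the group `Sp_n(F)` of `2n × 2n` matrices preserving the
form with matrix `[0, -1; 1, 0]`. -/

open Matrix

section Symplectic

variable {F : Type*} [Field F] {n : ℕ}

/-- The underlying matrix of `w_i`. -/
def wMatrix (F : Type*) [Field F] (n i : ℕ) : Matrix (Fin n ⊕ Fin n) (Fin n ⊕ Fin n) F :=
  fromBlocks
    (diagonal fun k : Fin n => if (k : ℕ) < n - i then 1 else 0)
    (diagonal fun k : Fin n => if (k : ℕ) < n - i then 0 else -1)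
    (diagonal fun k : Fin n => if (k : ℕ) < n - i then 0 else 1)
    (diagonal fun k : Fin n => if (k : ℕ) < n - i then 1 else 0)

theorem wMatrix_mem (n i : ℕ) : wMatrix F n i ∈ symplecticGroup (Fin n) F := by
  rw [SymplecticGroup.mem_iff]
  simp only [wMatrix, J, fromBlocks_transpose, diagonal_transpose, fromBlocks_multiply,
    Matrix.mul_zero, Matrix.mul_one, Matrix.mul_neg, zero_add, add_zero,
    diagonal_mul_diagonal, diagonal_neg, diagonal_add]
  congr 1 <;> ext a b <;> by_cases hab : a = b <;>
    by_cases h : (b : ℕ) < n - i <;> simp [Matrix.one_apply, hab, h]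

/-- The representatives `w_i`, `0 ≤ i ≤ n`, of `P \ G / Γ`. -/
def w (F : Type*) [Field F] (n i : ℕ) : symplecticGroup (Fin n) F :=
  ⟨wMatrix F n i, wMatrix_mem n i⟩

theorem unipotent_mem {X : Matrix (Fin n) (Fin n) F} (hX : X.IsSymm) :
    fromBlocks 1 X 0 1 ∈ symplecticGroup (Fin n) F := by
  rw [SymplecticGroup.mem_iff]
  simp [J, fromBlocks_transpose, fromBlocks_multiply, hX.eq]

/-- The element `[1, X; 0, 1]` of `Sp_n(F)`, for symmetric `X`. -/
def unipotent (X : Matrix (Fin n) (Fin n) F) (hX : X.IsSymm) : symplecticGroup (Fin n) F :=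
  ⟨fromBlocks 1 X 0 1, unipotent_mem hX⟩

/-- The Siegel parabolic subgroup `P`: the lower left block vanishes. -/
def siegelParabolic (F : Type*) [Field F] (n : ℕ) : Set (symplecticGroup (Fin n) F) :=
  {g | g.1.toBlocks₂₁ = 0}

end Symplectic

section Induced

variable {F : Type*} [NontriviallyNormedField F] {n : ℕ}

/-- The subgroup `Γ` of `Sp_n(𝔬)`: integral entries, lower left block congruent to `0` modulo
the maximal ideal. -/
def Gam (F : Type*) [NontriviallyNormedField F] (n : ℕ) : Set (symplecticGroup (Fin n) F) :=
  {g | (∀ i j, ‖g.1 i j‖ ≤ 1) ∧ ∀ i j, ‖g.1.toBlocks₂₁ i j‖ < 1}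

/-- `I_n(ω, s)`: smooth (i.e. locally constant) functions on `Sp_n(F)` with
`f(p g) = ω(det A) |det A|^{s + (n+1)/2} f(g)` for `p = [A, *; 0, ᵗA⁻¹]`. -/
def inducedSpace (ω : F → ℂ) (s : ℂ) : Set (symplecticGroup (Fin n) F → ℂ) :=
  {f | IsLocallyConstant f ∧
    ∀ p ∈ siegelParabolic F n, ∀ g,
      f (p * g) = ω p.1.toBlocks₁₁.det *
        ((‖p.1.toBlocks₁₁.det‖ : ℝ) : ℂ) ^ (s + ((n : ℂ) + 1) / 2) * f g}

/-- `I_n(ω, s)^{Γ, ω}`: those `f` in `I_n(ω, s)` with `f(g k) = ω(det D) f(g)` for every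
`k = [A, B; C, D]` in `Γ`. -/
def inducedSpaceGam (ω : F → ℂ) (s : ℂ) : Set (symplecticGroup (Fin n) F → ℂ) :=
  {f | f ∈ inducedSpace ω s ∧ ∀ g, ∀ k ∈ Gam F n, f (g * k) = ω k.1.toBlocks₂₂.det * f g}

/-- The defining property of `f_t`: it lies in `I_n(ω, s)^{Γ, ω}` and `f_t(w_j) = δ_{tj}`. -/
def IsBasisSection (ω : F → ℂ) (s : ℂ) (t : ℕ) (f : symplecticGroup (Fin n) F → ℂ) : Prop :=
  f ∈ inducedSpaceGam ω s ∧ ∀ j ≤ n, f (w F n j) = if j = t then 1 else 0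

open Classical in
/-- The function `f_t`. -/
def basisSection (ω : F → ℂ) (s : ℂ) (t : ℕ) : symplecticGroup (Fin n) F → ℂ :=
  if h : ∃ f : symplecticGroup (Fin n) F → ℂ, IsBasisSection ω s t f then h.choose else 0

end Induced

/-! ### The Siegel series

A symmetric matrix is given by its entries on and above the diagonal, and `dX = ∏_{i ≤ j} dx_{ij}`
is the Haar measure on `Sym_n(F)` for which `Sym_n(𝔬)` has volume `1`. -/

/-- Positions on and above the diagonal. -/
abbrev UpperIdx (n : ℕ) : Type := {p : Fin n × Fin n // p.1 ≤ p.2}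

/-- The symmetric matrix with the given entries on and above the diagonal. -/
def symMatrix {F : Type*} {n : ℕ} (x : UpperIdx n → F) : Matrix (Fin n) (Fin n) F :=
  Matrix.of fun i j => x ⟨(min i j, max i j), min_le_max⟩

theorem symMatrix_isSymm {F : Type*} {n : ℕ} (x : UpperIdx n → F) : (symMatrix x).IsSymm := by
  ext i j
  simp only [symMatrix, transpose_apply, of_apply, min_comm i j, max_comm i j]

section Series

variable {F : Type*} [NontriviallyNormedField F] [ProperSpace F]
  [MeasurableSpace F] [BorelSpace F] {n : ℕ}

/-- The measure `dX` on `Sym_n(F)`. -/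
def haarSym (F : Type*) [NontriviallyNormedField F] [ProperSpace F]
    [MeasurableSpace F] [BorelSpace F] (n : ℕ) : Measure (UpperIdx n → F) :=
  Measure.pi fun _ => haarF F

/-- The integrand `f_t(w_n [1, X; 0, 1]) ψ(-tr(BX))`, with `f_t` in
`I_n(ω, s - (n+1)/2)^{Γ, ω}`. -/
def siegelIntegrand (ω : F → ℂ) (ψ : AddChar F Circle) (t : ℕ) (B : Matrix (Fin n) (Fin n) F)
    (s : ℂ) (x : UpperIdx n → F) : ℂ :=
  basisSection ω (s - ((n : ℂ) + 1) / 2) t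
      (w F n n * unipotent (symMatrix x) (symMatrix_isSymm x)) *
    (ψ (-(B * symMatrix x).trace) : ℂ)

/-- `S` is a meromorphic function on `ℂ` (with removable singularities removed) which, on some
right half plane, is given by the absolutely convergent Siegel series integral. -/
def IsSiegelSeries (ω : F → ℂ) (ψ : AddChar F Circle) (t : ℕ) (B : Matrix (Fin n) (Fin n) F)
    (S : ℂ → ℂ) : Prop :=
  MeromorphicNFOn S Set.univ ∧
    ∃ c : ℝ, ∀ s : ℂ, c < s.re →
      Integrable (siegelIntegrand ω ψ t B s) (haarSym F n) ∧
        S s = ∫ x, siegelIntegrand ω ψ t B s x ∂(haarSym F n)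

open Classical in
/-- The Siegel series `S_t(B, s)^ω`, as a meromorphic function of `s`. -/
def siegelSeries (ω : F → ℂ) (ψ : AddChar F Circle) (t : ℕ) (B : Matrix (Fin n) (Fin n) F) :
    ℂ → ℂ :=
  if h : ∃ S : ℂ → ℂ, IsSiegelSeries ω ψ t B S then h.choose else 0

end Series

end RamifiedSiegel

end

noncomputable section

set_option linter.unusedSectionVars false

namespace RamifiedSiegel

/-! Write X = (x, y; y, z) and split Sym_2(F) according to the entry of largest norm. If X is
integral, then w_2 n(X) lies in w_2 Γ, where f_0 and f_1 vanish. If x dominates, with |x| > 1,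
completing the square gives X = U diag(x, v) ᵗU with U in GL_2(𝔬) and v = z - y²/x. The value of f_t
at w_2 n(X) is unchanged by this conjugation. It comes from P w_1 Γ, with value χ(x)|x|^(-s), when
|v| ≤ 1, and from P w_0 Γ, with value χ(xv)|xv|^(-s), when |v| > 1. The case where z strictly
dominates is symmetric. If y dominates, det X agrees with -y² up to a factor in 1 + 𝔭 and X⁻¹ is
small, so that only f_0 contributes. This is `section_mul_psi_eq`.

On the part where x dominates, the shear z ↦ v + y²/x preserves the measure and separates the
variables (`integral_shellFn`). The y-integral becomes the quadratic integral of ψ(a y²) over 𝔬,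
where a is proportional to x. If |a| is an even power of q (or |a| ≤ 1), it does not involve χ; if
|a| is an odd power, it carries χ(a) and one factor g, the Gauss integral of χψ over |x| = q. In the
even case the x-integral is a Gauss integral, which lives on a single sphere. In the odd case χ(x)²
= 1 leaves an integral of ψ alone, which yields a factor q - 1 at each radius and a negative
boundary term at the last one. These terms form a geometric progression of ratio q³ z², where z =
q^(-s).

Every integral vanishes on large spheres, so for Re s > 2 the series equals a polynomial in q^(-s),
namely `siegelSum`; the identity theorem then gives the continuation. For S_0 the v-integral
supplies a second factor g and g² = χ(-1) q (`gaussInt_sq`). For S_1 a single g survives, and it is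
turned into the Weil constant by α_ψ(π) = q^(-1/2) χ(-1) g (`weilConstant_eq`). What remains is the
algebra of finite geometric sums. -/

/-- `F` has residue field of odd cardinality `q`, and its norm is normalized by `‖π‖ = q⁻¹`
for the prime element `π`. -/
structure IsNormalized {F : Type*} [NontriviallyNormedField F] [IsUltrametricDist F]
    (q : ℕ) (π : F) : Prop where
  card : q = residueCard F
  odd : Odd q
  unif : IsUniformizer π
  norm : ‖π‖ = (q : ℝ)⁻¹

/-! ### Ultrametric norms, reduction to the residue field, and Hensel's lemma. -/

section Ultrametric

variable {F : Type*} [NontriviallyNormedField F] [IsUltrametricDist F]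

theorem norm_sub_le_max' (a b : F) : ‖a - b‖ ≤ max ‖a‖ ‖b‖ := by
  simpa [sub_eq_add_neg] using IsUltrametricDist.norm_add_le_max a (-b)

theorem norm_add_le_of_le {a b : F} {r : ℝ} (ha : ‖a‖ ≤ r) (hb : ‖b‖ ≤ r) : ‖a + b‖ ≤ r :=
  (IsUltrametricDist.norm_add_le_max a b).trans (max_le ha hb)

theorem norm_sub_le_of_le {a b : F} {r : ℝ} (ha : ‖a‖ ≤ r) (hb : ‖b‖ ≤ r) : ‖a - b‖ ≤ r :=
  (norm_sub_le_max' a b).trans (max_le ha hb)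

theorem norm_add_lt_of_lt {a b : F} {r : ℝ} (ha : ‖a‖ < r) (hb : ‖b‖ < r) : ‖a + b‖ < r :=
  (IsUltrametricDist.norm_add_le_max a b).trans_lt (max_lt ha hb)

theorem norm_sub_lt_of_lt {a b : F} {r : ℝ} (ha : ‖a‖ < r) (hb : ‖b‖ < r) : ‖a - b‖ < r :=
  (norm_sub_le_max' a b).trans_lt (max_lt ha hb)

theorem norm_add_eq_left {a b : F} (h : ‖b‖ < ‖a‖) : ‖a + b‖ = ‖a‖ := by
  rw [IsUltrametricDist.norm_add_eq_max_of_norm_ne_norm h.ne', max_eq_left h.le]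

theorem norm_sub_eq_left {a b : F} (h : ‖b‖ < ‖a‖) : ‖a - b‖ = ‖a‖ := by
  rw [sub_eq_add_neg, norm_add_eq_left (by simpa using h)]

theorem norm_eq_of_norm_sub_lt {a b : F} (h : ‖a - b‖ < ‖a‖) : ‖b‖ = ‖a‖ := by
  have := norm_sub_eq_left h
  simpa using this

theorem norm_mul_sub_mul_lt {a b c d : F} (h₁ : ‖a - c‖ < 1) (h₂ : ‖b - d‖ < 1)
    (hb : ‖b‖ ≤ 1) (hc : ‖c‖ ≤ 1) : ‖a * b - c * d‖ < 1 := by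
  have : a * b - c * d = (a - c) * b + c * (b - d) := by ring
  rw [this]
  apply norm_add_lt_of_lt
  · rw [norm_mul]
    calc ‖a - c‖ * ‖b‖ ≤ ‖a - c‖ * 1 := by gcongr
      _ < 1 := by simpa using h₁
  · rw [norm_mul]
    calc ‖c‖ * ‖b - d‖ ≤ 1 * ‖b - d‖ := by gcongr
      _ < 1 := by simpa using h₂

end Ultrametric

section Residue

variable {F : Type*} [NontriviallyNormedField F] [IsUltrametricDist F]

/-- The residue field of `F`. -/
abbrev ResField (F : Type*) [NontriviallyNormedField F] [IsUltrametricDist F] : Type _ :=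
  IsLocalRing.ResidueField (NormedField.valuation (K := F)).valuationSubring

theorem mem_integers {x : F} :
    x ∈ (NormedField.valuation (K := F)).valuationSubring ↔ ‖x‖ ≤ 1 := by
  rw [Valuation.mem_valuationSubring_iff, NormedField.valuation_apply, ← NNReal.coe_le_coe]
  simp

open Classical in
/-- Reduction of an integral element modulo the maximal ideal (`0` on non-integral elements). -/
def red (x : F) : ResField F :=
  if h : ‖x‖ ≤ 1 then IsLocalRing.residue _ ⟨x, mem_integers.2 h⟩ else 0

theorem red_add {x y : F} (hx : ‖x‖ ≤ 1) (hy : ‖y‖ ≤ 1) : red (x + y) = red x + red y := by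
  rw [red, red, red, dif_pos hx, dif_pos hy, dif_pos (norm_add_le_of_le hx hy), ← map_add]
  rfl

theorem red_mul {x y : F} (hx : ‖x‖ ≤ 1) (hy : ‖y‖ ≤ 1) : red (x * y) = red x * red y := by
  rw [red, red, red, dif_pos hx, dif_pos hy,
    dif_pos (by rw [norm_mul]; exact mul_le_one₀ hx (norm_nonneg _) hy), ← map_mul]
  rfl

theorem red_one : red (1 : F) = 1 := by
  rw [red, dif_pos (by simp), ← map_one (IsLocalRing.residue _)]
  rfl

theorem red_surjective (r : ResField F) : ∃ x : F, ‖x‖ ≤ 1 ∧ red x = r := by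
  obtain ⟨x, rfl⟩ := IsLocalRing.residue_surjective r
  refine ⟨x, mem_integers.1 x.2, ?_⟩
  rw [red, dif_pos (mem_integers.1 x.2)]

theorem red_eq_zero_iff {x : F} (hx : ‖x‖ ≤ 1) : red x = 0 ↔ ‖x‖ < 1 := by
  rw [red, dif_pos hx, IsLocalRing.residue_eq_zero_iff, IsLocalRing.mem_maximalIdeal,
    mem_nonunits_iff]
  constructor
  · intro h
    refine lt_of_le_of_ne hx fun h1 => h ?_
    have h0 : x ≠ 0 := by rintro rfl; simp at h1
    refine IsUnit.of_mul_eq_one ⟨x⁻¹, mem_integers.2 (by simp [h1])⟩ ?_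
    ext
    simp [h0]
  · intro h hu
    obtain ⟨y, hy⟩ := hu.exists_right_inv
    have h1 : x * (y : F) = 1 := congrArg Subtype.val hy
    have h2 := mem_integers.1 y.2
    have h3 : ‖x‖ * ‖(y : F)‖ = 1 := by rw [← norm_mul, h1, norm_one]
    nlinarith [norm_nonneg x, norm_nonneg (y : F)]

theorem red_ne_zero {x : F} (hx : ‖x‖ = 1) : red x ≠ 0 := fun h => by
  have := (red_eq_zero_iff hx.le).1 h
  linarith

theorem red_neg {x : F} (hx : ‖x‖ ≤ 1) : red (-x) = -red x := by
  have h := red_add hx (y := -x) (by simpa using hx)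
  rw [add_neg_cancel, (red_eq_zero_iff (x := (0 : F)) (by simp)).2 (by simp)] at h
  exact (neg_eq_of_add_eq_zero_right h.symm).symm

theorem red_eq_red_iff {x y : F} (hx : ‖x‖ ≤ 1) (hy : ‖y‖ ≤ 1) :
    red x = red y ↔ ‖x - y‖ < 1 := by
  rw [← red_eq_zero_iff (norm_sub_le_of_le hx hy), sub_eq_add_neg,
    red_add hx (by simpa using hy), red_neg hy, ← sub_eq_add_neg, sub_eq_zero]

end Residue

section Field

variable {F : Type*} [NontriviallyNormedField F] [IsUltrametricDist F] {q : ℕ} {π : F}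

namespace IsNormalized

variable (h : IsNormalized q π)
include h

theorem ne_zero : π ≠ 0 := h.unif.1

theorem one_lt : 1 < q := by
  have h1 := h.unif.2.1
  have h0 := norm_pos_iff.2 h.ne_zero
  rw [h.norm] at h1 h0
  have : (0 : ℝ) < q := inv_pos.1 h0
  rw [inv_lt_one₀ this] at h1
  exact_mod_cast h1

theorem pos : (0 : ℝ) < q := by exact_mod_cast h.one_lt.pos

theorem one_lt_real : (1 : ℝ) < q := by exact_mod_cast h.one_lt

theorem card_resField : Nat.card (ResField F) = q := h.card.symm

theorem finite : Finite (ResField F) := by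
  apply Nat.finite_of_card_ne_zero
  rw [h.card_resField]
  exact h.one_lt.pos.ne'

theorem norm_zpow (m : ℤ) : ‖π ^ (-m)‖ = (q : ℝ) ^ m := by
  rw [_root_.norm_zpow, h.norm, inv_zpow', neg_neg]

theorem norm_pow (m : ℕ) : ‖π ^ m‖ = (q : ℝ) ^ (-(m : ℤ)) := by
  rw [← h.norm_zpow, neg_neg, zpow_natCast]

/-- Scaling by a power of π moves the norm into (1/q, 1], and no element has norm strictly between
‖π‖ = 1/q and 1. -/
theorem exists_norm_eq {x : F} (hx : x ≠ 0) : ∃ m : ℤ, ‖x‖ = (q : ℝ) ^ m := by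
  obtain ⟨m, hm1, hm2⟩ := exists_mem_Ioc_zpow (norm_pos_iff.2 hx) h.one_lt_real
  refine ⟨m + 1, le_antisymm hm2 ?_⟩
  by_contra! hlt
  have hx' : ‖x * π ^ (m + 1)‖ < 1 := by
    rw [norm_mul, ← neg_neg (m + 1), h.norm_zpow, zpow_neg, ← div_eq_mul_inv,
      div_lt_one (zpow_pos h.pos _)]
    exact hlt
  have := h.unif.2.2 _ hx'
  rw [norm_mul, ← neg_neg (m + 1), h.norm_zpow, zpow_neg, h.norm, ← div_eq_mul_inv,
    div_le_iff₀ (zpow_pos h.pos _), zpow_add_one₀ h.pos.ne', mul_comm, mul_assoc,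
    mul_inv_cancel₀ h.pos.ne', mul_one] at this
  linarith

theorem zpow_lt_iff {m n : ℤ} : (q : ℝ) ^ m < (q : ℝ) ^ n ↔ m < n :=
  zpow_lt_zpow_iff_right₀ h.one_lt_real

theorem zpow_le_iff {m n : ℤ} : (q : ℝ) ^ m ≤ (q : ℝ) ^ n ↔ m ≤ n :=
  zpow_le_zpow_iff_right₀ h.one_lt_real

theorem zpow_inj_iff {m n : ℤ} : (q : ℝ) ^ m = (q : ℝ) ^ n ↔ m = n :=
  zpow_right_inj₀ h.pos h.one_lt_real.ne'

/-- The value group is discrete, so open balls of radius a power of q are closed balls of the next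
smaller radius. -/
theorem norm_lt_zpow_iff {x : F} {m : ℤ} : ‖x‖ < (q : ℝ) ^ m ↔ ‖x‖ ≤ (q : ℝ) ^ (m - 1) := by
  rcases eq_or_ne x 0 with rfl | hx
  · simp only [norm_zero]
    exact ⟨fun _ => (zpow_pos h.pos _).le, fun _ => zpow_pos h.pos _⟩
  · obtain ⟨k, hk⟩ := h.exists_norm_eq hx
    rw [hk, h.zpow_lt_iff, h.zpow_le_iff]
    omega

theorem ringChar_ne_two : ringChar (ResField F) ≠ 2 := by
  have := h.finite
  have := Fintype.ofFinite (ResField F)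
  intro h2
  have h3 := FiniteField.even_card_of_char_two h2
  have h5 := h.odd
  rw [← h.card_resField, Nat.card_eq_fintype_card, Nat.odd_iff, h3] at h5
  norm_num at h5

theorem norm_two : ‖(2 : F)‖ = 1 := by
  have h2 : ‖(2 : F)‖ ≤ 1 := by
    have := norm_add_le_of_le (a := (1 : F)) (b := 1) norm_one.le norm_one.le
    rwa [one_add_one_eq_two] at this
  refine le_antisymm h2 ?_
  by_contra! hlt
  rw [← red_eq_zero_iff h2, ← one_add_one_eq_two, red_add norm_one.le norm_one.le, red_one,
    one_add_one_eq_two] at hlt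
  exact Ring.two_ne_zero h.ringChar_ne_two hlt

theorem two_ne_zero : (2 : F) ≠ 0 := by
  have := h.norm_two
  intro h0
  simp [h0] at this

/-- Hensel's lemma: an element congruent to the square of a unit is a square. -/
theorem isSquare_of_norm_sub_lt [ProperSpace F] {a b : F} (hb : ‖b‖ = 1)
    (hab : ‖b ^ 2 - a‖ < 1) : IsSquare a := by
  have hcont : ContinuousOn (fun x : F => ‖x ^ 2 - a‖) (Metric.closedBall b ‖π‖) := by fun_prop
  -- Compactness replaces the limit of Newton's iteration: a minimizer of |x² - a| near b must be a
  -- root, since one Newton step would otherwise improve it.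
  obtain ⟨x, hx, hmin⟩ := (isCompact_closedBall b ‖π‖).exists_isMinOn
    (Metric.nonempty_closedBall.2 (norm_nonneg _)) hcont
  have hle : ‖x ^ 2 - a‖ ≤ ‖b ^ 2 - a‖ :=
    hmin (Metric.mem_closedBall_self (norm_nonneg _))
  by_cases h0 : x ^ 2 - a = 0
  · exact ⟨x, by linear_combination -h0⟩
  exfalso
  have hxb : ‖x - b‖ ≤ ‖π‖ := by simpa [dist_eq_norm] using hx
  have hx1 : ‖x‖ = 1 := by
    have := norm_add_eq_left (a := b) (b := x - b) (by rw [hb]; exact hxb.trans_lt h.unif.2.1)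
    rw [← hb, ← this]; congr 1; ring
  have hx0 : x ≠ 0 := by rintro rfl; simp at hx1
  -- The Newton correction. As |2x| = 1, it turns the error |x² - a| into |d|² = |x² - a|², which is
  -- strictly smaller unless the error is 0.
  set d := (a - x ^ 2) / (2 * x) with hd
  have hdn : ‖d‖ = ‖x ^ 2 - a‖ := by
    rw [hd, norm_div, norm_mul, h.norm_two, hx1, norm_sub_rev]; simp
  have hd1 : ‖d‖ < 1 := by rw [hdn]; linarith
  have hmem : x + d ∈ Metric.closedBall b ‖π‖ := by
    rw [mem_closedBall_iff_norm]
    have : x + d - b = (x - b) + d := by ring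
    rw [this]
    exact norm_add_le_of_le hxb (h.unif.2.2 _ hd1)
  have h1 : ‖x ^ 2 - a‖ ≤ ‖(x + d) ^ 2 - a‖ := hmin hmem
  have h2 : (x + d) ^ 2 - a = d ^ 2 := by
    have h2 := h.two_ne_zero
    have : d * (2 * x) = a - x ^ 2 := by rw [hd]; field_simp
    linear_combination this
  rw [h2, _root_.norm_pow, ← hdn] at h1
  have hdpos : 0 < ‖d‖ := by rw [hdn]; exact norm_pos_iff.2 h0
  nlinarith

end IsNormalized

end Field

/-! ### The ramified quadratic character -/

section Chi

variable {F : Type*} [NontriviallyNormedField F] {π : F}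

theorem chi_eq_one_or (x : F) : chi π x = 1 ∨ chi π x = -1 := by
  unfold chi hilbertSymbol
  split_ifs <;> simp

theorem chi_mul_self (x : F) : chi π x * chi π x = 1 := by
  rcases chi_eq_one_or (π := π) x with h | h <;> rw [h] <;> norm_num

theorem chi_ne_zero (x : F) : chi π x ≠ 0 := by
  rcases chi_eq_one_or (π := π) x with h | h <;> rw [h] <;> norm_num

theorem norm_chi (x : F) : ‖chi π x‖ = 1 := by
  rcases chi_eq_one_or (π := π) x with h | h <;> rw [h] <;> simp

theorem chi_congr {x y : F} (h : chi π x = 1 ↔ chi π y = 1) : chi π x = chi π y := by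
  rcases chi_eq_one_or (π := π) x with h1 | h1 <;> rcases chi_eq_one_or (π := π) y with h2 | h2 <;>
    rw [h1, h2] at h ⊢ <;> norm_num at h

theorem chi_eq_one_iff {x : F} : chi π x = 1 ↔
    ∃ a b c : F, (a ≠ 0 ∨ b ≠ 0 ∨ c ≠ 0) ∧ c ^ 2 = π * a ^ 2 + x * b ^ 2 := by
  unfold chi hilbertSymbol
  split_ifs with h
  · simpa using h
  · simp only [h, iff_false]; norm_num

theorem chi_mul_sq (b : F) {c : F} (hc : c ≠ 0) : chi π (b * c ^ 2) = chi π b := by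
  apply chi_congr
  rw [chi_eq_one_iff, chi_eq_one_iff]
  constructor
  · rintro ⟨x, y, z, h0, h⟩
    exact ⟨x, c * y, z, by simpa [hc] using h0, by rw [h]; ring⟩
  · rintro ⟨x, y, z, h0, h⟩
    exact ⟨x, y / c, z, by simpa [hc] using h0, by rw [h]; field_simp⟩

/-- The relation ⟨π, -π⟩ = 1 in disguise: multiplying z² = πx² + πby² by π exchanges the roles of z
and πx. -/
theorem chi_mul_self_right (hπ : π ≠ 0) (b : F) : chi π (π * b) = chi π (-b) := by
  apply chi_congr
  rw [chi_eq_one_iff, chi_eq_one_iff]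
  constructor
  · rintro ⟨x, y, z, h0, h⟩
    exact ⟨z, π * y, π * x, by simp only [ne_eq, mul_eq_zero, hπ, false_or]; tauto, by
      rw [h]; ring⟩
  · rintro ⟨x, y, z, h0, h⟩
    refine ⟨z / π, y / π, x, by simp only [ne_eq, div_eq_zero_iff, hπ, or_false]; tauto, ?_⟩
    field_simp
    rw [h]
    ring

theorem chi_isSquare {x : F} (hx : IsSquare x) : chi π x = 1 := by
  obtain ⟨y, rfl⟩ := hx
  exact chi_eq_one_iff.2 ⟨0, 1, y, by simp, by ring⟩

variable [IsUltrametricDist F] [ProperSpace F] {q : ℕ}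

namespace IsNormalized

variable (h : IsNormalized q π)
include h

theorem isSquare_of_isSquare_red {u : F} (hu : ‖u‖ = 1) (hs : IsSquare (red u)) : IsSquare u := by
  obtain ⟨r, hr⟩ := hs
  obtain ⟨b, hb, rfl⟩ := red_surjective r
  have hb1 : ‖b‖ = 1 := by
    refine le_antisymm hb ?_
    by_contra! hlt
    rw [(red_eq_zero_iff hb).2 hlt, zero_mul] at hr
    exact red_ne_zero hu hr
  refine h.isSquare_of_norm_sub_lt hb1 ?_
  rw [← red_eq_red_iff (by simp [hb1]) hu.le, hr, pow_two, red_mul hb hb]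

/-- In a nontrivial solution of z² = πx² + uy², nonzero terms on the right have norms of opposite
parity as powers of q. The larger one has the norm of a square, hence is uy², and z/y is then an
approximate square root of u. -/
theorem isSquare_of_chi_eq_one {u : F} (hu : ‖u‖ = 1) (hc : chi π u = 1) : IsSquare u := by
  obtain ⟨x, y, z, h0, he⟩ := chi_eq_one_iff.1 hc
  have hu0 : u ≠ 0 := by rintro rfl; simp at hu
  have hne : ‖π * x ^ 2‖ ≠ ‖u * y ^ 2‖ ∨ x = 0 ∧ y = 0 := by
    by_cases hx : x = 0
    · by_cases hy : y = 0
      · exact Or.inr ⟨hx, hy⟩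
      · left; simp [hx, hy, hu0]
    · left
      by_cases hy : y = 0
      · simp [hx, hy, h.ne_zero]
      obtain ⟨m, hm⟩ := h.exists_norm_eq hx
      obtain ⟨n, hn⟩ := h.exists_norm_eq hy
      rw [norm_mul, norm_mul, _root_.norm_pow, _root_.norm_pow, hm, hn, hu, h.norm, one_mul,
        ← zpow_neg_one, ← zpow_natCast, ← zpow_natCast, ← zpow_mul, ← zpow_mul,
        ← zpow_add₀ h.pos.ne', ne_eq, h.zpow_inj_iff]
      push_cast
      omega
  rcases hne with hne | ⟨rfl, rfl⟩
  swap
  · simp at he; simp [he] at h0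
  have hmax := IsUltrametricDist.norm_add_eq_max_of_norm_ne_norm hne
  rw [← he] at hmax
  rcases le_total ‖π * x ^ 2‖ ‖u * y ^ 2‖ with hle | hle
  · have hlt := lt_of_le_of_ne hle hne
    have hy0 : y ≠ 0 := by rintro rfl; simp only [ne_eq, OfNat.ofNat_ne_zero, not_false_eq_true, zero_pow, mul_zero, norm_zero] at hlt; exact absurd hlt (not_lt.2 (norm_nonneg _))
    rw [max_eq_right hle, norm_mul, hu, one_mul, _root_.norm_pow, _root_.norm_pow] at hmax
    have hzy : ‖z‖ = ‖y‖ := (pow_left_inj₀ (norm_nonneg _) (norm_nonneg _) (by norm_num)).1 hmax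
    refine h.isSquare_of_norm_sub_lt (b := z / y) ?_ ?_
    · rw [norm_div, hzy, div_self (norm_ne_zero_iff.2 hy0)]
    · have : (z / y) ^ 2 - u = π * x ^ 2 / y ^ 2 := by
        field_simp; rw [he]; ring
      rw [this, norm_div, div_lt_one (norm_pos_iff.2 (pow_ne_zero _ hy0))]
      rwa [norm_mul u, hu, one_mul] at hlt
  · exfalso
    have hx : x ≠ 0 := by
      rintro rfl
      apply hne
      simp only [ne_eq, OfNat.ofNat_ne_zero, not_false_eq_true, zero_pow, mul_zero, norm_zero] at hle ⊢
      exact (le_antisymm hle (norm_nonneg _)).symm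
    rw [max_eq_left hle, norm_mul, _root_.norm_pow, _root_.norm_pow] at hmax
    have hz : z ≠ 0 := by
      rintro rfl
      simp only [norm_zero, ne_eq, OfNat.ofNat_ne_zero, not_false_eq_true, zero_pow] at hmax
      have : 0 < ‖π‖ * ‖x‖ ^ 2 := mul_pos (norm_pos_iff.2 h.ne_zero)
        (pow_pos (norm_pos_iff.2 hx) _)
      linarith
    obtain ⟨m, hm⟩ := h.exists_norm_eq hx
    obtain ⟨n, hn⟩ := h.exists_norm_eq hz
    rw [hm, hn, h.norm, ← zpow_neg_one, ← zpow_natCast, ← zpow_natCast, ← zpow_mul, ← zpow_mul,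
        ← zpow_add₀ h.pos.ne', h.zpow_inj_iff] at hmax
    push_cast at hmax
    omega

theorem isSquare_red {u : F} (hu : ‖u‖ = 1) (hs : IsSquare u) : IsSquare (red u) := by
  obtain ⟨b, rfl⟩ := hs
  have hb : ‖b‖ = 1 := by
    rw [norm_mul] at hu
    nlinarith [norm_nonneg b]
  exact ⟨red b, red_mul hb.le hb.le⟩

theorem chi_unit_eq_one_iff {u : F} (hu : ‖u‖ = 1) : chi π u = 1 ↔ IsSquare (red u) :=
  ⟨fun hc => h.isSquare_red hu (h.isSquare_of_chi_eq_one hu hc),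
    fun hs => chi_isSquare (h.isSquare_of_isSquare_red hu hs)⟩

theorem chi_unit [Fintype (ResField F)] [DecidableEq (ResField F)] {u : F} (hu : ‖u‖ = 1) :
    chi π u = (quadraticChar (ResField F) (red u) : ℂ) := by
  rcases quadraticChar_dichotomy (red_ne_zero hu) with h1 | h1
  · rw [h1, Int.cast_one, h.chi_unit_eq_one_iff hu]
    exact (quadraticChar_one_iff_isSquare (red_ne_zero hu)).1 h1
  · rw [h1]
    rcases chi_eq_one_or (π := π) u with h2 | h2
    · rw [h.chi_unit_eq_one_iff hu, ← quadraticChar_one_iff_isSquare (red_ne_zero hu), h1] at h2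
      norm_num at h2
    · rw [h2]; simp

theorem chi_unit_mul {u v : F} (hu : ‖u‖ = 1) (hv : ‖v‖ = 1) :
    chi π (u * v) = chi π u * chi π v := by
  classical
  have := h.finite
  have := Fintype.ofFinite (ResField F)
  rw [h.chi_unit hu, h.chi_unit hv, h.chi_unit (by rw [norm_mul, hu, hv, one_mul]),
    red_mul hu.le hv.le, map_mul, Int.cast_mul]

theorem exists_eq_unit_mul_sq {a : F} (ha : a ≠ 0) :
    ∃ u c : F, ‖u‖ = 1 ∧ c ≠ 0 ∧ (a = u * c ^ 2 ∨ a = π * u * c ^ 2) := by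
  obtain ⟨m, hm⟩ := h.exists_norm_eq ha
  have hpow (k : ℤ) : π ^ k ≠ 0 := zpow_ne_zero _ h.ne_zero
  have hu : ‖a * π ^ m‖ = 1 := by
    rw [norm_mul, hm, ← neg_neg m, h.norm_zpow, neg_neg, ← zpow_add₀ h.pos.ne']; simp
  rcases Int.even_or_odd' (-m) with ⟨k, hk | hk⟩
  · refine ⟨a * π ^ m, π ^ k, hu, hpow k, Or.inl ?_⟩
    rw [← zpow_natCast, ← zpow_mul, mul_assoc, ← zpow_add₀ h.ne_zero]
    have : m + k * (2 : ℕ) = 0 := by push_cast; omega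
    rw [this]; simp
  · refine ⟨a * π ^ m, π ^ k, hu, hpow k, Or.inr ?_⟩
    have : π * (a * π ^ m) * (π ^ k) ^ 2 = a * (π ^ (1 : ℤ) * π ^ m * π ^ (k * (2 : ℕ))) := by
      rw [zpow_mul, zpow_natCast, zpow_one]; ring
    rw [this, ← zpow_add₀ h.ne_zero, ← zpow_add₀ h.ne_zero]
    have : 1 + m + k * (2 : ℕ) = 0 := by push_cast; omega
    rw [this]; simp

/-- Modulo squares each argument is a unit u or πu, and πu may be replaced by -u. So only units
remain, where χ is the quadratic character of the residue field. -/
theorem chi_mul {a b : F} (ha : a ≠ 0) (hb : b ≠ 0) : chi π (a * b) = chi π a * chi π b := by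
  obtain ⟨u, c, hu, hc, hac⟩ := h.exists_eq_unit_mul_sq ha
  obtain ⟨v, d, hv, hd, hbd⟩ := h.exists_eq_unit_mul_sq hb
  have hnu : ‖-u‖ = 1 := by simpa using hu
  have hnv : ‖-v‖ = 1 := by simpa using hv
  rcases hac with rfl | rfl <;> rcases hbd with rfl | rfl
  · rw [show u * c ^ 2 * (v * d ^ 2) = u * v * (c * d) ^ 2 by ring,
      chi_mul_sq _ (mul_ne_zero hc hd), chi_mul_sq _ hc, chi_mul_sq _ hd, h.chi_unit_mul hu hv]
  · rw [show u * c ^ 2 * (π * v * d ^ 2) = π * (u * v) * (c * d) ^ 2 by ring,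
      chi_mul_sq _ (mul_ne_zero hc hd), chi_mul_sq _ hc, chi_mul_sq _ hd,
      chi_mul_self_right h.ne_zero, chi_mul_self_right h.ne_zero, ← mul_neg, h.chi_unit_mul hu hnv]
  · rw [show π * u * c ^ 2 * (v * d ^ 2) = π * (u * v) * (c * d) ^ 2 by ring,
      chi_mul_sq _ (mul_ne_zero hc hd), chi_mul_sq _ hc, chi_mul_sq _ hd,
      chi_mul_self_right h.ne_zero, chi_mul_self_right h.ne_zero, ← neg_mul, h.chi_unit_mul hnu hv]
  · rw [show π * u * c ^ 2 * (π * v * d ^ 2) = (-u) * (-v) * (π * c * d) ^ 2 by ring,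
      chi_mul_sq _ (mul_ne_zero (mul_ne_zero h.ne_zero hc) hd), chi_mul_sq _ hc, chi_mul_sq _ hd,
      chi_mul_self_right h.ne_zero, chi_mul_self_right h.ne_zero, h.chi_unit_mul hnu hnv]

theorem chi_one : chi π (1 : F) = 1 := chi_isSquare ⟨1, by simp⟩

theorem chi_prime : chi π π = chi π (-1) := by
  simpa using chi_mul_self_right h.ne_zero (1 : F)

theorem chi_inv {a : F} (ha : a ≠ 0) : chi π a⁻¹ = chi π a := by
  have := chi_mul_sq (π := π) a⁻¹ ha
  rw [← this]; congr 1; field_simp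

theorem chi_neg {a : F} (ha : a ≠ 0) : chi π (-a) = chi π (-1) * chi π a := by
  rw [← h.chi_mul (by simp) ha]; simp

theorem chi_pow {a : F} (ha : a ≠ 0) (n : ℕ) : chi π (a ^ n) = chi π a ^ n := by
  induction n with
  | zero => simpa using h.chi_one
  | succ n ih => rw [pow_succ, h.chi_mul (pow_ne_zero _ ha) ha, ih, pow_succ]

/-- `χ` is constant on balls not containing `0`. -/
theorem chi_eq_of_norm_sub_lt {a b : F} (hab : ‖a - b‖ < ‖a‖) : chi π a = chi π b := by
  have ha : a ≠ 0 := by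
    rintro rfl
    simp only [norm_zero] at hab
    exact absurd hab (not_lt.2 (norm_nonneg _))
  have hb : b ≠ 0 := by
    rw [← norm_ne_zero_iff, norm_eq_of_norm_sub_lt hab]; exact norm_ne_zero_iff.2 ha
  -- The quotient lies in 1 + 𝔭, which consists of squares by Hensel's lemma.
  have h1 : IsSquare (b / a) := by
    refine h.isSquare_of_norm_sub_lt norm_one ?_
    have : 1 ^ 2 - b / a = (a - b) / a := by field_simp
    rw [this, norm_div, div_lt_one (norm_pos_iff.2 ha)]
    exact hab
  have h2 : b = a * (b / a) := by field_simp
  rw [h2, h.chi_mul ha (div_ne_zero hb ha), chi_isSquare h1, mul_one]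

theorem exists_chi_eq_neg_one : ∃ u : F, ‖u‖ = 1 ∧ chi π u = -1 := by
  classical
  have := h.finite
  have := Fintype.ofFinite (ResField F)
  obtain ⟨r, hr⟩ := quadraticChar_exists_neg_one h.ringChar_ne_two
  obtain ⟨u, hu, rfl⟩ := red_surjective r
  have hu1 : ‖u‖ = 1 := by
    refine le_antisymm hu ?_
    by_contra! hlt
    rw [(red_eq_zero_iff hu).2 hlt] at hr
    simp at hr
  exact ⟨u, hu1, by rw [h.chi_unit hu1, hr]; simp⟩

end IsNormalized

end Chi

end RamifiedSiegel

namespace RamifiedSiegel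

open Metric

/-! ### Haar measure: scaling, and volumes of balls, spheres and residue classes. -/

section Haar

variable {F : Type*} [NontriviallyNormedField F] [ProperSpace F] [MeasurableSpace F] [BorelSpace F]

instance : (haarF F).IsAddHaarMeasure := by
  unfold haarF; infer_instance

theorem haarF_closedBall_one : haarF F (closedBall 0 1) = 1 :=
  Measure.addHaarMeasure_self (K₀ := ⟨⟨Metric.closedBall (0 : F) 1, isCompact_closedBall 0 1⟩,
      ⟨0, Metric.ball_subset_interior_closedBall (Metric.mem_ball_self one_pos)⟩⟩)

/-- Uniqueness of Haar measure. The factor stays the volume of a ball here; identifying it with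
‖a‖⁻¹ needs the count of residue classes below. -/
theorem map_mulLeft_haarF {a : F} (ha : a ≠ 0) :
    (haarF F).map (MeasurableEquiv.mulLeft₀ a ha) = haarF F (closedBall 0 ‖a‖⁻¹) • haarF F := by
  have : ((haarF F).map (MeasurableEquiv.mulLeft₀ a ha)).IsAddHaarMeasure :=
    AddEquiv.isAddHaarMeasure_map (haarF F)
      { (AddMonoidHom.mulLeft a : F →+ F) with
        invFun := fun x => a⁻¹ * x
        left_inv := fun x => by simp [ha]
        right_inv := fun x => by simp [ha] : F ≃+ F }
      (continuous_const_mul a) (continuous_const_mul a⁻¹)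
  have h := Measure.addHaarMeasure_unique ((haarF F).map (MeasurableEquiv.mulLeft₀ a ha))
    ⟨⟨Metric.closedBall (0 : F) 1, isCompact_closedBall 0 1⟩,
      ⟨0, Metric.ball_subset_interior_closedBall (Metric.mem_ball_self one_pos)⟩⟩
  refine h.trans ?_
  congr 1
  change Measure.map _ _ (closedBall (0 : F) 1) = _
  rw [MeasurableEquiv.map_apply]
  congr 1
  ext x
  have ha' := norm_pos_iff.2 ha
  simp only [Set.mem_preimage, MeasurableEquiv.coe_mulLeft₀, mem_closedBall, dist_zero_right,
    norm_mul]
  rw [← mul_one ‖a‖⁻¹, inv_mul_eq_div, le_div_iff₀' ha']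

theorem haarF_closedBall_center (x : F) (r : ℝ) :
    haarF F (closedBall x r) = haarF F (closedBall 0 r) := by
  rw [← measure_preimage_add (haarF F) x (closedBall x r)]
  congr 1
  ext y
  simp

theorem haarF_closedBall_mul {a : F} (ha : a ≠ 0) (r : ℝ) :
    haarF F (closedBall 0 (‖a‖⁻¹ * r)) =
      haarF F (closedBall 0 ‖a‖⁻¹) * haarF F (closedBall 0 r) := by
  have h := congrArg (fun μ => μ (closedBall (0 : F) r)) (map_mulLeft_haarF ha)
  simp only [MeasurableEquiv.map_apply, Measure.smul_apply, smul_eq_mul] at h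
  rw [← h]
  congr 1
  ext x
  have ha' := norm_pos_iff.2 ha
  simp only [Set.mem_preimage, MeasurableEquiv.coe_mulLeft₀, mem_closedBall, dist_zero_right,
    norm_mul]
  rw [inv_mul_eq_div, le_div_iff₀' ha']

variable [IsUltrametricDist F]

theorem measurableSet_red (r : ResField F) : MeasurableSet {x : F | ‖x‖ ≤ 1 ∧ red x = r} := by
  obtain ⟨y, hy, rfl⟩ := red_surjective r
  have : {x : F | ‖x‖ ≤ 1 ∧ red x = red y} = ball y 1 := by
    ext x
    simp only [Set.mem_ofPred_eq, mem_ball, dist_eq_norm]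
    constructor
    · rintro ⟨hx, hxy⟩
      exact (red_eq_red_iff hx hy).1 hxy
    · intro hxy
      have hx : ‖x‖ ≤ 1 := by
        simpa using norm_add_le_of_le hxy.le hy
      exact ⟨hx, (red_eq_red_iff hx hy).2 hxy⟩
  rw [this]
  exact measurableSet_ball

theorem closedBall_eq_iUnion_red :
    closedBall (0 : F) 1 = ⋃ r : ResField F, {x : F | ‖x‖ ≤ 1 ∧ red x = r} := by
  ext x
  simp

theorem pairwise_disjoint_red :
    Pairwise (Function.onFun Disjoint fun r : ResField F => {x : F | ‖x‖ ≤ 1 ∧ red x = r}) := by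
  intro r s hrs
  rw [Function.onFun, Set.disjoint_left]
  rintro x ⟨_, rfl⟩ ⟨_, h⟩
  exact hrs h

namespace IsNormalized

variable {q : ℕ} {π : F} (h : IsNormalized q π)
include h

theorem haarF_red (r : ResField F) :
    haarF F {x : F | ‖x‖ ≤ 1 ∧ red x = r} = haarF F (closedBall 0 (q : ℝ)⁻¹) := by
  obtain ⟨y, hy, rfl⟩ := red_surjective r
  rw [← haarF_closedBall_center y]
  congr 1
  ext x
  rw [Set.mem_ofPred_eq, mem_closedBall, dist_eq_norm]
  have hb : ‖x - y‖ < 1 ↔ ‖x - y‖ ≤ (q : ℝ)⁻¹ := by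
    simpa using h.norm_lt_zpow_iff (x := x - y) (m := 0)
  rw [← hb]
  constructor
  · rintro ⟨hx, hxy⟩
    exact (red_eq_red_iff hx hy).1 hxy
  · intro hxy
    have hx : ‖x‖ ≤ 1 := by
      simpa using norm_add_le_of_le hxy.le hy
    exact ⟨hx, (red_eq_red_iff hx hy).2 hxy⟩

/-- The q residue classes are translates of 𝔭 that partition 𝔬, which has volume 1. -/
theorem haarF_closedBall_inv : haarF F (closedBall 0 (q : ℝ)⁻¹) = (q : ENNReal)⁻¹ := by
  have := h.finite
  have := Fintype.ofFinite (ResField F)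
  have h1 := haarF_closedBall_one (F := F)
  rw [closedBall_eq_iUnion_red, measure_iUnion pairwise_disjoint_red measurableSet_red,
    tsum_fintype] at h1
  simp only [h.haarF_red, Finset.sum_const, Finset.card_univ, nsmul_eq_mul] at h1
  rw [← Nat.card_eq_fintype_card, h.card_resField] at h1
  exact ENNReal.eq_inv_of_mul_eq_one_left (by rwa [mul_comm])

theorem haarF_closedBall_zpow (x : F) (m : ℤ) :
    haarF F (closedBall x ((q : ℝ) ^ m)) = ENNReal.ofReal ((q : ℝ) ^ m) := by
  rw [haarF_closedBall_center]
  have hq0 : (q : ENNReal) ≠ 0 := by exact_mod_cast h.one_lt.pos.ne'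
  have hqt : (q : ENNReal) ≠ ⊤ := ENNReal.natCast_ne_top q
  have key : ∀ n : ℤ, haarF F (closedBall (0 : F) ((q : ℝ) ^ (n - 1))) =
      (q : ENNReal)⁻¹ * haarF F (closedBall (0 : F) ((q : ℝ) ^ n)) := by
    intro n
    have h1 := haarF_closedBall_mul (F := F) (inv_ne_zero h.ne_zero) ((q : ℝ) ^ n)
    rw [norm_inv, inv_inv, h.norm, h.haarF_closedBall_inv] at h1
    rw [← h1, zpow_sub_one₀ h.pos.ne', mul_comm]
  have hr : ENNReal.ofReal ((q : ℝ) ^ m) = (q : ENNReal) ^ m := by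
    have : (q : ℝ) ^ m = (((q : NNReal) ^ m : NNReal) : ℝ) := by push_cast; rfl
    rw [this, ENNReal.ofReal_coe_nnreal, ENNReal.coe_zpow (by exact_mod_cast h.one_lt.pos.ne'),
      ENNReal.coe_natCast]
  rw [hr]
  clear hr
  induction m using Int.induction_on with
  | zero => simpa using haarF_closedBall_one
  | succ n ih =>
    have := key (n + 1)
    rw [add_sub_cancel_right, ih] at this
    rw [ENNReal.zpow_add hq0 hqt, this, mul_comm, ← mul_assoc, zpow_one,
      ENNReal.mul_inv_cancel hq0 hqt, one_mul]
  | pred n ih =>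
    rw [key, ih, sub_eq_add_neg, ENNReal.zpow_add hq0 hqt, mul_comm, zpow_neg_one]

theorem real_closedBall_zpow (x : F) (m : ℤ) :
    (haarF F).real (closedBall x ((q : ℝ) ^ m)) = (q : ℝ) ^ m := by
  rw [Measure.real, h.haarF_closedBall_zpow, ENNReal.toReal_ofReal (zpow_pos h.pos _).le]

theorem haarF_closedBall_norm {a : F} (ha : a ≠ 0) :
    haarF F (closedBall 0 ‖a‖) = ENNReal.ofReal ‖a‖ := by
  obtain ⟨m, hm⟩ := h.exists_norm_eq ha
  rw [hm, h.haarF_closedBall_zpow]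

theorem integral_comp_mul {a : F} (ha : a ≠ 0) (f : F → ℂ) :
    ∫ x, f (a * x) ∂haarF F = (‖a‖ : ℂ)⁻¹ * ∫ x, f x ∂haarF F := by
  have h1 := integral_map_equiv (μ := haarF F) (MeasurableEquiv.mulLeft₀ a ha) f
  rw [map_mulLeft_haarF ha, ← norm_inv, h.haarF_closedBall_norm (inv_ne_zero ha),
    integral_smul_measure, ENNReal.toReal_ofReal (norm_nonneg _)] at h1
  rw [MeasurableEquiv.coe_mulLeft₀] at h1
  rw [← h1, norm_inv, Complex.real_smul, Complex.ofReal_inv]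

theorem setIntegral_comp_mul {a : F} (ha : a ≠ 0) (f : F → ℂ) {s : Set F} (hs : MeasurableSet s) :
    ∫ x in (a * ·) ⁻¹' s, f (a * x) ∂haarF F = (‖a‖ : ℂ)⁻¹ * ∫ x in s, f x ∂haarF F := by
  rw [← integral_indicator hs, ← h.integral_comp_mul ha, ← integral_indicator
    ((measurable_const_mul a) hs)]
  rfl

theorem integral_closedBall_mul {a : F} (ha : a ≠ 0) (f : F → ℂ) (r : ℝ) :
    ∫ x in closedBall 0 r, f x ∂haarF F =
      ‖a‖ * ∫ x in closedBall 0 (‖a‖⁻¹ * r), f (a * x) ∂haarF F := by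
  have ha' := norm_pos_iff.2 ha
  have hs : closedBall (0 : F) (‖a‖⁻¹ * r) = (a * ·) ⁻¹' closedBall 0 r := by
    ext x
    simp only [Set.mem_preimage, mem_closedBall, dist_zero_right, norm_mul]
    rw [inv_mul_eq_div, le_div_iff₀' ha']
  rw [hs, h.setIntegral_comp_mul ha f measurableSet_closedBall, ← mul_assoc, mul_inv_cancel₀, one_mul]
  exact_mod_cast ha'.ne'

theorem integral_sphere_mul {a : F} (ha : a ≠ 0) (f : F → ℂ) (r : ℝ) :
    ∫ x in sphere 0 r, f x ∂haarF F =
      ‖a‖ * ∫ x in sphere 0 (‖a‖⁻¹ * r), f (a * x) ∂haarF F := by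
  have ha' := norm_pos_iff.2 ha
  have hs : sphere (0 : F) (‖a‖⁻¹ * r) = (a * ·) ⁻¹' sphere 0 r := by
    ext x
    simp only [Set.mem_preimage, mem_sphere, dist_zero_right, norm_mul]
    rw [inv_mul_eq_div, eq_div_iff ha'.ne', mul_comm]
  rw [hs, h.setIntegral_comp_mul ha f isClosed_sphere.measurableSet, ← mul_assoc, mul_inv_cancel₀,
    one_mul]
  exact_mod_cast ha'.ne'

theorem closedBall_diff (m : ℤ) : closedBall (0 : F) ((q : ℝ) ^ m) \ closedBall 0 ((q : ℝ) ^ (m - 1)) =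
    sphere 0 ((q : ℝ) ^ m) := by
  ext x
  simp only [Set.mem_sdiff, mem_closedBall, dist_zero_right, ← h.norm_lt_zpow_iff, not_lt, mem_sphere]
  exact ⟨fun h => le_antisymm h.1 h.2, fun h => ⟨h.le, h.ge⟩⟩

theorem closedBall_subset (m : ℤ) :
    closedBall (0 : F) ((q : ℝ) ^ (m - 1)) ⊆ closedBall 0 ((q : ℝ) ^ m) :=
  closedBall_subset_closedBall (h.zpow_le_iff.2 (by omega))

theorem integral_sphere_eq_sub {f : F → ℂ} (m : ℤ)
    (hf : IntegrableOn f (closedBall 0 ((q : ℝ) ^ m)) (haarF F)) :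
    ∫ x in sphere 0 ((q : ℝ) ^ m), f x ∂haarF F =
      ∫ x in closedBall 0 ((q : ℝ) ^ m), f x ∂haarF F -
        ∫ x in closedBall 0 ((q : ℝ) ^ (m - 1)), f x ∂haarF F := by
  rw [← h.closedBall_diff, setIntegral_sdiff measurableSet_closedBall hf (h.closedBall_subset m)]

theorem haarF_sphere (m : ℤ) :
    haarF F (sphere 0 ((q : ℝ) ^ m)) = ENNReal.ofReal ((q : ℝ) ^ m - (q : ℝ) ^ (m - 1)) := by
  rw [← h.closedBall_diff, measure_sdiff (h.closedBall_subset m)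
    measurableSet_closedBall.nullMeasurableSet (by rw [h.haarF_closedBall_zpow]; simp),
    h.haarF_closedBall_zpow, h.haarF_closedBall_zpow, ENNReal.ofReal_sub _ (zpow_pos h.pos _).le]

theorem real_sphere (m : ℤ) :
    (haarF F).real (sphere 0 ((q : ℝ) ^ m)) = (q : ℝ) ^ m - (q : ℝ) ^ (m - 1) := by
  rw [Measure.real, h.haarF_sphere, ENNReal.toReal_ofReal]
  rw [sub_nonneg, h.zpow_le_iff]; omega

theorem haarF_sphere_lt_top (m : ℤ) : haarF F (sphere 0 ((q : ℝ) ^ m)) < ⊤ := by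
  rw [h.haarF_sphere]; simp

/-- The integral over the ring of integers of a function of the residue class. -/
theorem integral_comp_red [Fintype (ResField F)] (g : ResField F → ℂ) :
    ∫ x in closedBall (0 : F) 1, g (red x) ∂haarF F = (q : ℂ)⁻¹ * ∑ r, g r := by
  have hconst (r : ResField F) : ∀ x ∈ {x : F | ‖x‖ ≤ 1 ∧ red x = r}, g (red x) = g r :=
    fun x hx => by rw [hx.2]
  rw [closedBall_eq_iUnion_red, integral_iUnion_fintype measurableSet_red pairwise_disjoint_red,
    Finset.mul_sum]
  · refine Finset.sum_congr rfl fun r _ => ?_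
    rw [setIntegral_congr_fun (measurableSet_red r) (hconst r), setIntegral_const, Measure.real,
      h.haarF_red, h.haarF_closedBall_inv, Complex.real_smul]
    simp
  · intro r
    refine IntegrableOn.congr_fun (f := fun _ => g r) ?_ (fun x hx => (hconst r x hx).symm)
      (measurableSet_red r)
    refine integrableOn_const ?_
    rw [h.haarF_red, h.haarF_closedBall_inv]
    simp [h.one_lt.pos.ne']

end IsNormalized

/-- If the averages of `f` over all translates of `H` vanish, so does the integral of `f`. -/
theorem integral_eq_zero_of_forall_integral_translate {f : F → ℂ} (hf : Integrable f (haarF F))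
    {H : Set F} (hH0 : haarF F H ≠ 0) (hHt : haarF F H ≠ ⊤)
    (h : ∀ y, ∫ x in H, f (x + y) ∂haarF F = 0) : ∫ y, f y ∂haarF F = 0 := by
  have : IsFiniteMeasure ((haarF F).restrict H) := ⟨by simpa using hHt.lt_top⟩
  -- Integrating f(x + y) over H × F in one order gives 0, and in the other vol(H) ∫ f.
  have h1 : Integrable (fun z : F × F => f (z.1 + z.2)) (((haarF F).restrict H).prod (haarF F)) :=
    (measurePreserving_prod_add ((haarF F).restrict H) (haarF F)).integrable_comp_of_integrable
      (hf.comp_snd ((haarF F).restrict H))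
  have h2 := integral_integral_swap (f := fun x y => f (x + y)) h1
  simp only [h, integral_zero, integral_add_left_eq_self, setIntegral_const] at h2
  rcases smul_eq_zero.1 h2 with h3 | h3
  · exact absurd h3 ((measureReal_ne_zero_iff hHt).2 hH0)
  · exact h3

end Haar

end RamifiedSiegel

namespace RamifiedSiegel

open Metric

/-- A normalized local field with an additive character of order `0`. -/
structure IsNormalizedWith {F : Type*} [NontriviallyNormedField F] [IsUltrametricDist F]
    (q : ℕ) (π : F) (ψ : AddChar F Circle) : Prop extends IsNormalized q π where
  continuous : Continuous ψ
  order : HasOrderZero ψ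

/-! ### Integrals of ψ, of χψ and of ψ(ay²) over balls and spheres. -/

section Translation

variable {F : Type*} [NontriviallyNormedField F] [ProperSpace F] [MeasurableSpace F] [BorelSpace F]

/-- Translation invariance gives I = cI with c ≠ 1. This is the orthogonality argument behind the
vanishing of character integrals. -/
theorem setIntegral_eq_zero_of_translate {s : Set F} (hs : MeasurableSet s) {f : F → ℂ} {t : F}
    {c : ℂ} (hc : c ≠ 1) (hst : ∀ x, x + t ∈ s ↔ x ∈ s) (hf : ∀ x ∈ s, f (x + t) = c * f x) :
    ∫ x in s, f x ∂haarF F = 0 := by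
  have h1 : ∫ x in s, f x ∂haarF F = c * ∫ x in s, f x ∂haarF F := by
    rw [← integral_indicator hs, ← integral_const_mul]
    conv_lhs => rw [← integral_add_right_eq_self _ t]
    congr 1
    ext x
    by_cases hx : x ∈ s
    · rw [Set.indicator_of_mem ((hst x).2 hx), Set.indicator_of_mem hx, hf x hx]
    · rw [Set.indicator_of_notMem (fun h => hx ((hst x).1 h)), Set.indicator_of_notMem hx, mul_zero]
  have h2 : (c - 1) * ∫ x in s, f x ∂haarF F = 0 := by linear_combination -h1
  exact (mul_eq_zero.1 h2).resolve_left (sub_ne_zero.2 hc)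

theorem integrableOn_of_norm_le {s : Set F} (hs : haarF F s < ⊤) {f : F → ℂ} (hf : Measurable f)
    {C : ℝ} (hC : ∀ x, ‖f x‖ ≤ C) : IntegrableOn f s (haarF F) :=
  Measure.integrableOn_of_bounded hs.ne hf.aestronglyMeasurable (Filter.Eventually.of_forall hC)

end Translation

section Integrals

variable {F : Type*} [NontriviallyNormedField F] [ProperSpace F] [MeasurableSpace F] [BorelSpace F]
variable [IsUltrametricDist F] {q : ℕ} {π : F} {ψ : AddChar F Circle}

theorem IsNormalized.measurable_chi (h : IsNormalized q π) : Measurable (chi π : F → ℂ) := by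
  classical
  have hopen : IsOpen {x : F | chi π x = 1}ᶜ := by
    rw [Metric.isOpen_iff]
    intro x hx
    -- By the definition of the symbol χ(0) = 1, so 0 lies in the level set {χ = 1} and causes no
    -- trouble in its complement, near whose points χ is locally constant.
    have hx0 : x ≠ 0 := by
      rintro rfl
      exact hx (chi_isSquare ⟨0, by simp⟩)
    refine ⟨‖x‖, norm_pos_iff.2 hx0, fun y hy => ?_⟩
    rw [mem_ball, dist_comm, dist_eq_norm] at hy
    simpa [h.chi_eq_of_norm_sub_lt hy] using hx
  have hm : MeasurableSet {x : F | chi π x = 1} := by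
    rw [← compl_compl {x : F | chi π x = 1}]
    exact hopen.measurableSet.compl
  have : (chi π : F → ℂ) = fun x => if x ∈ {x : F | chi π x = 1} then 1 else -1 := by
    ext x
    split_ifs with hx
    · exact hx
    · exact (chi_eq_one_or x).resolve_left hx
  rw [this]
  exact Measurable.ite hm measurable_const measurable_const

theorem sphere_add_mem {r : ℝ} {x t : F} (ht : ‖t‖ < r) :
    x + t ∈ sphere (0 : F) r ↔ x ∈ sphere (0 : F) r := by
  simp only [mem_sphere, dist_zero_right]
  constructor
  · intro hx
    have := norm_sub_eq_left (a := x + t) (b := t) (by rwa [hx])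
    rw [← hx, ← this]; congr 1; ring
  · intro hx
    rw [norm_add_eq_left (by rwa [hx]), hx]

theorem closedBall_add_mem {r : ℝ} {x t : F} (ht : ‖t‖ ≤ r) :
    x + t ∈ closedBall (0 : F) r ↔ x ∈ closedBall (0 : F) r := by
  simp only [mem_closedBall, dist_zero_right]
  constructor
  · intro hx
    have := norm_sub_le_of_le hx ht
    simpa using this
  · intro hx
    exact norm_add_le_of_le hx ht

/-- The quadratic Gauss integral over the sphere of radius `q`. -/
def gaussInt (π : F) (ψ : AddChar F Circle) : ℂ :=
  ∫ x in sphere (0 : F) ‖π‖⁻¹, chi π x * (ψ x : ℂ) ∂haarF F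

/-- The integral of `ψ(a y²)` over the ring of integers. -/
def quadInt (ψ : AddChar F Circle) (a : F) : ℂ :=
  ∫ y in closedBall (0 : F) 1, (ψ (a * y ^ 2) : ℂ) ∂haarF F

namespace IsNormalizedWith

variable (h : IsNormalizedWith q π ψ)
include h

theorem psi_eq_one {x : F} (hx : ‖x‖ ≤ 1) : ψ x = 1 := h.order.1 x hx

theorem psi_congr {x y : F} (hxy : ‖x - y‖ ≤ 1) : ψ x = ψ y := by
  have : x = y + (x - y) := by ring
  rw [this, AddChar.map_add_eq_mul, h.psi_eq_one hxy, mul_one]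

theorem exists_psi_ne_one {b : F} {r : ℝ} {m : ℤ} (hr : r = (q : ℝ) ^ m) (hb : 1 < ‖b‖ * r) :
    ∃ t : F, ‖t‖ ≤ r ∧ (ψ (b * t) : ℂ) ≠ 1 := by
  have hb0 : b ≠ 0 := by
    rintro rfl
    rw [norm_zero, zero_mul] at hb
    linarith
  obtain ⟨x, hx, hx1⟩ := h.order.2 (b * π ^ (-m)) (by rwa [norm_mul, h.norm_zpow, ← hr])
  refine ⟨x / b, ?_, ?_⟩
  · rw [norm_mul, h.norm_zpow, ← hr] at hx
    rw [norm_div, div_le_iff₀ (norm_pos_iff.2 hb0), mul_comm]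
    exact hx
  · rw [mul_div_cancel₀ _ hb0]
    simpa [← Circle.coe_one, Circle.coe_inj] using hx1

theorem measurable_psi : Measurable fun x : F => (ψ x : ℂ) :=
  (Continuous.comp (by fun_prop) h.continuous).measurable

theorem integral_closedBall_psi (b : F) (m : ℤ) :
    ∫ x in closedBall (0 : F) ((q : ℝ) ^ m), (ψ (b * x) : ℂ) ∂haarF F =
      if ‖b‖ * (q : ℝ) ^ m ≤ 1 then (q : ℂ) ^ m else 0 := by
  split_ifs with hb
  · have : Set.EqOn (fun x : F => (ψ (b * x) : ℂ)) (fun _ => 1) (closedBall 0 ((q : ℝ) ^ m)) := by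
      intro x hx
      have hx' : ‖x‖ ≤ (q : ℝ) ^ m := by simpa using hx
      have : ‖b * x‖ ≤ 1 := by
        rw [norm_mul]
        exact (mul_le_mul_of_nonneg_left hx' (norm_nonneg _)).trans hb
      simp [h.psi_eq_one this]
    rw [setIntegral_congr_fun measurableSet_closedBall this, setIntegral_const,
      h.real_closedBall_zpow, Complex.real_smul]
    push_cast
    ring
  · obtain ⟨t, ht, ht1⟩ := h.exists_psi_ne_one rfl (not_le.1 hb)
    refine setIntegral_eq_zero_of_translate measurableSet_closedBall ht1
      (fun x => closedBall_add_mem ht) fun x _ => ?_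
    rw [mul_add, AddChar.map_add_eq_mul, Circle.coe_mul, mul_comm]

theorem integrableOn_psi (b : F) {s : Set F} (hs : haarF F s < ⊤) :
    IntegrableOn (fun x => (ψ (b * x) : ℂ)) s (haarF F) :=
  integrableOn_of_norm_le hs (h.measurable_psi.comp (measurable_const_mul b)) (C := 1)
    fun _ => (Circle.norm_coe _).le

theorem integral_sphere_psi {b : F} {e : ℤ} (hb : ‖b‖ = (q : ℝ) ^ (-e)) (m : ℤ) :
    ∫ x in sphere (0 : F) ((q : ℝ) ^ m), (ψ (b * x) : ℂ) ∂haarF F =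
      if m ≤ e then (q : ℂ) ^ m - (q : ℂ) ^ (m - 1) else if m = e + 1 then -(q : ℂ) ^ e else 0 := by
  rw [h.integral_sphere_eq_sub m (h.integrableOn_psi b measure_closedBall_lt_top),
    h.integral_closedBall_psi, h.integral_closedBall_psi, hb, ← zpow_add₀ h.pos.ne',
    ← zpow_add₀ h.pos.ne']
  have (k : ℤ) : (q : ℝ) ^ k ≤ 1 ↔ k ≤ 0 := by
    rw [← h.zpow_le_iff, zpow_zero]
  simp only [this]
  split_ifs with h1 h2 h3 h4 h5 h6 h7 <;> first | omega | simp
  congr 1; omega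

/-- A Gauss integral lives on one sphere. On smaller ones ψ(bx) = 1 and multiplication by a
nonsquare unit reverses the sign; on larger ones χ is invariant under a translation on which ψ(b ·)
is nontrivial. On the critical sphere, x ↦ b⁻¹x reduces to radius q. -/
theorem integral_sphere_chi_psi {b : F} {e : ℤ} (hb : ‖b‖ = (q : ℝ) ^ (-e)) (m : ℤ) :
    ∫ x in sphere (0 : F) ((q : ℝ) ^ m), chi π x * (ψ (b * x) : ℂ) ∂haarF F =
      if m = e + 1 then (q : ℂ) ^ e * chi π b * gaussInt π ψ else 0 := by
  have hb0 : b ≠ 0 := by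
    rw [← norm_ne_zero_iff, hb]; exact (zpow_pos h.pos _).ne'
  rcases lt_trichotomy m (e + 1) with hm | rfl | hm
  · rw [if_neg hm.ne]
    obtain ⟨u, hu, hχ⟩ := h.exists_chi_eq_neg_one
    have hu0 : u ≠ 0 := by rintro rfl; simp at hu
    have h1 := h.integral_sphere_mul hu0 (fun x => chi π x * (ψ (b * x) : ℂ)) ((q : ℝ) ^ m)
    have h2 : Set.EqOn (fun x => chi π (u * x) * (ψ (b * (u * x)) : ℂ))
        (fun x => -(chi π x * (ψ (b * x) : ℂ))) (sphere (0 : F) ((q : ℝ) ^ m)) := by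
      intro x hx
      have hx' : ‖x‖ = (q : ℝ) ^ m := by simpa using hx
      have hx0 : x ≠ 0 := by
        rw [← norm_ne_zero_iff, hx']; exact (zpow_pos h.pos _).ne'
      have hbx : ‖b * x‖ ≤ 1 := by
        rw [norm_mul, hb, hx', ← zpow_add₀ h.pos.ne', ← zpow_zero (q : ℝ), h.zpow_le_iff]
        omega
      have hbux : ‖b * (u * x)‖ ≤ 1 := by
        rw [norm_mul, norm_mul, hu, one_mul, ← norm_mul]; exact hbx
      simp only
      rw [h.psi_eq_one hbx, h.psi_eq_one hbux, h.chi_mul hu0 hx0, hχ]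
      ring
    rw [hu, inv_one, one_mul, setIntegral_congr_fun isClosed_sphere.measurableSet h2,
      integral_neg, Complex.ofReal_one, one_mul] at h1
    linear_combination h1 / 2
  · rw [if_pos rfl, h.integral_sphere_mul (inv_ne_zero hb0), norm_inv, hb, ← zpow_neg, neg_neg,
      ← zpow_neg, ← zpow_add₀ h.pos.ne', gaussInt, h.norm, inv_inv, mul_assoc,
      ← integral_const_mul (chi π b)]
    have : -e + (e + 1) = 1 := by ring
    rw [this, zpow_one]
    push_cast
    congr 1
    refine setIntegral_congr_fun (isClosed_sphere (x := (0 : F))).measurableSet fun x hx => ?_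
    have hx' : ‖x‖ = (q : ℝ) := by simpa using hx
    have hx0 : x ≠ 0 := by
      rw [← norm_ne_zero_iff, hx']; exact h.pos.ne'
    rw [h.chi_mul (inv_ne_zero hb0) hx0, h.chi_inv hb0, mul_inv_cancel_left₀ hb0]
    ring
  · rw [if_neg hm.ne']
    obtain ⟨t, ht, ht1⟩ := h.exists_psi_ne_one (b := b) (m := e + 1) rfl (by
      rw [hb, ← zpow_add₀ h.pos.ne', ← zpow_zero (q : ℝ), h.zpow_lt_iff]
      omega)
    have htm : ‖t‖ < (q : ℝ) ^ m := ht.trans_lt (h.zpow_lt_iff.2 hm)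
    refine setIntegral_eq_zero_of_translate isClosed_sphere.measurableSet ht1
      (fun x => sphere_add_mem htm) fun x hx => ?_
    have hx' : ‖x‖ = (q : ℝ) ^ m := by simpa using hx
    rw [mul_add, AddChar.map_add_eq_mul, Circle.coe_mul,
      h.chi_eq_of_norm_sub_lt (a := x + t) (b := x)]
    · ring
    · rw [norm_add_eq_left (by rwa [hx']), hx']
      simpa using htm

/-- For `‖a‖ = q`, the character `r ↦ ψ(a r)` of the residue field. -/
theorem exists_resChar {a : F} (ha : ‖a‖ = q) :
    ∃ Ψ : AddChar (ResField F) ℂ, Ψ ≠ 1 ∧ ∀ x : F, ‖x‖ ≤ 1 → Ψ (red x) = (ψ (a * x) : ℂ) := by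
  choose l hl hlr using red_surjective (F := F)
  have key : ∀ x : F, ‖x‖ ≤ 1 → (ψ (a * l (red x)) : ℂ) = ψ (a * x) := by
    intro x hx
    congr 1
    apply h.psi_congr
    rw [← mul_sub, norm_mul, ha]
    have h1 := (red_eq_red_iff (hl _) hx).1 (hlr (red x))
    have h2 := (h.norm_lt_zpow_iff (m := 0)).1 (by simpa using h1)
    rw [zero_sub, zpow_neg_one] at h2
    calc (q : ℝ) * _ ≤ q * (q : ℝ)⁻¹ := by gcongr
      _ = 1 := mul_inv_cancel₀ h.pos.ne'
  refine ⟨⟨fun r => (ψ (a * l r) : ℂ), ?_, ?_⟩, ?_, key⟩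
  · have := key 0 (by simp)
    rw [(red_eq_zero_iff (x := (0 : F)) (by simp)).2 (by simp)] at this
    simpa using this
  · intro r s
    have := key (l r + l s) (norm_add_le_of_le (hl r) (hl s))
    rw [red_add (hl r) (hl s), hlr, hlr] at this
    rw [this, mul_add, AddChar.map_add_eq_mul, Circle.coe_mul]
  · intro h1
    obtain ⟨t, ht, ht1⟩ := h.exists_psi_ne_one (b := a) (r := 1) (m := 0) (by simp)
      (by rw [ha, mul_one]; exact h.one_lt_real)
    apply ht1
    rw [← key t ht]
    exact DFunLike.congr_fun h1 (red t)

theorem integral_sphere_one_chi_psi [Fintype (ResField F)] [DecidableEq (ResField F)] {a : F}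
    {Ψ : AddChar (ResField F) ℂ} (hΨ : ∀ x : F, ‖x‖ ≤ 1 → Ψ (red x) = (ψ (a * x) : ℂ)) :
    ∫ x in sphere (0 : F) 1, chi π x * (ψ (a * x) : ℂ) ∂haarF F =
      (q : ℂ)⁻¹ * ∑ r, (quadraticChar (ResField F) r : ℂ) * Ψ r := by
  rw [← h.integral_comp_red]
  have hs : sphere (0 : F) 1 = closedBall 0 1 \ closedBall 0 ((q : ℝ) ^ (0 - 1 : ℤ)) := by
    rw [← zpow_zero (q : ℝ), h.closedBall_diff]
  rw [← integral_indicator isClosed_sphere.measurableSet,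
    ← integral_indicator measurableSet_closedBall]
  congr 1
  ext x
  by_cases h1 : x ∈ closedBall (0 : F) 1
  swap
  · rw [Set.indicator_of_notMem h1, Set.indicator_of_notMem]
    exact fun h2 => h1 (sphere_subset_closedBall h2)
  have hx : ‖x‖ ≤ 1 := by simpa using h1
  rw [Set.indicator_of_mem h1]
  by_cases h2 : x ∈ sphere (0 : F) 1
  · rw [Set.indicator_of_mem h2, hΨ x hx, h.chi_unit (by simpa using h2)]
  · rw [Set.indicator_of_notMem h2, (red_eq_zero_iff hx).2]
    · simp
    · exact lt_of_le_of_ne hx (by simpa using h2)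

/-- Rescaling the Gauss integral by π⁻¹ to the unit sphere turns it, up to the sign χ(π⁻¹), into the
quadratic Gauss sum of the residue field, whose square is known. -/
theorem gaussInt_sq : gaussInt π ψ ^ 2 = chi π (-1) * q := by
  classical
  have := h.finite
  have := Fintype.ofFinite (ResField F)
  have ha : ‖π⁻¹‖ = (q : ℝ) := by rw [norm_inv, h.norm, inv_inv]
  obtain ⟨Ψ, hΨ1, hΨ⟩ := h.exists_resChar ha
  have h1 := h.integral_sphere_chi_psi (b := π⁻¹) (e := -1) (by rw [ha]; simp) 0
  rw [if_pos (by ring), zpow_zero, h.integral_sphere_one_chi_psi hΨ] at h1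
  have hq : (q : ℂ) ≠ 0 := by exact_mod_cast h.one_lt.pos.ne'
  have h2 := gaussSum_sq (χ := (quadraticChar (ResField F)).ringHomComp (Int.castRingHom ℂ))
    ?_ ((quadraticChar_isQuadratic (ResField F)).comp _) (AddChar.IsPrimitive.of_ne_one hΨ1)
  · simp only [gaussSum, MulChar.ringHomComp_apply, eq_intCast] at h2
    have h4 : chi π (-1) = (quadraticChar (ResField F) (-1) : ℂ) := by
      rw [h.chi_unit (by simp), red_neg (by simp), red_one]
    rw [← Nat.card_eq_fintype_card, h.card_resField, ← h4] at h2
    rw [← h2]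
    rw [zpow_neg_one, mul_assoc] at h1
    have h3 := mul_left_cancel₀ (inv_ne_zero hq) h1
    rw [h3, mul_pow, pow_two (chi π _), chi_mul_self, one_mul]
  · intro h3
    obtain ⟨r, hr⟩ := quadraticChar_exists_neg_one h.ringChar_ne_two
    have h4 := DFunLike.congr_fun h3 r
    have hr0 : r ≠ 0 := by rintro rfl; simp at hr
    rw [MulChar.ringHomComp_apply, hr, MulChar.one_apply hr0.isUnit] at h4
    norm_num at h4

theorem quadInt_of_norm_le_one {a : F} (ha : ‖a‖ ≤ 1) : quadInt ψ a = 1 := by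
  have : Set.EqOn (fun y : F => (ψ (a * y ^ 2) : ℂ)) (fun _ => 1) (closedBall 0 1) := by
    intro y hy
    have hy' : ‖y‖ ≤ 1 := by simpa using hy
    have : ‖a * y ^ 2‖ ≤ 1 := by
      rw [norm_mul, _root_.norm_pow]
      exact mul_le_one₀ ha (by positivity) (pow_le_one₀ (norm_nonneg _) hy')
    simp [h.psi_eq_one this]
  rw [quadInt, setIntegral_congr_fun measurableSet_closedBall this, setIntegral_const, Measure.real,
    haarF_closedBall_one]
  simp

/-- A residue class s has χ(s) + 1 square roots. The summand 1 contributes the sum of a nontrivial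
character, which is 0, and χ(s) gives the Gauss sum. -/
theorem quadInt_of_norm_eq {a : F} (ha : ‖a‖ = q) :
    quadInt ψ a = (q : ℂ)⁻¹ * chi π a * gaussInt π ψ := by
  classical
  have := h.finite
  have := Fintype.ofFinite (ResField F)
  obtain ⟨Ψ, hΨ1, hΨ⟩ := h.exists_resChar ha
  have h1 := h.integral_sphere_chi_psi (b := a) (e := -1) (by rw [ha]; simp) 0
  rw [if_pos (by ring), zpow_zero, h.integral_sphere_one_chi_psi hΨ, zpow_neg_one] at h1
  rw [← h1, quadInt]
  have h2 : Set.EqOn (fun y : F => (ψ (a * y ^ 2) : ℂ)) (fun y => Ψ (red y ^ 2))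
      (closedBall 0 1) := by
    intro y hy
    have hy' : ‖y‖ ≤ 1 := by simpa using hy
    simp only
    rw [pow_two (red y), ← red_mul hy' hy', ← pow_two, hΨ]
    rw [_root_.norm_pow]; exact pow_le_one₀ (norm_nonneg _) hy'
  rw [setIntegral_congr_fun measurableSet_closedBall h2, h.integral_comp_red fun r => Ψ (r ^ 2)]
  congr 1
  have h3 : ∑ r : ResField F, Ψ (r ^ 2) =
      ∑ s : ResField F, ((quadraticChar (ResField F) s : ℂ) + 1) * Ψ s := by
    rw [← Finset.sum_fiberwise_of_maps_to (t := Finset.univ) (g := fun r : ResField F => r ^ 2)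
      (fun _ _ => Finset.mem_univ _)]
    refine Finset.sum_congr rfl fun s _ => ?_
    rw [Finset.sum_congr rfl (g := fun _ => Ψ s)
      (fun r hr => by rw [(Finset.mem_filter.1 hr).2]), Finset.sum_const, nsmul_eq_mul]
    congr 1
    have := quadraticChar_card_sqrts h.ringChar_ne_two s
    rw [← Int.cast_one, ← Int.cast_add, ← this, Int.cast_natCast]
    congr 2
    ext r
    simp
  rw [h3]
  simp only [add_mul, one_mul, Finset.sum_add_distrib]
  rw [AddChar.sum_eq_zero_of_ne_one hΨ1, add_zero]

/-- Stationary phase: units y contribute nothing, because the phase ay² has the nonzero derivative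
2ay there. The substitution y ↦ πy in the remaining ball 𝔭 costs a factor 1/q. -/
theorem quadInt_of_lt {a : F} (ha : (q : ℝ) ^ 2 ≤ ‖a‖) :
    quadInt ψ a = (q : ℂ)⁻¹ * quadInt ψ (a * π ^ 2) := by
  have hq := h.pos
  have ha0 : 0 < ‖a‖ := lt_of_lt_of_le (by positivity) ha
  have hane : a ≠ 0 := norm_pos_iff.1 ha0
  obtain ⟨m, hm⟩ := h.exists_norm_eq hane
  have hm2 : 2 ≤ m := by
    rw [hm, ← zpow_natCast, h.zpow_le_iff] at ha; exact_mod_cast ha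
  have hmeas : Measurable fun y : F => (ψ (a * y ^ 2) : ℂ) := by
    exact h.measurable_psi.comp (by fun_prop : Measurable fun y : F => a * y ^ 2)
  have hsph : ∫ y in sphere (0 : F) 1, (ψ (a * y ^ 2) : ℂ) ∂haarF F = 0 := by
    rw [← integral_indicator isClosed_sphere.measurableSet]
    have hfin : haarF F (sphere 0 1) < ⊤ := by simpa using h.haarF_sphere_lt_top 0
    -- With |a| = q^m, this radius makes ax² integral, since 2 - m ≤ 0, while the linear term 2ayx
    -- still reaches norm q and so defines a nontrivial character.
    refine integral_eq_zero_of_forall_integral_translate (H := closedBall 0 ((q : ℝ) ^ (1 - m)))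
      ?_ ?_ ?_ fun y => ?_
    · exact (integrable_indicator_iff isClosed_sphere.measurableSet).2
        (integrableOn_of_norm_le hfin hmeas (C := 1) fun x => (Circle.norm_coe _).le)
    · rw [h.haarF_closedBall_zpow]
      simpa using zpow_pos hq _
    · rw [h.haarF_closedBall_zpow]; simp
    · have hlt : ∀ x ∈ closedBall (0 : F) ((q : ℝ) ^ (1 - m)), ‖x‖ < 1 := by
        intro x hx
        have hx' : ‖x‖ ≤ (q : ℝ) ^ (1 - m) := by simpa using hx
        refine hx'.trans_lt ?_
        rw [← zpow_zero (q : ℝ), h.zpow_lt_iff]; omega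
      by_cases hy : y ∈ sphere (0 : F) 1
      · have hy1 : ‖y‖ = 1 := by simpa using hy
        have heq : Set.EqOn (fun x => (sphere (0 : F) 1).indicator (fun y => (ψ (a * y ^ 2) : ℂ)) (x + y))
            (fun x => (ψ (a * y ^ 2) : ℂ) * ψ (2 * a * y * x)) (closedBall 0 ((q : ℝ) ^ (1 - m))) := by
          intro x hx
          have hx' : ‖x‖ ≤ (q : ℝ) ^ (1 - m) := by simpa using hx
          simp only
          rw [add_comm, Set.indicator_of_mem ((sphere_add_mem (hlt x hx)).2 hy), ← Circle.coe_mul,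
            ← AddChar.map_add_eq_mul]
          congr 1
          apply h.psi_congr
          have : a * (y + x) ^ 2 - (a * y ^ 2 + 2 * a * y * x) = a * x ^ 2 := by ring
          rw [this, norm_mul, hm, _root_.norm_pow]
          calc (q : ℝ) ^ m * ‖x‖ ^ 2 ≤ (q : ℝ) ^ m * ((q : ℝ) ^ (1 - m)) ^ 2 := by gcongr
            _ = (q : ℝ) ^ (m + (1 - m) * (2 : ℕ)) := by
              rw [zpow_add₀ hq.ne', zpow_mul, zpow_natCast]
            _ ≤ 1 := by
              rw [← zpow_zero (q : ℝ), h.zpow_le_iff]; push_cast; omega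
        rw [setIntegral_congr_fun measurableSet_closedBall heq, integral_const_mul,
          h.integral_closedBall_psi, if_neg, mul_zero]
        rw [norm_mul, norm_mul, h.norm_two, hy1, one_mul, mul_one, hm, ← zpow_add₀ hq.ne',
          ← zpow_zero (q : ℝ), h.zpow_le_iff]
        omega
      · rw [setIntegral_congr_fun (g := fun _ => 0) measurableSet_closedBall, integral_zero]
        intro x hx
        simp only
        rw [add_comm, Set.indicator_of_notMem]
        exact fun h1 => hy ((sphere_add_mem (hlt x hx)).1 h1)
  have h1 := h.integral_sphere_eq_sub 0 (integrableOn_of_norm_le measure_closedBall_lt_top hmeas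
    (C := 1) fun x => (Circle.norm_coe _).le)
  rw [zpow_zero, hsph, eq_comm, sub_eq_zero] at h1
  rw [quadInt, h1, h.integral_closedBall_mul h.ne_zero, quadInt, h.norm, inv_inv, zero_sub,
    zpow_neg_one, mul_inv_cancel₀ hq.ne']
  push_cast
  congr 2
  ext x
  rw [show a * (π * x) ^ 2 = a * π ^ 2 * x ^ 2 by ring]

/-- Repeated reduction a ↦ aπ² ends at norm 1 when the exponent is even and at norm q when it is
odd, which is why χ appears only for odd exponents. -/
theorem quadInt_even {a : F} (k : ℕ) (ha : ‖a‖ = (q : ℝ) ^ (2 * k)) :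
    quadInt ψ a = (q : ℂ)⁻¹ ^ k := by
  induction k generalizing a with
  | zero => rw [pow_zero, h.quadInt_of_norm_le_one (by simpa using ha.le)]
  | succ k ih =>
    rw [h.quadInt_of_lt, ih, pow_succ']
    · rw [norm_mul, ha, _root_.norm_pow, h.norm, mul_add, pow_add, mul_one, inv_pow,
        mul_inv_cancel_right₀ (pow_ne_zero _ h.pos.ne')]
    · rw [ha]
      exact pow_le_pow_right₀ h.one_lt_real.le (by omega)

theorem quadInt_odd {a : F} (k : ℕ) (ha : ‖a‖ = (q : ℝ) ^ (2 * k + 1)) :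
    quadInt ψ a = (q : ℂ)⁻¹ ^ (k + 1) * chi π a * gaussInt π ψ := by
  induction k generalizing a with
  | zero => rw [h.quadInt_of_norm_eq (by simpa using ha)]; simp
  | succ k ih =>
    rw [h.quadInt_of_lt, ih, chi_mul_sq _ h.ne_zero]
    · ring
    · rw [norm_mul, ha, _root_.norm_pow, h.norm, mul_add, add_right_comm, pow_add _ _ (2 * 1),
        mul_one, inv_pow, mul_inv_cancel_right₀ (pow_ne_zero _ h.pos.ne')]
    · rw [ha]
      exact pow_le_pow_right₀ h.one_lt_real.le (by omega)

end IsNormalizedWith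

end Integrals

end RamifiedSiegel

namespace RamifiedSiegel

open Metric

/-! ### The Weil constant of π in terms of the Gauss integral. -/

section Weil

variable {F : Type*} [NontriviallyNormedField F] [ProperSpace F] [MeasurableSpace F] [BorelSpace F]
variable [IsUltrametricDist F] {q : ℕ} {π : F} {ψ : AddChar F Circle}

/-- The Lebesgue number of the cover of the support by the fibres of φ works; a pair with both
points outside the support is trivial. -/
theorem exists_uniform_of_isLocallyConstant {φ : F → ℂ} (hφ : IsLocallyConstant φ)
    (hc : HasCompactSupport φ) : ∃ δ > 0, ∀ x t : F, ‖t‖ < δ → φ (x + t) = φ x := by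
  obtain ⟨δ, hδ, hball⟩ := lebesgue_number_lemma_of_metric (s := tsupport φ)
    (c := fun c : ℂ => φ ⁻¹' {c}) hc (fun c => hφ.isOpen_fiber c) (fun x _ => by simp)
  refine ⟨δ, hδ, ?_⟩
  have key : ∀ x ∈ tsupport φ, ∀ y, ‖y - x‖ < δ → φ y = φ x := by
    intro x hx y hxy
    obtain ⟨c, hsub⟩ := hball x hx
    have h1 : φ x = c := hsub (mem_ball_self hδ)
    have h2 : φ y = c := hsub (by rwa [mem_ball, dist_eq_norm])
    rw [h1, h2]
  intro x t ht
  by_cases hx : x ∈ tsupport φ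
  · exact key x hx _ (by simpa using ht)
  by_cases hxt : x + t ∈ tsupport φ
  · exact (key (x + t) hxt x (by simpa using ht)).symm
  · rw [image_eq_zero_of_notMem_tsupport hx, image_eq_zero_of_notMem_tsupport hxt]

namespace IsNormalizedWith

variable (h : IsNormalizedWith q π ψ)
include h

/-- If φ is invariant under a small ball, its Fourier transform vanishes at every frequency whose
character is nontrivial on that ball. -/
theorem exists_fourier_eq_zero {φ : F → ℂ} (hφ : IsLocallyConstant φ) (hc : HasCompactSupport φ) :
    ∃ N₀ : ℕ, ∀ x : F, (q : ℝ) ^ N₀ < ‖x‖ → fourier ψ φ x = 0 := by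
  obtain ⟨δ, hδ, hloc⟩ := exists_uniform_of_isLocallyConstant hφ hc
  obtain ⟨N, hN⟩ := exists_pow_lt_of_lt_one hδ (inv_lt_one_of_one_lt₀ h.one_lt_real)
  refine ⟨N, fun x hx => ?_⟩
  obtain ⟨t, ht, ht1⟩ := h.exists_psi_ne_one (b := x) (r := (q : ℝ)⁻¹ ^ N) (m := -N)
    (by simp) (by
      rw [inv_pow, ← div_eq_mul_inv, one_lt_div (pow_pos h.pos _)]; exact hx)
  have h1 : fourier ψ φ x = ψ (x * t) * fourier ψ φ x := by
    rw [fourier, ← integral_const_mul]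
    conv_lhs => rw [← integral_add_right_eq_self _ t]
    congr 1
    ext y
    rw [hloc y t (ht.trans_lt hN), mul_add, AddChar.map_add_eq_mul, Circle.coe_mul]
    ring
  have h2 : ((ψ (x * t) : ℂ) - 1) * fourier ψ φ x = 0 := by linear_combination -h1
  exact (mul_eq_zero.1 h2).resolve_left (sub_ne_zero.2 ht1)

/-- The value does not depend on the radius q^N, so it serves as the integral of ψ(-x²/(4π)) over
all of F. After rescaling, χ of the coefficient is χ(-1)χ(π) = 1. -/
theorem integral_closedBall_psi_sq (N : ℕ) :
    ∫ x in closedBall (0 : F) ((q : ℝ) ^ N), (ψ (-(x ^ 2 / (4 * π))) : ℂ) ∂haarF F =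
      (q : ℂ)⁻¹ * gaussInt π ψ := by
  have hπ := h.ne_zero
  have hp : π ^ (-(N : ℤ)) ≠ 0 := zpow_ne_zero _ hπ
  have h2 := h.two_ne_zero
  have h4 : (4 : F) = 2 ^ 2 := by norm_num
  have h4n : ‖(4 : F)‖ = 1 := by rw [h4, _root_.norm_pow, h.norm_two, one_pow]
  have hq : (q : ℂ) ≠ 0 := by exact_mod_cast h.one_lt.pos.ne'
  have ha : ‖-(π * (π ^ N * (2 * π ^ 1)) ^ 2 / π ^ 2)⁻¹‖ = (q : ℝ) ^ (2 * N + 1) := by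
    rw [norm_neg, norm_inv, norm_div, norm_mul, _root_.norm_pow, norm_mul, norm_mul,
      _root_.norm_pow, _root_.norm_pow, _root_.norm_pow, h.norm_two, h.norm]
    have := h.pos.ne'
    simp only [inv_pow]
    field_simp
    ring
  rw [h.integral_closedBall_mul hp, h.norm_zpow, zpow_natCast,
    inv_mul_cancel₀ (pow_ne_zero _ h.pos.ne')]
  have h1 := h.quadInt_odd N ha
  have h3 : chi π (-(π * (π ^ N * (2 * π ^ 1)) ^ 2 / π ^ 2)⁻¹) = 1 := by
    rw [h.chi_neg (by simp [hπ, h2]), h.chi_inv (by simp [hπ, h2]), div_eq_mul_inv, mul_assoc,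
      ← inv_pow, ← mul_pow, chi_mul_sq _ (by simp [hπ, h2]), h.chi_prime, chi_mul_self]
  rw [h3, quadInt] at h1
  have h5 : (fun x : F => (ψ (-((π ^ (-(N : ℤ)) * x) ^ 2 / (4 * π))) : ℂ)) =
      fun y : F => (ψ (-(π * (π ^ N * (2 * π ^ 1)) ^ 2 / π ^ 2)⁻¹ * y ^ 2) : ℂ) := by
    ext x
    congr 2
    rw [zpow_neg, zpow_natCast, h4]
    field_simp
  rw [h5, h1]
  push_cast
  rw [pow_succ, inv_pow]
  field_simp

/-- Fubini, then completing the square: xy - x²/(4π) = πy² - (x - 2πy)²/(4π). -/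
theorem integral_fourier_mul_psi {φ : F → ℂ} (hφ : IsLocallyConstant φ) (hc : HasCompactSupport φ) :
    ∫ x, fourier ψ φ x * (ψ (-(x ^ 2 / (4 * π))) : ℂ) ∂haarF F =
      (q : ℂ)⁻¹ * gaussInt π ψ * ∫ x, φ x * (ψ (π * x ^ 2) : ℂ) ∂haarF F := by
  have hπ := h.ne_zero
  have h2 := h.two_ne_zero
  have h4 : (4 : F) = 2 ^ 2 := by norm_num
  obtain ⟨N₀, hN₀⟩ := h.exists_fourier_eq_zero hφ hc
  obtain ⟨R, hR⟩ := hc.isBounded.subset_closedBall (0 : F)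
  obtain ⟨N₁, hN₁⟩ := pow_unbounded_of_one_lt R h.one_lt_real
  set N := max N₀ N₁
  have hqN : (q : ℝ) ^ N₀ ≤ (q : ℝ) ^ N := pow_le_pow_right₀ h.one_lt_real.le (le_max_left _ _)
  have hRN : R ≤ (q : ℝ) ^ N :=
    hN₁.le.trans (pow_le_pow_right₀ h.one_lt_real.le (le_max_right _ _))
  have hint : Integrable φ (haarF F) := hφ.continuous.integrable_of_hasCompactSupport hc
  have hfin : haarF F (closedBall (0 : F) ((q : ℝ) ^ N)) < ⊤ := measure_closedBall_lt_top
  have : IsFiniteMeasure ((haarF F).restrict (closedBall (0 : F) ((q : ℝ) ^ N))) :=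
    ⟨by simpa using hfin⟩
  -- The transform has bounded support; cutting to a ball beforehand makes the double integral
  -- absolutely convergent.
  have htrunc : ∫ x, fourier ψ φ x * (ψ (-(x ^ 2 / (4 * π))) : ℂ) ∂haarF F =
      ∫ x in closedBall (0 : F) ((q : ℝ) ^ N),
        fourier ψ φ x * (ψ (-(x ^ 2 / (4 * π))) : ℂ) ∂haarF F := by
    rw [setIntegral_eq_integral_of_forall_compl_eq_zero]
    intro x hx
    have hx' : (q : ℝ) ^ N < ‖x‖ := by simpa using hx
    rw [hN₀ x (hqN.trans_lt hx'), zero_mul]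
  have hmeas : Measurable fun z : F × F => (ψ (z.1 * z.2 - z.1 ^ 2 / (4 * π)) : ℂ) :=
    h.measurable_psi.comp (by fun_prop : Measurable fun z : F × F => z.1 * z.2 - z.1 ^ 2 / (4 * π))
  have hprod : Integrable (Function.uncurry fun x y : F =>
      φ y * (ψ (x * y - x ^ 2 / (4 * π)) : ℂ))
      (((haarF F).restrict (closedBall (0 : F) ((q : ℝ) ^ N))).prod (haarF F)) :=
    (hint.comp_snd _).mul_bdd (c := 1) hmeas.aestronglyMeasurable
      (Filter.Eventually.of_forall fun z => (Circle.norm_coe _).le)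
  have hinner : ∀ y, ∫ x in closedBall (0 : F) ((q : ℝ) ^ N),
      φ y * (ψ (x * y - x ^ 2 / (4 * π)) : ℂ) ∂haarF F =
        (q : ℂ)⁻¹ * gaussInt π ψ * (φ y * (ψ (π * y ^ 2) : ℂ)) := by
    intro y
    by_cases hy : y ∈ tsupport φ
    swap
    · simp [image_eq_zero_of_notMem_tsupport hy]
    have hyN : ‖2 * π * y‖ ≤ (q : ℝ) ^ N := by
      have : ‖y‖ ≤ R := by simpa using hR hy
      rw [norm_mul, norm_mul, h.norm_two, one_mul]
      calc ‖π‖ * ‖y‖ ≤ 1 * ‖y‖ := by gcongr; exact h.unif.2.1.le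
        _ ≤ (q : ℝ) ^ N := by rw [one_mul]; exact this.trans hRN
    rw [← h.integral_closedBall_psi_sq N, integral_const_mul, mul_comm (∫ x in _, _ ∂_), mul_assoc]
    congr 1
    rw [← integral_const_mul]
    rw [← integral_indicator measurableSet_closedBall, ← integral_indicator measurableSet_closedBall]
    -- The ball is a group containing 2πy, because N was chosen larger than the size of the support
    -- of φ, so the shift preserves the domain.
    conv_lhs => rw [← integral_add_right_eq_self _ (2 * π * y)]
    congr 1
    ext x
    by_cases hx : x ∈ closedBall (0 : F) ((q : ℝ) ^ N)
    · rw [Set.indicator_of_mem ((closedBall_add_mem hyN).2 hx), Set.indicator_of_mem hx,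
        ← Circle.coe_mul, ← AddChar.map_add_eq_mul]
      congr 2
      rw [h4]
      field_simp
      ring
    · rw [Set.indicator_of_notMem (fun hx' => hx ((closedBall_add_mem hyN).1 hx')),
        Set.indicator_of_notMem hx]
  rw [htrunc]
  have hfub := integral_integral_swap hprod
  simp only [hinner] at hfub
  rw [integral_const_mul] at hfub
  rw [← hfub]
  congr 1
  ext x
  rw [fourier, ← integral_mul_const]
  congr 1
  ext y
  rw [sub_eq_add_neg, AddChar.map_add_eq_mul, Circle.coe_mul, mul_assoc]

/-- The preceding identity shows that the constant exists; testing on the indicator function of 𝔬,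
where both integrals are nonzero, shows that it is unique. The inverse of g is χ(-1) g / q. -/
theorem weilConstant_eq :
    weilConstant ψ π = (((q : ℝ) ^ (1 / 2 : ℝ) : ℝ) : ℂ) * (q : ℂ)⁻¹ * chi π (-1) * gaussInt π ψ := by
  have hq : (q : ℂ) ≠ 0 := by exact_mod_cast h.one_lt.pos.ne'
  have hr : (((q : ℝ) ^ (1 / 2 : ℝ) : ℝ) : ℂ) * (((q : ℝ) ^ (1 / 2 : ℝ) : ℝ) : ℂ) = q := by
    rw [← Complex.ofReal_mul, ← Real.rpow_add h.pos]
    norm_num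
  have hr0 : (((q : ℝ) ^ (1 / 2 : ℝ) : ℝ) : ℂ) ≠ 0 := by
    intro h0; rw [h0, zero_mul] at hr; exact hq hr.symm
  have hn : ‖2 * π‖ ^ (-(1 / 2) : ℝ) = (q : ℝ) ^ (1 / 2 : ℝ) := by
    rw [norm_mul, h.norm_two, one_mul, h.norm, Real.inv_rpow h.pos.le, Real.rpow_neg h.pos.le,
      inv_inv]
  have hg := h.gaussInt_sq
  have hχ : chi π (-1) * chi π (-1) = 1 := chi_mul_self _
  have hex : ∃ c, IsWeilConstant ψ π c := by
    refine ⟨(((q : ℝ) ^ (1 / 2 : ℝ) : ℝ) : ℂ) * (q : ℂ)⁻¹ * chi π (-1) * gaussInt π ψ,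
      fun φ hφ hc => ?_⟩
    rw [h.integral_fourier_mul_psi hφ hc, hn]
    set I := ∫ x, φ x * (ψ (π * x ^ 2) : ℂ) ∂haarF F
    set r := (((q : ℝ) ^ (1 / 2 : ℝ) : ℝ) : ℂ)
    calc I = (q * (q : ℂ)⁻¹) * (q * (q : ℂ)⁻¹) * (chi π (-1) * chi π (-1)) * I := by
          rw [hχ, mul_inv_cancel₀ hq]; ring
      _ = (r * r) * (q : ℂ)⁻¹ * (q : ℂ)⁻¹ * chi π (-1) * (chi π (-1) * q) * I := by rw [hr]; ring
      _ = _ := by rw [← hg]; ring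
  rw [weilConstant, dif_pos hex]
  have hspec := hex.choose_spec
  set c := hex.choose
  set φ : F → ℂ := (closedBall (0 : F) 1).indicator fun _ => 1
  have hclopen : IsClopen (closedBall (0 : F) 1) :=
    IsUltrametricDist.isClopen_closedBall 0 one_ne_zero
  have hφ : IsLocallyConstant φ := ((LocallyConstant.const F 1).indicator hclopen).isLocallyConstant
  have hc : HasCompactSupport φ :=
    HasCompactSupport.intro (isCompact_closedBall (0 : F) 1) fun x hx => Set.indicator_of_notMem hx _
  have h1 := hspec φ hφ hc
  rw [h.integral_fourier_mul_psi hφ hc, hn] at h1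
  have hI : ∫ x, φ x * (ψ (π * x ^ 2) : ℂ) ∂haarF F = 1 := by
    rw [← h.quadInt_of_norm_le_one h.unif.2.1.le, quadInt, ← integral_indicator measurableSet_closedBall]
    congr 1
    ext x
    by_cases hx : x ∈ closedBall (0 : F) 1 <;> simp [φ, Set.indicator, hx]
  rw [hI, mul_one] at h1
  set r := (((q : ℝ) ^ (1 / 2 : ℝ) : ℝ) : ℂ)
  have h5 : c * (chi π (-1) * q) = r * chi π (-1) * gaussInt π ψ * chi π (-1) := by
    rw [← hg]
    have h3 : r * gaussInt π ψ = r * gaussInt π ψ * (c * r * ((q : ℂ)⁻¹ * gaussInt π ψ)) := by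
      rw [← h1, mul_one]
    have h4 : r * gaussInt π ψ * (c * r * ((q : ℂ)⁻¹ * gaussInt π ψ)) =
        c * ((r * r) * (q : ℂ)⁻¹) * gaussInt π ψ ^ 2 := by ring
    rw [h4, hr, mul_inv_cancel₀ hq, mul_one] at h3
    rw [← h3]
    linear_combination -(r * gaussInt π ψ) * hχ
  have h6 : c * q = r * chi π (-1) * gaussInt π ψ := by
    have := mul_right_cancel₀ (b := chi π (-1)) (a := c * q)
      (c := r * chi π (-1) * gaussInt π ψ) (chi_ne_zero _) (by linear_combination h5)
    exact this
  rw [← mul_inv_cancel_right₀ hq c, h6]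
  ring

end IsNormalizedWith

end Weil

end RamifiedSiegel

namespace RamifiedSiegel

open Matrix

/-! ### Integral matrices, block identities in Sp_2, and the group Γ. -/

section IntegralMatrices

variable {F : Type*} [NontriviallyNormedField F]

/-- The entries of `M` are integral. -/
def IsIntegralMat (M : Matrix (Fin 2) (Fin 2) F) : Prop := ∀ i j, ‖M i j‖ ≤ 1

/-- The entries of `M` lie in the maximal ideal. -/
def IsSmallMat (M : Matrix (Fin 2) (Fin 2) F) : Prop := ∀ i j, ‖M i j‖ < 1

variable {M N : Matrix (Fin 2) (Fin 2) F}

theorem IsSmallMat.isIntegralMat (hM : IsSmallMat M) : IsIntegralMat M := fun i j => (hM i j).le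

theorem IsIntegralMat.transpose (hM : IsIntegralMat M) : IsIntegralMat Mᵀ := fun i j => hM j i

theorem IsSmallMat.transpose (hM : IsSmallMat M) : IsSmallMat Mᵀ := fun i j => hM j i

theorem IsIntegralMat.neg (hM : IsIntegralMat M) : IsIntegralMat (-M) := fun i j => by
  simpa using hM i j

theorem IsSmallMat.neg (hM : IsSmallMat M) : IsSmallMat (-M) := fun i j => by
  simpa using hM i j

theorem isIntegralMat_one : IsIntegralMat (1 : Matrix (Fin 2) (Fin 2) F) := fun i j => by
  rw [Matrix.one_apply]; split_ifs <;> simp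

theorem isIntegralMat_zero : IsIntegralMat (0 : Matrix (Fin 2) (Fin 2) F) := fun i j => by simp

theorem isSmallMat_zero : IsSmallMat (0 : Matrix (Fin 2) (Fin 2) F) := fun i j => by simp

variable [IsUltrametricDist F]

theorem IsIntegralMat.add (hM : IsIntegralMat M) (hN : IsIntegralMat N) : IsIntegralMat (M + N) :=
  fun i j => norm_add_le_of_le (hM i j) (hN i j)

theorem IsSmallMat.add (hM : IsSmallMat M) (hN : IsSmallMat N) : IsSmallMat (M + N) :=
  fun i j => norm_add_lt_of_lt (hM i j) (hN i j)

theorem IsIntegralMat.mul (hM : IsIntegralMat M) (hN : IsIntegralMat N) : IsIntegralMat (M * N) :=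
  fun i j => by
    rw [Matrix.mul_apply, Fin.sum_univ_two]
    apply norm_add_le_of_le <;> rw [norm_mul] <;>
      exact mul_le_one₀ (hM _ _) (norm_nonneg _) (hN _ _)

theorem IsSmallMat.mul_right (hM : IsSmallMat M) (hN : IsIntegralMat N) : IsSmallMat (M * N) :=
  fun i j => by
    rw [Matrix.mul_apply, Fin.sum_univ_two]
    apply norm_add_lt_of_lt <;> rw [norm_mul] <;>
      exact mul_lt_one_of_nonneg_of_lt_one_left (norm_nonneg _) (hM _ _) (hN _ _)

theorem IsSmallMat.mul_left (hM : IsIntegralMat M) (hN : IsSmallMat N) : IsSmallMat (M * N) :=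
  fun i j => by
    rw [Matrix.mul_apply, Fin.sum_univ_two]
    apply norm_add_lt_of_lt <;> rw [norm_mul] <;>
      exact mul_lt_one_of_nonneg_of_lt_one_right (hM _ _) (norm_nonneg _) (hN _ _)

theorem IsIntegralMat.norm_det_le (hM : IsIntegralMat M) : ‖M.det‖ ≤ 1 := by
  rw [Matrix.det_fin_two]
  apply norm_sub_le_of_le <;> rw [norm_mul] <;>
    exact mul_le_one₀ (hM _ _) (norm_nonneg _) (hM _ _)

theorem norm_det_sub_lt (hM : IsIntegralMat M) (hN : IsIntegralMat N) (hMN : IsSmallMat (M - N)) :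
    ‖M.det - N.det‖ < 1 := by
  rw [Matrix.det_fin_two, Matrix.det_fin_two]
  have : M 0 0 * M 1 1 - M 0 1 * M 1 0 - (N 0 0 * N 1 1 - N 0 1 * N 1 0) =
      (M 0 0 * M 1 1 - N 0 0 * N 1 1) - (M 0 1 * M 1 0 - N 0 1 * N 1 0) := by ring
  rw [this]
  exact norm_sub_lt_of_lt (norm_mul_sub_mul_lt (hMN _ _) (hMN _ _) (hM _ _) (hN _ _))
    (norm_mul_sub_mul_lt (hMN _ _) (hMN _ _) (hM _ _) (hN _ _))

end IntegralMatrices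

section Blocks

variable {F : Type*} [Field F]

local notation "G₂" => symplecticGroup (Fin 2) F

theorem blocks_mul (g g' : G₂) :
    (g * g').1 = fromBlocks
      (g.1.toBlocks₁₁ * g'.1.toBlocks₁₁ + g.1.toBlocks₁₂ * g'.1.toBlocks₂₁)
      (g.1.toBlocks₁₁ * g'.1.toBlocks₁₂ + g.1.toBlocks₁₂ * g'.1.toBlocks₂₂)
      (g.1.toBlocks₂₁ * g'.1.toBlocks₁₁ + g.1.toBlocks₂₂ * g'.1.toBlocks₂₁)
      (g.1.toBlocks₂₁ * g'.1.toBlocks₁₂ + g.1.toBlocks₂₂ * g'.1.toBlocks₂₂) := by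
  rw [← fromBlocks_multiply, fromBlocks_toBlocks, fromBlocks_toBlocks]
  rfl

theorem blocks_inv (g : G₂) :
    (g⁻¹).1 = fromBlocks g.1.toBlocks₂₂ᵀ (-g.1.toBlocks₁₂ᵀ) (-g.1.toBlocks₂₁ᵀ) g.1.toBlocks₁₁ᵀ := by
  rw [SymplecticGroup.coe_inv]
  conv_lhs => rw [← fromBlocks_toBlocks g.1]
  simp [J, fromBlocks_transpose, fromBlocks_multiply, fromBlocks_neg]

theorem blocks_relation (g : G₂) :
    g.1.toBlocks₁₁ᵀ * g.1.toBlocks₂₂ = 1 + g.1.toBlocks₂₁ᵀ * g.1.toBlocks₁₂ := by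
  have := g.2
  rw [← fromBlocks_toBlocks g.1, SymplecticGroup.fromBlocks_mem_iff] at this
  rw [← this.2.2]
  abel

theorem siegelParabolic_mul {p p' : G₂} (hp : p ∈ siegelParabolic F 2)
    (hp' : p' ∈ siegelParabolic F 2) : p * p' ∈ siegelParabolic F 2 := by
  have h : p.1.toBlocks₂₁ = 0 := hp
  have h' : p'.1.toBlocks₂₁ = 0 := hp'
  change (p * p').1.toBlocks₂₁ = 0
  rw [blocks_mul, toBlocks_fromBlocks₂₁, h, h']
  simp

theorem siegelParabolic_inv {p : G₂} (hp : p ∈ siegelParabolic F 2) :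
    p⁻¹ ∈ siegelParabolic F 2 := by
  have h : p.1.toBlocks₂₁ = 0 := hp
  change (p⁻¹).1.toBlocks₂₁ = 0
  rw [blocks_inv, toBlocks_fromBlocks₂₁, h]
  simp

theorem one_mem_siegelParabolic : (1 : G₂) ∈ siegelParabolic F 2 := by
  change (1 : Matrix (Fin 2 ⊕ Fin 2) (Fin 2 ⊕ Fin 2) F).toBlocks₂₁ = 0
  rw [← fromBlocks_one, toBlocks_fromBlocks₂₁]

theorem siegelParabolic_det_mul {p p' : G₂} (hp' : p' ∈ siegelParabolic F 2) :
    (p * p').1.toBlocks₁₁.det = p.1.toBlocks₁₁.det * p'.1.toBlocks₁₁.det := by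
  have h' : p'.1.toBlocks₂₁ = 0 := hp'
  rw [blocks_mul, toBlocks_fromBlocks₁₁, h']
  simp

theorem siegelParabolic_det_ne_zero {p : G₂} (hp : p ∈ siegelParabolic F 2) :
    p.1.toBlocks₁₁.det ≠ 0 := by
  have h : p.1.toBlocks₂₁ = 0 := hp
  have := congrArg Matrix.det (blocks_relation p)
  rw [h, det_mul, det_transpose] at this
  intro h0
  rw [h0] at this
  simp at this

theorem w_zero : w F 2 0 = 1 := by
  apply Subtype.ext
  change wMatrix F 2 0 = 1
  rw [wMatrix, ← fromBlocks_one]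
  congr 1 <;> ext i j <;> fin_cases i <;> fin_cases j <;> simp

theorem w_one : (w F 2 1).1 = fromBlocks !![1, 0; 0, 0] !![0, 0; 0, -1] !![0, 0; 0, 1]
    !![1, 0; 0, 0] := by
  change wMatrix F 2 1 = _
  rw [wMatrix]
  congr 1 <;> ext i j <;> fin_cases i <;> fin_cases j <;> simp

theorem w_two : (w F 2 2).1 = fromBlocks 0 (-1) 1 0 := by
  change wMatrix F 2 2 = _
  rw [wMatrix]
  congr 1 <;> ext i j <;> fin_cases i <;> fin_cases j <;> simp

end Blocks

section Gamma

variable {F : Type*} [NontriviallyNormedField F]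

local notation "G₂" => symplecticGroup (Fin 2) F

theorem mem_Gam_iff {k : G₂} : k ∈ Gam F 2 ↔ IsIntegralMat k.1.toBlocks₁₁ ∧
    IsIntegralMat k.1.toBlocks₁₂ ∧ IsSmallMat k.1.toBlocks₂₁ ∧ IsIntegralMat k.1.toBlocks₂₂ := by
  constructor
  · rintro ⟨h1, h2⟩
    exact ⟨fun i j => h1 _ _, fun i j => h1 _ _, h2, fun i j => h1 _ _⟩
  · rintro ⟨hA, hB, hC, hD⟩
    refine ⟨fun i j => ?_, hC⟩
    rcases i with i | i <;> rcases j with j | j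
    · exact hA i j
    · exact hB i j
    · exact (hC i j).le
    · exact hD i j

variable [IsUltrametricDist F]

theorem Gam_mul {k k' : G₂} (hk : k ∈ Gam F 2) (hk' : k' ∈ Gam F 2) : k * k' ∈ Gam F 2 := by
  rw [mem_Gam_iff] at *
  obtain ⟨hA, hB, hC, hD⟩ := hk
  obtain ⟨hA', hB', hC', hD'⟩ := hk'
  rw [blocks_mul, toBlocks_fromBlocks₁₁, toBlocks_fromBlocks₁₂, toBlocks_fromBlocks₂₁,
    toBlocks_fromBlocks₂₂]
  exact ⟨(hA.mul hA').add (hB.mul hC'.isIntegralMat), (hA.mul hB').add (hB.mul hD'),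
    (hC.mul_right hA').add (IsSmallMat.mul_left hD hC'), (hC.isIntegralMat.mul hB').add (hD.mul hD')⟩

theorem Gam_inv {k : G₂} (hk : k ∈ Gam F 2) : k⁻¹ ∈ Gam F 2 := by
  rw [mem_Gam_iff] at *
  obtain ⟨hA, hB, hC, hD⟩ := hk
  rw [blocks_inv, toBlocks_fromBlocks₁₁, toBlocks_fromBlocks₁₂, toBlocks_fromBlocks₂₁,
    toBlocks_fromBlocks₂₂]
  exact ⟨hD.transpose, hB.transpose.neg, hC.transpose.neg, hA.transpose⟩

theorem one_mem_Gam : (1 : G₂) ∈ Gam F 2 := by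
  rw [mem_Gam_iff]
  change IsIntegralMat (1 : Matrix (Fin 2 ⊕ Fin 2) (Fin 2 ⊕ Fin 2) F).toBlocks₁₁ ∧
    IsIntegralMat (1 : Matrix (Fin 2 ⊕ Fin 2) (Fin 2 ⊕ Fin 2) F).toBlocks₁₂ ∧
    IsSmallMat (1 : Matrix (Fin 2 ⊕ Fin 2) (Fin 2 ⊕ Fin 2) F).toBlocks₂₁ ∧
    IsIntegralMat (1 : Matrix (Fin 2 ⊕ Fin 2) (Fin 2 ⊕ Fin 2) F).toBlocks₂₂
  rw [← fromBlocks_one]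
  exact ⟨isIntegralMat_one, isIntegralMat_zero, isSmallMat_zero, isIntegralMat_one⟩

/-- The symplectic relation ᵗA D = 1 + ᵗC B reduces to ᵗA D ≡ 1, since C is small. -/
theorem Gam_norm_det_mul_sub_one {k : G₂} (hk : k ∈ Gam F 2) :
    ‖k.1.toBlocks₁₁.det * k.1.toBlocks₂₂.det - 1‖ < 1 := by
  obtain ⟨hA, hB, hC, hD⟩ := mem_Gam_iff.1 hk
  have h := norm_det_sub_lt (hA.transpose.mul hD) isIntegralMat_one (by
    rw [blocks_relation, add_sub_cancel_left]
    exact hC.transpose.mul_right hB)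
  rwa [det_mul, det_transpose, det_one] at h

theorem norm_eq_one_of_norm_mul_sub_one_lt {a b : F} (ha : ‖a‖ ≤ 1) (hb : ‖b‖ ≤ 1)
    (hab : ‖a * b - 1‖ < 1) : ‖a‖ = 1 ∧ ‖b‖ = 1 := by
  have h1 : ‖a * b‖ = 1 := by
    rw [← norm_one (α := F)]
    refine norm_eq_of_norm_sub_lt ?_
    rwa [norm_sub_rev, norm_one]
  rw [norm_mul] at h1
  constructor <;> nlinarith [norm_nonneg a, norm_nonneg b]

theorem Gam_norm_det {k : G₂} (hk : k ∈ Gam F 2) :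
    ‖k.1.toBlocks₁₁.det‖ = 1 ∧ ‖k.1.toBlocks₂₂.det‖ = 1 := by
  obtain ⟨hA, hB, hC, hD⟩ := mem_Gam_iff.1 hk
  exact norm_eq_one_of_norm_mul_sub_one_lt hA.norm_det_le hD.norm_det_le
    (Gam_norm_det_mul_sub_one hk)

theorem Gam_det_ne_zero {k : G₂} (hk : k ∈ Gam F 2) :
    k.1.toBlocks₁₁.det ≠ 0 ∧ k.1.toBlocks₂₂.det ≠ 0 := by
  obtain ⟨h1, h2⟩ := Gam_norm_det hk
  constructor <;> rw [← norm_ne_zero_iff] <;> simp [h1, h2]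

variable {q : ℕ} {π : F} [ProperSpace F]

namespace IsNormalized

variable (h : IsNormalized q π)
include h

theorem chi_eq_of_mul_sub_one {a b : F} (ha : ‖a‖ ≤ 1) (hb : ‖b‖ ≤ 1)
    (hab : ‖a * b - 1‖ < 1) : chi π a = chi π b := by
  obtain ⟨ha1, hb1⟩ := norm_eq_one_of_norm_mul_sub_one_lt ha hb hab
  have h1 : chi π (1 : F) = chi π (a * b) :=
    h.chi_eq_of_norm_sub_lt (by rwa [norm_sub_rev, norm_one])
  rw [h.chi_one, h.chi_unit_mul ha1 hb1] at h1
  have h2 := chi_mul_self (π := π) b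
  linear_combination -chi π b * h1 - chi π a * h2

theorem Gam_chi_det {k : G₂} (hk : k ∈ Gam F 2) :
    chi π k.1.toBlocks₁₁.det = chi π k.1.toBlocks₂₂.det := by
  obtain ⟨hA, hB, hC, hD⟩ := mem_Gam_iff.1 hk
  exact h.chi_eq_of_mul_sub_one hA.norm_det_le hD.norm_det_le (Gam_norm_det_mul_sub_one hk)

theorem Gam_chi_det_mul {k k' : G₂} (hk : k ∈ Gam F 2) (hk' : k' ∈ Gam F 2) :
    chi π (k * k').1.toBlocks₂₂.det = chi π k.1.toBlocks₂₂.det * chi π k'.1.toBlocks₂₂.det := by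
  rw [← h.chi_mul (Gam_det_ne_zero hk).2 (Gam_det_ne_zero hk').2, ← det_mul]
  apply h.chi_eq_of_norm_sub_lt
  rw [(Gam_norm_det (Gam_mul hk hk')).2]
  have hkk := (mem_Gam_iff.1 (Gam_mul hk hk')).2.2.2
  obtain ⟨hA, hB, hC, hD⟩ := mem_Gam_iff.1 hk
  obtain ⟨hA', hB', hC', hD'⟩ := mem_Gam_iff.1 hk'
  refine norm_det_sub_lt hkk (hD.mul hD') ?_
  rw [blocks_mul, toBlocks_fromBlocks₂₂, add_sub_cancel_right]
  exact hC.mul_right hB'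

/-- Compatibility of the two characters on `w_t⁻¹ P w_t ∩ Γ`. -/
theorem siegelParabolic_inter_Gam {t : ℕ} (ht : t ≤ 1) {p k : G₂} (hp : p ∈ siegelParabolic F 2)
    (hk : k ∈ Gam F 2) (hpk : p * w F 2 t = w F 2 t * k) :
    ‖p.1.toBlocks₁₁.det‖ = 1 ∧ chi π p.1.toBlocks₁₁.det = chi π k.1.toBlocks₂₂.det := by
  obtain rfl | rfl : t = 0 ∨ t = 1 := by omega
  · rw [w_zero, mul_one, one_mul] at hpk
    rw [hpk]
    exact ⟨(Gam_norm_det hk).1, h.Gam_chi_det hk⟩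
  · have hdet := (Gam_norm_det hk).2
    have hrel := blocks_relation k
    obtain ⟨hA, hB, hC, hD⟩ := mem_Gam_iff.1 hk
    have hp0 : p.1.toBlocks₂₁ = 0 := hp
    have heq := congrArg Subtype.val hpk
    rw [blocks_mul, blocks_mul, w_one] at heq
    simp only [toBlocks_fromBlocks₁₁, toBlocks_fromBlocks₁₂, toBlocks_fromBlocks₂₁,
      toBlocks_fromBlocks₂₂, hp0, Matrix.zero_mul, zero_add] at heq
    obtain ⟨h11, h12, h21, h22⟩ := fromBlocks_inj.1 heq
    set A := k.1.toBlocks₁₁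
    set B := k.1.toBlocks₁₂
    set C := k.1.toBlocks₂₁
    set D := k.1.toBlocks₂₂
    set A' := p.1.toBlocks₁₁
    have a00 : A' 0 0 = A 0 0 := by
      simpa [Matrix.mul_apply, Fin.sum_univ_two, Matrix.vecMul, dotProduct] using congrFun (congrFun h11 0) 0
    have a10 : A' 1 0 = -C 1 0 := by
      simpa [Matrix.mul_apply, Fin.sum_univ_two, Matrix.vecMul, dotProduct] using congrFun (congrFun h11 1) 0
    have a01 : -A' 0 1 = B 0 1 := by
      simpa [Matrix.mul_apply, Fin.sum_univ_two, Matrix.vecMul, dotProduct] using congrFun (congrFun h12 0) 1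
    have a11 : A' 1 1 = D 1 1 := by
      simpa [Matrix.mul_apply, Fin.sum_univ_two, Matrix.vecMul, dotProduct] using congrFun (congrFun h12 1) 1
    have k10 : 0 = A 1 0 := by
      simpa [Matrix.mul_apply, Fin.sum_univ_two, Matrix.vecMul, dotProduct] using congrFun (congrFun h21 1) 0
    have d01 : 0 = D 0 1 := by
      simpa [Matrix.mul_apply, Fin.sum_univ_two, Matrix.vecMul, dotProduct] using congrFun (congrFun h22 0) 1
    -- Modulo 𝔭 this is A₀₀ D₁₁, while det D = D₀₀ D₁₁ and A₀₀ D₀₀ ≡ 1. As χ is quadratic, χ(A₀₀) =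
    -- χ(D₀₀) and the two characters agree.
    have hdetA : A'.det = A 0 0 * D 1 1 - B 0 1 * C 1 0 := by
      rw [det_fin_two, a00, a11, a10, ← neg_neg (A' 0 1), a01]
      ring
    have hdetD : D.det = D 0 0 * D 1 1 := by
      rw [det_fin_two, ← d01]; ring
    have hAD : ‖A 0 0 * D 0 0 - 1‖ < 1 := by
      have := congrFun (congrFun hrel 0) 0
      simp only [Matrix.mul_apply, Fin.sum_univ_two, transpose_apply, ← k10, zero_mul, add_zero,
        Matrix.add_apply, Matrix.one_apply_eq] at this
      rw [this, add_sub_cancel_left]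
      apply norm_add_lt_of_lt <;> rw [norm_mul] <;>
        exact mul_lt_one_of_nonneg_of_lt_one_left (norm_nonneg _) (hC _ _) (hB _ _)
    obtain ⟨hA1, hD1⟩ := norm_eq_one_of_norm_mul_sub_one_lt (hA 0 0) (hD 0 0) hAD
    have hD11 : ‖D 1 1‖ = 1 := by rwa [hdetD, norm_mul, hD1, one_mul] at hdet
    have hnorm : ‖A 0 0 * D 1 1‖ = 1 := by rw [norm_mul, hA1, hD11, one_mul]
    have hlt : ‖A 0 0 * D 1 1 - A'.det‖ < ‖A 0 0 * D 1 1‖ := by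
      rw [hdetA, hnorm, sub_sub_cancel, norm_mul]
      exact mul_lt_one_of_nonneg_of_lt_one_right (hB _ _) (norm_nonneg _) (hC _ _)
    refine ⟨by rw [norm_eq_of_norm_sub_lt hlt, hnorm], ?_⟩
    rw [← h.chi_eq_of_norm_sub_lt hlt, hdetD, h.chi_unit_mul hA1 hD11, h.chi_unit_mul hD1 hD11,
      h.chi_eq_of_mul_sub_one (hA 0 0) (hD 0 0) hAD]

end IsNormalized

/-- The double cosets `P w_t Γ` and `P w_j Γ` are disjoint. -/
theorem w_ne_mul {t j : ℕ} (ht : t ≤ 1) (hj : j ≤ 2) (htj : j ≠ t) {p k : G₂}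
    (hp : p ∈ siegelParabolic F 2) (hk : k ∈ Gam F 2) : w F 2 j * k ≠ p * w F 2 t := by
  intro heq
  have hp0 : p.1.toBlocks₂₁ = 0 := hp
  obtain ⟨hA0, hD0⟩ := Gam_det_ne_zero hk
  have heq' := congrArg Subtype.val heq
  rw [blocks_mul, blocks_mul] at heq'
  obtain ⟨h11, h12, h21, h22⟩ := fromBlocks_inj.1 heq'
  rw [hp0, Matrix.zero_mul, zero_add] at h21 h22
  -- Comparing the bottom rows of both sides, the ranks of the bottom blocks of w_t and w_j force
  -- det A or det D of k to vanish, although both are units.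
  obtain rfl | rfl : t = 0 ∨ t = 1 := by omega
  · obtain rfl | rfl : j = 1 ∨ j = 2 := by omega
    · have h0 : (w F 2 0).1.toBlocks₂₁ = 0 := by
        rw [w_zero]; exact one_mem_siegelParabolic
      rw [w_one, toBlocks_fromBlocks₂₁, toBlocks_fromBlocks₂₂, h0, Matrix.mul_zero] at h21
      have a0 : k.1.toBlocks₁₁ 1 0 = 0 := by
        simpa [Matrix.mul_apply, Fin.sum_univ_two, Matrix.vecMul, dotProduct] using congrFun (congrFun h21 1) 0
      have a1 : k.1.toBlocks₁₁ 1 1 = 0 := by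
        simpa [Matrix.mul_apply, Fin.sum_univ_two, Matrix.vecMul, dotProduct] using congrFun (congrFun h21 1) 1
      exact hA0 (by rw [det_fin_two, a0, a1]; ring)
    · have h0 : (w F 2 0).1.toBlocks₂₁ = 0 := by
        rw [w_zero]; exact one_mem_siegelParabolic
      rw [w_two, toBlocks_fromBlocks₂₁, toBlocks_fromBlocks₂₂, h0, Matrix.mul_zero, Matrix.one_mul,
        Matrix.zero_mul, add_zero] at h21
      exact hA0 (by rw [h21]; simp)
  · obtain rfl | rfl : j = 0 ∨ j = 2 := by omega
    · rw [w_zero, ← blocks_mul] at heq'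
      have h1 : k.1 = (p * w F 2 1).1 := by rw [← heq, w_zero, one_mul]
      rw [blocks_mul] at h1
      have h2 : k.1.toBlocks₂₂ = p.1.toBlocks₂₂ * (w F 2 1).1.toBlocks₂₂ := by
        rw [h1, toBlocks_fromBlocks₂₂, hp0, Matrix.zero_mul, zero_add]
      apply hD0
      rw [h2, det_mul, w_one, toBlocks_fromBlocks₂₂]
      simp [det_fin_two]
    · rw [w_two, toBlocks_fromBlocks₂₁, toBlocks_fromBlocks₂₂, Matrix.one_mul, Matrix.zero_mul,
        add_zero] at h21
      apply hA0
      rw [h21, det_mul, w_one, toBlocks_fromBlocks₂₁]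
      simp [det_fin_two]

end Gamma

/-! ### Existence of the sections f_0 and f_1. -/

section Existence

variable {F : Type*} [NontriviallyNormedField F] [IsUltrametricDist F] [ProperSpace F]
variable {q : ℕ} {π : F}

local notation "G₂" => symplecticGroup (Fin 2) F

/-- The value prescribed on `p w_t k`. -/
def cosetValue (π : F) (s : ℂ) (p k : G₂) : ℂ :=
  chi π p.1.toBlocks₁₁.det * ((‖p.1.toBlocks₁₁.det‖ : ℝ) : ℂ) ^ s * chi π k.1.toBlocks₂₂.det

open Classical in
/-- The function supported on `P w_t Γ` with the prescribed values. -/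
def cosetSection (π : F) (s : ℂ) (t : ℕ) (g : G₂) : ℂ :=
  if h : ∃ x : G₂ × G₂, (x.1 ∈ siegelParabolic F 2 ∧ x.2 ∈ Gam F 2) ∧ g = x.1 * w F 2 t * x.2 then
    cosetValue π s h.choose.1 h.choose.2 else 0

namespace IsNormalized

variable (h : IsNormalized q π)
include h

/-- Two factorizations of one element differ by an element of P that w_t conjugates into Γ, and on
such elements the two characters coincide and the norm of the determinant is 1. Hence the choice in
`cosetSection` is harmless. -/
theorem cosetValue_eq {s : ℂ} {t : ℕ} (ht : t ≤ 1) {p p' k k' : G₂} (hp : p ∈ siegelParabolic F 2)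
    (hp' : p' ∈ siegelParabolic F 2) (hk : k ∈ Gam F 2) (hk' : k' ∈ Gam F 2)
    (heq : p * w F 2 t * k = p' * w F 2 t * k') : cosetValue π s p k = cosetValue π s p' k' := by
  have hp'' := siegelParabolic_mul (siegelParabolic_inv hp') hp
  have hk'' := Gam_mul hk' (Gam_inv hk)
  have h1 : p'⁻¹ * p * w F 2 t = w F 2 t * (k' * k⁻¹) := by
    rw [mul_assoc, ← mul_assoc _ k', inv_mul_eq_iff_eq_mul, ← mul_assoc, ← mul_assoc, ← heq,
      mul_inv_cancel_right]
  obtain ⟨hn, hχ⟩ := h.siegelParabolic_inter_Gam ht hp'' hk'' h1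
  have hA : p.1.toBlocks₁₁.det = p'.1.toBlocks₁₁.det * (p'⁻¹ * p).1.toBlocks₁₁.det := by
    rw [← siegelParabolic_det_mul hp'', mul_inv_cancel_left]
  have hD : chi π k'.1.toBlocks₂₂.det =
      chi π (k' * k⁻¹).1.toBlocks₂₂.det * chi π k.1.toBlocks₂₂.det := by
    rw [← h.Gam_chi_det_mul hk'' hk, inv_mul_cancel_right]
  rw [cosetValue, cosetValue, hD, hA, norm_mul, hn, mul_one,
    h.chi_mul (siegelParabolic_det_ne_zero hp') (siegelParabolic_det_ne_zero hp''), hχ]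
  ring

theorem cosetSection_apply {s : ℂ} {t : ℕ} (ht : t ≤ 1) {p k : G₂} (hp : p ∈ siegelParabolic F 2)
    (hk : k ∈ Gam F 2) : cosetSection π s t (p * w F 2 t * k) = cosetValue π s p k := by
  have hex : ∃ x : G₂ × G₂, (x.1 ∈ siegelParabolic F 2 ∧ x.2 ∈ Gam F 2) ∧
      p * w F 2 t * k = x.1 * w F 2 t * x.2 := ⟨(p, k), ⟨hp, hk⟩, rfl⟩
  rw [cosetSection, dif_pos hex]
  obtain ⟨⟨h1, h2⟩, h3⟩ := hex.choose_spec
  exact h.cosetValue_eq ht h1 hp h2 hk h3.symm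

theorem cosetSection_mul {s : ℂ} {t : ℕ} (ht : t ≤ 1) {p k : G₂} (hp : p ∈ siegelParabolic F 2)
    (hk : k ∈ Gam F 2) (g : G₂) : cosetSection π s t (p * g * k) =
      cosetValue π s p k * cosetSection π s t g := by
  by_cases hg : ∃ x : G₂ × G₂, (x.1 ∈ siegelParabolic F 2 ∧ x.2 ∈ Gam F 2) ∧
      g = x.1 * w F 2 t * x.2
  · obtain ⟨⟨p', k'⟩, ⟨hp', hk'⟩, rfl⟩ := hg
    have h1 : p * (p' * w F 2 t * k') * k = (p * p') * w F 2 t * (k' * k) := by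
      simp only [mul_assoc]
    rw [h1, h.cosetSection_apply ht (siegelParabolic_mul hp hp') (Gam_mul hk' hk),
      h.cosetSection_apply ht hp' hk', cosetValue, cosetValue, cosetValue,
      h.Gam_chi_det_mul hk' hk, siegelParabolic_det_mul hp',
      h.chi_mul (siegelParabolic_det_ne_zero hp) (siegelParabolic_det_ne_zero hp'), norm_mul,
      Complex.ofReal_mul, Complex.mul_cpow_ofReal_nonneg (norm_nonneg _) (norm_nonneg _)]
    ring
  · have hg' : ¬∃ x : G₂ × G₂, (x.1 ∈ siegelParabolic F 2 ∧ x.2 ∈ Gam F 2) ∧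
        p * g * k = x.1 * w F 2 t * x.2 := by
      rintro ⟨⟨p', k'⟩, ⟨hp', hk'⟩, heq⟩
      refine hg ⟨(p⁻¹ * p', k' * k⁻¹),
        ⟨siegelParabolic_mul (siegelParabolic_inv hp) hp', Gam_mul hk' (Gam_inv hk)⟩, ?_⟩
      simp only at heq ⊢
      have : g = p⁻¹ * (p * g * k) * k⁻¹ := by group
      rw [this, heq]
      group
    rw [cosetSection, dif_neg hg', cosetSection, dif_neg hg, mul_zero]

theorem cosetValue_one_left (s : ℂ) (k : G₂) : cosetValue π s 1 k = chi π k.1.toBlocks₂₂.det := by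
  have : (1 : G₂).1.toBlocks₁₁ = 1 := by
    change (1 : Matrix (Fin 2 ⊕ Fin 2) (Fin 2 ⊕ Fin 2) F).toBlocks₁₁ = 1
    rw [← fromBlocks_one, toBlocks_fromBlocks₁₁]
  rw [cosetValue, this, det_one, h.chi_one, norm_one]
  simp

theorem cosetValue_one_right (s : ℂ) (p : G₂) : cosetValue π s p 1 =
    chi π p.1.toBlocks₁₁.det * ((‖p.1.toBlocks₁₁.det‖ : ℝ) : ℂ) ^ s := by
  have : (1 : G₂).1.toBlocks₂₂ = 1 := by
    change (1 : Matrix (Fin 2 ⊕ Fin 2) (Fin 2 ⊕ Fin 2) F).toBlocks₂₂ = 1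
    rw [← fromBlocks_one, toBlocks_fromBlocks₂₂]
  rw [cosetValue, this, det_one, h.chi_one, mul_one]

/-- Right translation by matrices congruent to 1 modulo 𝔭 is an open condition. These lie in Γ and
have χ(det D) = 1, so the section is constant along it. -/
theorem isLocallyConstant_cosetSection {s : ℂ} {t : ℕ} (ht : t ≤ 1) :
    IsLocallyConstant (cosetSection π s t) := by
  rw [IsLocallyConstant.iff_exists_open]
  intro g
  refine ⟨{g' | ∀ i j, ‖(g⁻¹ * g').1 i j - (1 : Matrix (Fin 2 ⊕ Fin 2) (Fin 2 ⊕ Fin 2) F) i j‖ < 1},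
    ?_, ?_, ?_⟩
  · have hset : {g' : G₂ | ∀ i j,
          ‖(g⁻¹ * g').1 i j - (1 : Matrix (Fin 2 ⊕ Fin 2) (Fin 2 ⊕ Fin 2) F) i j‖ < 1} =
        ⋂ i, ⋂ j, {g' : G₂ |
          ‖(g⁻¹ * g').1 i j - (1 : Matrix (Fin 2 ⊕ Fin 2) (Fin 2 ⊕ Fin 2) F) i j‖ < 1} := by
      ext; simp
    rw [hset]
    refine isOpen_iInter_of_finite fun i => isOpen_iInter_of_finite fun j => ?_
    refine isOpen_lt ?_ continuous_const
    have : Continuous fun g' : G₂ => (g⁻¹ * g').1 :=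
      (continuous_const (y := (g⁻¹).1)).matrix_mul continuous_subtype_val
    exact ((this.matrix_elem i j).sub continuous_const).norm
  · intro i j
    rw [inv_mul_cancel]
    simp
  · intro g' hg'
    set k := g⁻¹ * g' with hk
    have hsub : ∀ i j, ‖k.1 i j - (1 : Matrix (Fin 2 ⊕ Fin 2) (Fin 2 ⊕ Fin 2) F) i j‖ < 1 := hg'
    have hint : ∀ i j, ‖k.1 i j‖ ≤ 1 := fun i j => by
      have h1 := norm_add_le_of_le (hsub i j).le
        (b := (1 : Matrix (Fin 2 ⊕ Fin 2) (Fin 2 ⊕ Fin 2) F) i j) (r := 1) (by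
          rw [Matrix.one_apply]; split_ifs <;> simp)
      simpa using h1
    have hkΓ : k ∈ Gam F 2 := by
      refine ⟨hint, fun i j => ?_⟩
      simpa [toBlocks₂₁] using hsub (Sum.inr i) (Sum.inl j)
    have hD : ‖1 - k.1.toBlocks₂₂.det‖ < ‖(1 : F)‖ := by
      rw [norm_sub_rev, norm_one, ← det_one (n := Fin 2)]
      refine norm_det_sub_lt (fun i j => hint _ _) isIntegralMat_one fun i j => ?_
      have := hsub (Sum.inr i) (Sum.inr j)
      simpa [Matrix.one_apply, toBlocks₂₂] using this
    have hg'' : g' = 1 * g * k := by rw [hk]; group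
    rw [hg'', h.cosetSection_mul ht one_mem_siegelParabolic hkΓ, h.cosetValue_one_left,
      ← h.chi_eq_of_norm_sub_lt hD, h.chi_one, one_mul]

theorem isBasisSection_cosetSection {s : ℂ} {t : ℕ} (ht : t ≤ 1) :
    IsBasisSection (n := 2) (chi π) s t (cosetSection π (s + (((2 : ℕ) : ℂ) + 1) / 2) t) := by
  refine ⟨⟨⟨h.isLocallyConstant_cosetSection ht, fun p hp g => ?_⟩, fun g k hk => ?_⟩,
    fun j hj => ?_⟩
  · have := h.cosetSection_mul (s := s + (((2 : ℕ) : ℂ) + 1) / 2) ht hp one_mem_Gam g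
    rwa [mul_one, h.cosetValue_one_right] at this
  · have := h.cosetSection_mul (s := s + (((2 : ℕ) : ℂ) + 1) / 2) ht one_mem_siegelParabolic hk g
    rwa [one_mul, h.cosetValue_one_left] at this
  · split_ifs with hjt
    · subst hjt
      have := h.cosetSection_apply (s := s + (((2 : ℕ) : ℂ) + 1) / 2) ht one_mem_siegelParabolic
        one_mem_Gam
      rw [one_mul, mul_one, h.cosetValue_one_left] at this
      rw [this]
      have h1 : (1 : G₂).1.toBlocks₂₂ = 1 := by
        change (1 : Matrix (Fin 2 ⊕ Fin 2) (Fin 2 ⊕ Fin 2) F).toBlocks₂₂ = 1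
        rw [← fromBlocks_one, toBlocks_fromBlocks₂₂]
      rw [h1, det_one, h.chi_one]
    · rw [cosetSection, dif_neg]
      rintro ⟨⟨p, k⟩, ⟨hp, hk⟩, heq⟩
      refine w_ne_mul ht hj hjt hp (Gam_inv hk) ?_
      rw [heq, mul_inv_cancel_right]

/-- Existence rules out the default value 0 of `basisSection`. The later evaluations use only the
defining property, so it does not matter which section was chosen. -/
theorem isBasisSection_basisSection (s : ℂ) {t : ℕ} (ht : t ≤ 1) :
    IsBasisSection (n := 2) (chi π) s t (basisSection (chi π) s t) := by
  have hex : ∃ f : G₂ → ℂ, IsBasisSection (chi π) s t f := ⟨_, h.isBasisSection_cosetSection ht⟩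
  rw [basisSection, dif_pos hex]
  exact hex.choose_spec

end IsNormalized

end Existence

end RamifiedSiegel

namespace RamifiedSiegel

open Matrix

/-! ### Values of f_t at w_2 n(X). -/

section Values

variable {F : Type*} [NontriviallyNormedField F]

local notation "G₂" => symplecticGroup (Fin 2) F

/-- The element `[1, 0; Y, 1]` of `Sp_2(F)`, for symmetric `Y`. -/
def lowerUnipotent (Y : Matrix (Fin 2) (Fin 2) F) (hY : Y.IsSymm) : G₂ :=
  ⟨fromBlocks 1 0 Y 1, by
    rw [SymplecticGroup.fromBlocks_mem_iff]; simp [hY.eq]⟩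

/-- The element `[ᵗV, 0; 0, U]` of `Sp_2(F)`, for mutually inverse `U` and `V`. -/
def leviElement (U V : Matrix (Fin 2) (Fin 2) F) (hVU : V * U = 1) : G₂ :=
  ⟨fromBlocks Vᵀ 0 0 U, by
    rw [SymplecticGroup.fromBlocks_mem_iff]; simp [hVU]⟩

theorem w_two_mul_unipotent (X : Matrix (Fin 2) (Fin 2) F) (hX : X.IsSymm) :
    (w F 2 2 * unipotent X hX).1 = fromBlocks 0 (-1) 1 X := by
  rw [blocks_mul, w_two]
  simp [unipotent]

theorem unipotent_congr {X Y : Matrix (Fin 2) (Fin 2) F} (hX : X.IsSymm) (hXY : X = Y) :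
    unipotent X hX = unipotent Y (hXY ▸ hX) := by
  subst hXY; rfl

/-- `‖x‖ ^ (-s)` as a complex number. -/
def normCpow (s : ℂ) (x : F) : ℂ := ((‖x‖ : ℝ) : ℂ) ^ (-s)

theorem normCpow_mul (s : ℂ) (x y : F) : normCpow s (x * y) = normCpow s x * normCpow s y := by
  rw [normCpow, norm_mul, Complex.ofReal_mul,
    Complex.mul_cpow_ofReal_nonneg (norm_nonneg _) (norm_nonneg _), normCpow, normCpow]

theorem norm_inv_cpow (s : ℂ) (x : F) : ((‖x⁻¹‖ : ℝ) : ℂ) ^ s = normCpow s x := by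
  rw [normCpow, norm_inv, Complex.ofReal_inv, Complex.inv_cpow, Complex.cpow_neg]
  rw [Complex.arg_ofReal_of_nonneg (norm_nonneg _)]
  exact Real.pi_ne_zero.symm

variable [IsUltrametricDist F] [ProperSpace F] {q : ℕ} {π : F}

namespace IsNormalized

variable (h : IsNormalized q π)
include h

section

variable {s : ℂ} {t : ℕ} {f : symplecticGroup (Fin 2) F → ℂ}
  (hf : IsBasisSection (n := 2) (chi π) (s - (((2 : ℕ) : ℂ) + 1) / 2) t f)
include hf

/-- The shift of s by 3/2 in the section cancels the 3/2 in the definition of the induced space,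
leaving |det A|^s. -/
theorem section_mul {p k : G₂} (hp : p ∈ siegelParabolic F 2) (hk : k ∈ Gam F 2) (g : G₂) :
    f (p * g * k) = chi π p.1.toBlocks₁₁.det * ((‖p.1.toBlocks₁₁.det‖ : ℝ) : ℂ) ^ s *
      chi π k.1.toBlocks₂₂.det * f g := by
  rw [hf.1.2 _ _ hk, hf.1.1.2 p hp, sub_add_cancel]
  ring

/-- A Levi element of GL_2(𝔬) moves across w_2 from P into Γ; the two characters it produces are
χ(det V) and χ(det U), whose product is 1. -/
theorem section_conj {U V X X' : Matrix (Fin 2) (Fin 2) F} (hU : IsIntegralMat U)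
    (hV : IsIntegralMat V) (hVU : V * U = 1) (hX : X.IsSymm) (hX' : X'.IsSymm)
    (hXX' : X' = U * X * Uᵀ) :
    f (w F 2 2 * unipotent X' hX') = f (w F 2 2 * unipotent X hX) := by
  subst hXX'
  have hUV : U * V = 1 := mul_eq_one_comm.1 hVU
  have hk : leviElement Uᵀ Vᵀ (by rw [← transpose_mul, hUV, transpose_one]) *
      leviElement Vᵀ Uᵀ (by rw [← transpose_mul, hVU, transpose_one]) = (1 : G₂) := by
    apply Subtype.ext
    rw [blocks_mul]
    simp [leviElement, hVU, ← transpose_mul]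
  have h1 : w F 2 2 * unipotent (U * X * Uᵀ) hX' = leviElement U V hVU *
      (w F 2 2 * unipotent X hX) *
        leviElement Uᵀ Vᵀ (by rw [← transpose_mul, hUV, transpose_one]) := by
    apply Subtype.ext
    rw [w_two_mul_unipotent, blocks_mul, blocks_mul, w_two_mul_unipotent]
    simp [leviElement, hUV, ← transpose_mul]
  rw [h1, h.section_mul hf]
  · have hdet : V.det * U.det = 1 := by rw [← det_mul, hVU, det_one]
    obtain ⟨hV1, hU1⟩ := norm_eq_one_of_norm_mul_sub_one_lt hV.norm_det_le hU.norm_det_le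
      (by rw [hdet]; simp)
    simp only [leviElement, toBlocks_fromBlocks₁₁, toBlocks_fromBlocks₂₂, det_transpose, hV1]
    rw [Complex.ofReal_one, Complex.one_cpow, mul_one, ← h.chi_unit_mul hV1 hU1, hdet, h.chi_one,
      one_mul]
  · change (fromBlocks _ _ _ _).toBlocks₂₁ = 0
    rw [toBlocks_fromBlocks₂₁]
  · rw [mem_Gam_iff]
    simp only [leviElement, toBlocks_fromBlocks₁₁, toBlocks_fromBlocks₂₂, toBlocks_fromBlocks₁₂,
      toBlocks_fromBlocks₂₁]
    exact ⟨hV.transpose.transpose, isIntegralMat_zero, isSmallMat_zero, hU.transpose⟩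

/-- Multiplying w_2 n(X) = (0, -1; 1, X) on the right by the lower unipotent with entry -X⁻¹ gives
(X⁻¹, -1; 0, X) in P, and that unipotent lies in Γ. -/
theorem section_of_inv_small {X Y : Matrix (Fin 2) (Fin 2) F} (hX : X.IsSymm) (hY : Y.IsSymm)
    (hXY : X * Y = 1) (hYs : IsSmallMat Y) :
    f (w F 2 2 * unipotent X hX) = chi π X.det * normCpow s X.det * if t = 0 then 1 else 0 := by
  set p : G₂ := w F 2 2 * unipotent X hX * lowerUnipotent (-Y) hY.neg with hp
  have hpk : w F 2 2 * unipotent X hX = p * w F 2 0 * lowerUnipotent Y hY := by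
    have : lowerUnipotent (-Y) hY.neg * lowerUnipotent Y hY = (1 : G₂) := by
      apply Subtype.ext
      rw [blocks_mul]
      simp [lowerUnipotent]
    rw [hp, w_zero, mul_one, mul_assoc, this, mul_one]
  have hp1 : p.1 = fromBlocks Y (-1) 0 X := by
    rw [hp, blocks_mul, w_two_mul_unipotent]
    simp [lowerUnipotent, hXY]
  rw [hpk, h.section_mul hf, hf.2 0 (by norm_num), hp1, toBlocks_fromBlocks₁₁]
  · have hdet : X.det * Y.det = 1 := by rw [← det_mul, hXY, det_one]
    have hX0 : X.det ≠ 0 := left_ne_zero_of_mul_eq_one hdet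
    have hY' : Y.det = X.det⁻¹ := eq_inv_of_mul_eq_one_right hdet
    simp only [lowerUnipotent, toBlocks_fromBlocks₂₂, det_one, h.chi_one, mul_one]
    rw [hY', h.chi_inv hX0, norm_inv_cpow]
    simp only [eq_comm]
  · change p.1.toBlocks₂₁ = 0
    rw [hp1, toBlocks_fromBlocks₂₁]
  · rw [mem_Gam_iff]
    simp only [lowerUnipotent, toBlocks_fromBlocks₁₁, toBlocks_fromBlocks₂₂, toBlocks_fromBlocks₁₂,
      toBlocks_fromBlocks₂₁]
    exact ⟨isIntegralMat_one, isIntegralMat_zero, hYs, isIntegralMat_one⟩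

theorem section_of_integral {X : Matrix (Fin 2) (Fin 2) F} (hX : X.IsSymm)
    (hXi : IsIntegralMat X) :
    f (w F 2 2 * unipotent X hX) = if t = 2 then 1 else 0 := by
  rw [hf.1.2, hf.2 2 le_rfl]
  · simp only [unipotent, toBlocks_fromBlocks₂₂, det_one, h.chi_one, one_mul]
    simp only [eq_comm]
  · rw [mem_Gam_iff]
    simp only [unipotent, toBlocks_fromBlocks₁₁, toBlocks_fromBlocks₂₂, toBlocks_fromBlocks₁₂,
      toBlocks_fromBlocks₂₁]
    exact ⟨isIntegralMat_one, hXi, isSmallMat_zero, isIntegralMat_one⟩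

/-- Two copies of SL_2 treated separately: the large entry x is absorbed by a lower unipotent with
entry x⁻¹, the integral entry v by an upper unipotent, which leaves w_1. -/
theorem section_diag {x v : F} (hx : 1 < ‖x‖) (hv : ‖v‖ ≤ 1) (hX : (!![x, 0; 0, v]).IsSymm) :
    f (w F 2 2 * unipotent !![x, 0; 0, v] hX) =
      chi π x * normCpow s x * if t = 1 then 1 else 0 := by
  have hx0 : x ≠ 0 := norm_pos_iff.1 (one_pos.trans hx)
  let p : G₂ := ⟨fromBlocks !![x⁻¹, 0; 0, 1] !![-1, 0; 0, 0] 0 !![x, 0; 0, 1], by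
    rw [SymplecticGroup.fromBlocks_mem_iff]
    refine ⟨by simp, ?_, ?_⟩ <;> ext i j <;> fin_cases i <;> fin_cases j <;>
      simp [Matrix.mul_apply, Fin.sum_univ_two, hx0]⟩
  let k : G₂ := ⟨fromBlocks 1 !![0, 0; 0, v] !![x⁻¹, 0; 0, 0] 1, by
    rw [SymplecticGroup.fromBlocks_mem_iff]
    refine ⟨?_, ?_, ?_⟩ <;> ext i j <;> fin_cases i <;> fin_cases j <;>
      simp [Matrix.mul_apply, Fin.sum_univ_two]⟩
  have hpk : w F 2 2 * unipotent !![x, 0; 0, v] hX = p * w F 2 1 * k := by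
    apply Subtype.ext
    rw [w_two_mul_unipotent, blocks_mul, blocks_mul, w_one]
    simp only [p, k, toBlocks_fromBlocks₁₁, toBlocks_fromBlocks₂₂, toBlocks_fromBlocks₁₂,
      toBlocks_fromBlocks₂₁]
    congr 1 <;> ext i j <;> fin_cases i <;> fin_cases j <;>
      simp [hx0]
  rw [hpk, h.section_mul hf, hf.2 1 (by norm_num)]
  · simp only [p, k, toBlocks_fromBlocks₁₁, toBlocks_fromBlocks₂₂, det_one, h.chi_one, mul_one,
      det_fin_two_of, mul_zero, sub_zero]
    rw [h.chi_inv hx0, norm_inv_cpow]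
    simp only [eq_comm]
  · change (fromBlocks _ _ _ _).toBlocks₂₁ = 0
    rw [toBlocks_fromBlocks₂₁]
  · rw [mem_Gam_iff]
    simp only [k, toBlocks_fromBlocks₁₁, toBlocks_fromBlocks₂₂, toBlocks_fromBlocks₁₂,
      toBlocks_fromBlocks₂₁]
    refine ⟨isIntegralMat_one, fun i j => ?_, fun i j => ?_, isIntegralMat_one⟩
    · fin_cases i <;> fin_cases j <;> simp [hv]
    · fin_cases i <;> fin_cases j <;> simp [inv_lt_one_of_one_lt₀ hx]

/-- Completing the square with the entry y/x, integral because x dominates y, reduces to diag(x, z -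
y²/x). -/
theorem section_of_upper_left_max {x y z : F} (hx : 1 < ‖x‖) (hy : ‖y‖ ≤ ‖x‖)
    (hX : (!![x, y; y, z]).IsSymm) :
    f (w F 2 2 * unipotent !![x, y; y, z] hX) =
      if ‖z - y ^ 2 / x‖ ≤ 1 then chi π x * normCpow s x * if t = 1 then 1 else 0
      else chi π x * chi π (z - y ^ 2 / x) * (normCpow s x * normCpow s (z - y ^ 2 / x)) *
        if t = 0 then 1 else 0 := by
  have hxpos := one_pos.trans hx
  have hx0 : x ≠ 0 := norm_pos_iff.1 hxpos
  set v := z - y ^ 2 / x with hv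
  have hsymm : (!![x, 0; 0, v]).IsSymm := by
    ext i j; fin_cases i <;> fin_cases j <;> rfl
  have hyx : ‖y / x‖ ≤ 1 := by rw [norm_div]; exact div_le_one_of_le₀ hy hxpos.le
  rw [h.section_conj hf (U := !![1, 0; y / x, 1]) (V := !![1, 0; -(y / x), 1]) ?_ ?_ ?_ hsymm hX ?_]
  · by_cases hv1 : ‖v‖ ≤ 1
    · rw [if_pos hv1]
      exact h.section_diag hf hx hv1 hsymm
    · rw [if_neg hv1]
      have hv1' := not_le.1 hv1
      have hv0 : v ≠ 0 := norm_pos_iff.1 (one_pos.trans hv1')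
      rw [h.section_of_inv_small hf (Y := !![x⁻¹, 0; 0, v⁻¹]) hsymm, det_fin_two_of, mul_zero,
        sub_zero, normCpow_mul, h.chi_mul hx0 hv0]
      · ext i j; fin_cases i <;> fin_cases j <;> rfl
      · ext i j
        fin_cases i <;> fin_cases j <;> simp [Matrix.mul_apply, Fin.sum_univ_two, hx0, hv0]
      · intro i j
        fin_cases i <;> fin_cases j <;> simp [inv_lt_one_of_one_lt₀ hx, inv_lt_one_of_one_lt₀ hv1']
  · intro i j; fin_cases i <;> fin_cases j <;> simp [-norm_div, hyx]
  · intro i j; fin_cases i <;> fin_cases j <;> simp [-norm_div, hyx]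
  · ext i j; fin_cases i <;> fin_cases j <;> simp [Matrix.mul_apply, Fin.sum_univ_two]
  · ext i j
    fin_cases i <;> fin_cases j <;>
      simp [Matrix.mul_apply, Fin.sum_univ_two, hx0]
    all_goals (try rw [hv])
    all_goals field_simp
    all_goals ring

theorem section_of_lower_right_max {x y z : F} (hz : 1 < ‖z‖) (hy : ‖y‖ ≤ ‖z‖)
    (hX : (!![x, y; y, z]).IsSymm) :
    f (w F 2 2 * unipotent !![x, y; y, z] hX) =
      if ‖x - y ^ 2 / z‖ ≤ 1 then chi π z * normCpow s z * if t = 1 then 1 else 0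
      else chi π z * chi π (x - y ^ 2 / z) * (normCpow s z * normCpow s (x - y ^ 2 / z)) *
        if t = 0 then 1 else 0 := by
  have hsymm : (!![z, y; y, x]).IsSymm := by
    ext i j; fin_cases i <;> fin_cases j <;> rfl
  rw [← h.section_of_upper_left_max hf hz hy hsymm]
  apply h.section_conj hf (U := !![0, 1; 1, 0]) (V := !![0, 1; 1, 0])
  · intro i j; fin_cases i <;> fin_cases j <;> simp
  · intro i j; fin_cases i <;> fin_cases j <;> simp
  · ext i j; fin_cases i <;> fin_cases j <;> simp [Matrix.mul_apply, Fin.sum_univ_two]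
  · ext i j
    fin_cases i <;> fin_cases j <;>
      simp [Matrix.mul_apply, Fin.sum_univ_two]

/-- Since |xz| < |y|², the determinant is -y² up to a factor in 1 + 𝔭, and the inverse has entries
of norm at most |y|/|y|² < 1. -/
theorem section_of_off_diagonal_max {x y z : F} (hy : 1 < ‖y‖) (hx : ‖x‖ < ‖y‖) (hz : ‖z‖ ≤ ‖y‖)
    (hX : (!![x, y; y, z]).IsSymm) :
    f (w F 2 2 * unipotent !![x, y; y, z] hX) =
      chi π (-1) * normCpow s (y ^ 2) * if t = 0 then 1 else 0 := by
  have hypos := one_pos.trans hy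
  have hy0 : y ≠ 0 := norm_pos_iff.1 hypos
  set d := x * z - y * y with hd
  have hlt : ‖-(y ^ 2) - d‖ < ‖-(y ^ 2)‖ := by
    have : -(y ^ 2) - d = -(x * z) := by rw [hd]; ring
    rw [this, norm_neg, norm_neg, norm_mul, _root_.norm_pow, pow_two]
    calc ‖x‖ * ‖z‖ ≤ ‖x‖ * ‖y‖ := by gcongr
      _ < ‖y‖ * ‖y‖ := by gcongr
  have hdn : ‖d‖ = ‖y ^ 2‖ := by rw [norm_eq_of_norm_sub_lt hlt, norm_neg]
  have hd0 : d ≠ 0 := by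
    rw [← norm_ne_zero_iff, hdn, norm_ne_zero_iff]; exact pow_ne_zero _ hy0
  have hχ : chi π d = chi π (-1) := by
    rw [← h.chi_eq_of_norm_sub_lt hlt, ← chi_mul_sq (-1) hy0]; congr 1; ring
  have hpow : normCpow s d = normCpow s (y ^ 2) := by rw [normCpow, hdn, normCpow]
  have hsm (a : F) (ha : ‖a‖ ≤ ‖y‖) : ‖a / d‖ < 1 := by
    rw [norm_div, hdn, div_lt_one (norm_pos_iff.2 (pow_ne_zero _ hy0)), _root_.norm_pow]
    nlinarith
  rw [h.section_of_inv_small hf (Y := !![z / d, -(y / d); -(y / d), x / d]), det_fin_two_of, ← hd,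
    hχ, hpow]
  · ext i j; fin_cases i <;> fin_cases j <;> rfl
  · ext i j
    fin_cases i <;> fin_cases j <;> simp [Matrix.mul_apply, Fin.sum_univ_two] <;> field_simp <;>
      rw [hd] <;> ring
  · intro i j
    fin_cases i <;> fin_cases j <;> simp only [Fin.zero_eta, Fin.mk_one, of_apply, cons_val',
      cons_val_zero, cons_val_fin_one, cons_val_one, norm_neg]
    · exact hsm z hz
    · exact hsm y le_rfl
    · exact hsm y le_rfl
    · exact hsm x hx.le

end

end IsNormalized

end Values

end RamifiedSiegel

namespace RamifiedSiegel

open Metric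

/-! ### Integration over spheres, and the mixed Gauss integrals. -/

section Radial

variable {F : Type*} [NontriviallyNormedField F] [ProperSpace F] [MeasurableSpace F] [BorelSpace F]
variable [IsUltrametricDist F] {q : ℕ} {π : F} {ψ : AddChar F Circle}

theorem ofReal_pow_cpow {r : ℝ} (hr : 0 ≤ r) (m : ℕ) (s : ℂ) :
    ((r ^ m : ℝ) : ℂ) ^ s = ((r : ℂ) ^ s) ^ m := by
  induction m with
  | zero => simp
  | succ m ih =>
    rw [pow_succ, Complex.ofReal_mul, Complex.mul_cpow_ofReal_nonneg (pow_nonneg hr _) hr, ih,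
      pow_succ]

theorem norm_normCpow (s : ℂ) {x : F} (hx : x ≠ 0) : ‖normCpow s x‖ = ‖x‖ ^ (-s.re) := by
  rw [normCpow, Complex.norm_cpow_eq_rpow_re_of_pos (norm_pos_iff.2 hx), Complex.neg_re]

theorem measurable_normCpow (s : ℂ) : Measurable (normCpow s : F → ℂ) := by
  unfold normCpow
  exact (Complex.measurable_ofReal.comp measurable_norm).pow_const _

theorem measurableSet_one_lt_norm : MeasurableSet {x : F | 1 < ‖x‖} :=
  measurableSet_lt measurable_const measurable_norm

namespace IsNormalized

variable (h : IsNormalized q π)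
include h

theorem normCpow_of_norm_eq (s : ℂ) {x : F} {m : ℕ} (hx : ‖x‖ = (q : ℝ) ^ m) :
    normCpow s x = ((q : ℂ) ^ (-s)) ^ m := by
  rw [normCpow, hx, ofReal_pow_cpow h.pos.le, Complex.ofReal_natCast]

theorem one_lt_norm_eq_iUnion :
    {x : F | 1 < ‖x‖} = ⋃ m : ℕ, sphere 0 ((q : ℝ) ^ ((m : ℤ) + 1)) := by
  ext x
  simp only [Set.mem_ofPred_eq, Set.mem_iUnion, mem_sphere, dist_zero_right]
  constructor
  · intro hx
    obtain ⟨m, hm⟩ := h.exists_norm_eq (norm_pos_iff.1 (one_pos.trans hx))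
    rw [hm, ← zpow_zero (q : ℝ), h.zpow_lt_iff] at hx
    refine ⟨(m - 1).toNat, ?_⟩
    rw [hm, h.zpow_inj_iff]
    omega
  · rintro ⟨m, hm⟩
    rw [hm, ← zpow_zero (q : ℝ), h.zpow_lt_iff]
    omega

theorem pairwise_disjoint_sphere : Pairwise (Function.onFun Disjoint fun m : ℕ =>
    sphere (0 : F) ((q : ℝ) ^ ((m : ℤ) + 1))) := by
  intro m n hmn
  rw [Function.onFun, Set.disjoint_left]
  intro x hm hn
  simp only [mem_sphere, dist_zero_right] at hm hn
  rw [hm, h.zpow_inj_iff] at hn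
  omega

theorem hasSum_integral_sphere {f : F → ℂ} (hf : IntegrableOn f {x | 1 < ‖x‖} (haarF F)) :
    HasSum (fun m : ℕ => ∫ x in sphere 0 ((q : ℝ) ^ ((m : ℤ) + 1)), f x ∂haarF F)
      (∫ x in {x | 1 < ‖x‖}, f x ∂haarF F) := by
  rw [h.one_lt_norm_eq_iUnion] at hf ⊢
  exact hasSum_integral_iUnion (fun m => isClosed_sphere.measurableSet)
    h.pairwise_disjoint_sphere hf

/-- The spheres contribute at most a geometric series of ratio q^(1-τ). -/
theorem lintegral_norm_rpow_lt_top {τ : ℝ} (hτ : 1 < τ) :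
    ∫⁻ x in {x : F | 1 < ‖x‖}, ENNReal.ofReal (‖x‖ ^ (-τ)) ∂haarF F < ⊤ := by
  have hq := h.pos
  rw [h.one_lt_norm_eq_iUnion, lintegral_iUnion (fun m => isClosed_sphere.measurableSet)
    h.pairwise_disjoint_sphere]
  have hterm (m : ℕ) : ∫⁻ x in sphere (0 : F) ((q : ℝ) ^ ((m : ℤ) + 1)),
      ENNReal.ofReal (‖x‖ ^ (-τ)) ∂haarF F ≤ ENNReal.ofReal (((q : ℝ) ^ (1 - τ)) ^ (m + 1)) := by
    have hcast : (q : ℝ) ^ ((m : ℤ) + 1) = (q : ℝ) ^ (m + 1) := by exact_mod_cast rfl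
    have h1 : Set.EqOn (fun x : F => ENNReal.ofReal (‖x‖ ^ (-τ)))
        (fun _ => ENNReal.ofReal (((q : ℝ) ^ (m + 1)) ^ (-τ)))
        (sphere (0 : F) ((q : ℝ) ^ ((m : ℤ) + 1))) := by
      intro x hx
      have hx' : ‖x‖ = (q : ℝ) ^ ((m : ℤ) + 1) := by simpa using hx
      simp only [hx', hcast]
    rw [setLIntegral_congr_fun isClosed_sphere.measurableSet h1, setLIntegral_const, h.haarF_sphere,
      ← ENNReal.ofReal_mul (by positivity)]
    apply ENNReal.ofReal_le_ofReal
    calc ((q : ℝ) ^ (m + 1)) ^ (-τ) * ((q : ℝ) ^ ((m : ℤ) + 1) - (q : ℝ) ^ ((m : ℤ) + 1 - 1))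
        ≤ ((q : ℝ) ^ (m + 1)) ^ (-τ) * (q : ℝ) ^ ((m : ℤ) + 1) := by
          gcongr
          exact sub_le_self _ (zpow_pos hq _).le
      _ = ((q : ℝ) ^ (1 - τ)) ^ (m + 1) := by
          rw [hcast, ← Real.rpow_natCast, ← Real.rpow_natCast, ← Real.rpow_mul hq.le,
            ← Real.rpow_mul hq.le, ← Real.rpow_add hq]
          congr 1
          ring
  refine (ENNReal.tsum_le_tsum hterm).trans_lt ?_
  apply Summable.tsum_ofReal_lt_top
  refine ((summable_geometric_of_lt_one (by positivity) ?_).mul_left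
    ((q : ℝ) ^ (1 - τ))).congr fun m => (pow_succ' _ _).symm
  exact Real.rpow_lt_one_of_one_lt_of_neg h.one_lt_real (by linarith)

end IsNormalized

/-- The integral of `χ(x) ψ(b x) ∫_𝔬 ψ(a x y²) dy` over the sphere of radius `q ^ m`. -/
def mixedInt (q : ℕ) (π : F) (ψ : AddChar F Circle) (a b : F) (m : ℤ) : ℂ :=
  ∫ x in sphere (0 : F) ((q : ℝ) ^ m), chi π x * (ψ (b * x) : ℂ) * quadInt ψ (a * x) ∂haarF F

namespace IsNormalizedWith

variable (h : IsNormalizedWith q π ψ)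
include h

theorem mixedInt_of_const {a b : F} {e m : ℤ} {c : ℂ} (hb : ‖b‖ = (q : ℝ) ^ (-e))
    (hc : ∀ x : F, ‖x‖ = (q : ℝ) ^ m → quadInt ψ (a * x) = c) :
    mixedInt q π ψ a b m = c * if m = e + 1 then (q : ℂ) ^ e * chi π b * gaussInt π ψ else 0 := by
  rw [← h.integral_sphere_chi_psi hb, mixedInt, ← integral_const_mul]
  refine setIntegral_congr_fun isClosed_sphere.measurableSet fun x hx => ?_
  rw [hc x (by simpa using hx)]
  ring

theorem mixedInt_of_le {a b : F} {e e' m : ℤ} (hb : ‖b‖ = (q : ℝ) ^ (-e))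
    (ha : ‖a‖ = (q : ℝ) ^ (-e')) (hm : m ≤ e') :
    mixedInt q π ψ a b m = if m = e + 1 then (q : ℂ) ^ e * chi π b * gaussInt π ψ else 0 := by
  rw [h.mixedInt_of_const (c := 1) hb, one_mul]
  intro x hx
  apply h.quadInt_of_norm_le_one
  rw [norm_mul, ha, hx, ← zpow_add₀ h.pos.ne', ← zpow_zero (q : ℝ), h.zpow_le_iff]
  omega

theorem mixedInt_even {a b : F} {e e' m : ℤ} (hb : ‖b‖ = (q : ℝ) ^ (-e))
    (ha : ‖a‖ = (q : ℝ) ^ (-e')) (k : ℕ) (hm : m = e' + 2 * k) :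
    mixedInt q π ψ a b m =
      (q : ℂ)⁻¹ ^ k * if m = e + 1 then (q : ℂ) ^ e * chi π b * gaussInt π ψ else 0 := by
  rw [h.mixedInt_of_const hb]
  intro x hx
  apply h.quadInt_even
  rw [norm_mul, ha, hx, ← zpow_add₀ h.pos.ne', ← zpow_natCast]
  congr 1
  push_cast
  omega

/-- The quadratic integral contributes χ(ax), which cancels the χ(x) already present. What is left
is an integral of ψ alone, nonzero at every radius up to q^(e+1). -/
theorem mixedInt_odd {a b : F} {e e' m : ℤ} (hb : ‖b‖ = (q : ℝ) ^ (-e))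
    (ha : ‖a‖ = (q : ℝ) ^ (-e')) (k : ℕ) (hm : m = e' + 2 * k + 1) :
    mixedInt q π ψ a b m = (q : ℂ)⁻¹ ^ (k + 1) * chi π a * gaussInt π ψ *
      if m ≤ e then (q : ℂ) ^ m - (q : ℂ) ^ (m - 1) else
        if m = e + 1 then -(q : ℂ) ^ e else 0 := by
  rw [← h.integral_sphere_psi hb, mixedInt, ← integral_const_mul]
  refine setIntegral_congr_fun isClosed_sphere.measurableSet fun x hx => ?_
  have hx' : ‖x‖ = (q : ℝ) ^ m := by simpa using hx
  have hx0 : x ≠ 0 := by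
    rw [← norm_ne_zero_iff, hx']; exact (zpow_pos h.pos _).ne'
  have ha0 : a ≠ 0 := by
    rw [← norm_ne_zero_iff, ha]; exact (zpow_pos h.pos _).ne'
  rw [h.quadInt_odd k, h.chi_mul ha0 hx0]
  · have := chi_mul_self (π := π) x
    linear_combination (q : ℂ)⁻¹ ^ (k + 1) * chi π a * gaussInt π ψ * (ψ (b * x) : ℂ) * this
  · rw [norm_mul, ha, hx', ← zpow_add₀ h.pos.ne', ← zpow_natCast]
    congr 1
    push_cast
    omega

theorem mixedInt_eq_zero {a b : F} {e e' m : ℤ} (hb : ‖b‖ = (q : ℝ) ^ (-e))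
    (ha : ‖a‖ = (q : ℝ) ^ (-e')) (hm : e + 1 < m) : mixedInt q π ψ a b m = 0 := by
  rcases le_or_gt m e' with hme | hme
  · rw [h.mixedInt_of_le hb ha hme, if_neg hm.ne']
  obtain ⟨k, hk | hk⟩ : ∃ k : ℕ, m = e' + 2 * k ∨ m = e' + 2 * k + 1 :=
    ⟨((m - e') / 2).toNat, by omega⟩
  · rw [h.mixedInt_even hb ha k hk, if_neg hm.ne', mul_zero]
  · rw [h.mixedInt_odd hb ha k hk, if_neg (by omega), if_neg hm.ne', mul_zero]

end IsNormalizedWith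

end Radial

/-! ### Coordinates on symmetric matrices. -/

section Coordinates

variable {F : Type*} [NontriviallyNormedField F] [ProperSpace F] [MeasurableSpace F] [BorelSpace F]

open Classical in
/-- The coordinates `i, j, k` on the symmetric matrices. -/
def coordEquiv (F : Type*) [MeasurableSpace F] (i j k : UpperIdx 2) (hij : i ≠ j) (hik : i ≠ k)
    (hjk : j ≠ k) (hall : ∀ l, l = i ∨ l = j ∨ l = k) : F × F × F ≃ᵐ (UpperIdx 2 → F) where
  toFun p l := if l = i then p.1 else if l = j then p.2.1 else p.2.2
  invFun x := (x i, x j, x k)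
  left_inv p := by simp [hij.symm, hik.symm, hjk.symm]
  right_inv x := by
    ext l
    rcases hall l with rfl | rfl | rfl <;> simp [hij.symm, hik.symm, hjk.symm]
  measurable_toFun := by
    refine measurable_pi_lambda _ fun l => ?_
    change Measurable fun p : F × F × F => if l = i then p.1 else if l = j then p.2.1 else p.2.2
    split_ifs <;> fun_prop
  measurable_invFun := by
    change Measurable fun x : UpperIdx 2 → F => (x i, x j, x k)
    fun_prop

theorem measurePreserving_coordEquiv (i j k : UpperIdx 2) (hij : i ≠ j) (hik : i ≠ k)
    (hjk : j ≠ k) (hall : ∀ l, l = i ∨ l = j ∨ l = k) :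
    MeasurePreserving (coordEquiv F i j k hij hik hjk hall)
      ((haarF F).prod ((haarF F).prod (haarF F))) (haarSym F 2) := by
  classical
  refine ⟨(coordEquiv F i j k hij hik hjk hall).measurable, ?_⟩
  symm
  refine Measure.pi_eq fun s _ => ?_
  rw [MeasurableEquiv.map_apply]
  have hpre : coordEquiv F i j k hij hik hjk hall ⁻¹' Set.univ.pi s = s i ×ˢ (s j ×ˢ s k) := by
    ext p
    simp only [Set.mem_preimage, Set.mem_pi, Set.mem_univ, forall_true_left, Set.mem_prod]
    constructor
    · intro hp
      have h1 := hp i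
      have h2 := hp j
      have h3 := hp k
      simp only [coordEquiv, MeasurableEquiv.coe_mk, Equiv.coe_fn_mk, if_true, hij.symm, hik.symm,
        hjk.symm, if_false] at h1 h2 h3
      exact ⟨h1, h2, h3⟩
    · rintro ⟨h1, h2, h3⟩ l
      rcases hall l with rfl | rfl | rfl <;>
        simp only [coordEquiv, MeasurableEquiv.coe_mk, Equiv.coe_fn_mk, if_true, hij.symm, hik.symm,
        hjk.symm, if_false] <;> assumption
  have huniv : (Finset.univ : Finset (UpperIdx 2)) = {i, j, k} := by
    ext l; simpa using hall l
  rw [hpre, Measure.prod_prod, Measure.prod_prod, huniv, Finset.prod_insert (by simp [hij, hik]),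
    Finset.prod_insert (by simp [hjk]), Finset.prod_singleton]

end Coordinates

end RamifiedSiegel

namespace RamifiedSiegel

open Metric

/-! ### The region where one diagonal entry dominates. -/

section Shell

variable {F : Type*} [NontriviallyNormedField F] [ProperSpace F] [MeasurableSpace F] [BorelSpace F]

theorem measurePreserving_shear {g : F → F → F} (hg : Measurable (Function.uncurry g)) :
    MeasurePreserving (fun p : F × F × F => (p.1, p.2.1, p.2.2 + g p.1 p.2.1))
      ((haarF F).prod ((haarF F).prod (haarF F))) ((haarF F).prod ((haarF F).prod (haarF F))) := by
  refine (MeasurePreserving.id (haarF F)).skew_product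
    (g := fun x (y : F × F) => (y.1, y.2 + g x y.1)) ?_ (Filter.Eventually.of_forall fun x => ?_)
  · have : Measurable fun p : F × F × F => g p.1 p.2.1 :=
      hg.comp (by fun_prop : Measurable fun p : F × F × F => (p.1, p.2.1))
    exact (by fun_prop : Measurable fun p : F × F × F => (p.2.1, p.2.2 + g p.1 p.2.1))
  · refine ((MeasurePreserving.id (haarF F)).skew_product
      (g := fun y z => z + g x y) ?_ (Filter.Eventually.of_forall fun y => ?_)).map_eq
    · have : Measurable fun p : F × F => g x p.1 :=
        hg.comp (by fun_prop : Measurable fun p : F × F => (x, p.1))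
      exact (by fun_prop : Measurable fun p : F × F => p.2 + g x p.1)
    · exact map_add_right_eq_self (haarF F) (g x y)

/-- The part of a Siegel integrand on which the first diagonal entry `x` dominates:
`V` is evaluated at `x` and the complementary entry `z - y² / x`. -/
def shellFn (π : F) (ψ : AddChar F Circle) (s : ℂ) (r b b' : F) (V : F → F → ℂ)
    (p : F × F × F) : ℂ :=
  {p : F × F × F | 1 < ‖p.1‖ ∧ ‖p.2.1‖ ≤ ‖r * p.1‖}.indicator (fun p =>
    chi π p.1 * normCpow s p.1 * (ψ (b * p.1 + b' * p.2.2) : ℂ) *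
      V p.1 (p.2.2 - p.2.1 ^ 2 / p.1)) p

variable [IsUltrametricDist F] {q : ℕ} {π : F} {ψ : AddChar F Circle}

namespace IsNormalizedWith

variable (h : IsNormalizedWith q π ψ)
include h

theorem measurable_shellFn (s : ℂ) (r b b' : F) {V : F → F → ℂ}
    (hV : Measurable (Function.uncurry V)) : Measurable (shellFn π ψ s r b b' V) := by
  have h1 : Measurable fun p : F × F × F => chi π p.1 := h.measurable_chi.comp measurable_fst
  have h2 : Measurable fun p : F × F × F => normCpow s p.1 :=
    (measurable_normCpow s).comp measurable_fst
  have h3 : Measurable fun p : F × F × F => (ψ (b * p.1 + b' * p.2.2) : ℂ) :=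
    h.measurable_psi.comp (by fun_prop : Measurable fun p : F × F × F => b * p.1 + b' * p.2.2)
  have h4 : Measurable fun p : F × F × F => V p.1 (p.2.2 - p.2.1 ^ 2 / p.1) :=
    hV.comp (by fun_prop : Measurable fun p : F × F × F => (p.1, p.2.2 - p.2.1 ^ 2 / p.1))
  refine (((h1.mul h2).mul h3).mul h4).indicator ?_
  have h5 : MeasurableSet {p : F × F × F | 1 < ‖p.1‖} :=
    measurableSet_lt measurable_const (by fun_prop)
  have h6 : MeasurableSet {p : F × F × F | ‖p.2.1‖ ≤ ‖r * p.1‖} :=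
    measurableSet_le (by fun_prop) (by fun_prop)
  exact h5.inter h6

/-- The factor of the sheared integrand depending on `x` only. -/
theorem shellFn_shear (s : ℂ) (r b b' : F) (V : F → F → ℂ) (x y v : F) :
    shellFn π ψ s r b b' V (x, y, v + y ^ 2 / x) =
      {x : F | 1 < ‖x‖}.indicator (fun x => chi π x * normCpow s x * (ψ (b * x) : ℂ)) x *
        ((closedBall (0 : F) ‖r * x‖).indicator (fun y => (ψ (b' * (y ^ 2 / x)) : ℂ)) y *
          ((ψ (b' * v) : ℂ) * V x v)) := by
  by_cases hx : 1 < ‖x‖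
  · by_cases hy : ‖y‖ ≤ ‖r * x‖
    · have hmem : (x, y, v + y ^ 2 / x) ∈ {p : F × F × F | 1 < ‖p.1‖ ∧ ‖p.2.1‖ ≤ ‖r * p.1‖} :=
        ⟨hx, hy⟩
      rw [shellFn, Set.indicator_of_mem hmem, Set.indicator_of_mem (s := {x : F | 1 < ‖x‖}) hx,
        Set.indicator_of_mem (by simpa using hy)]
      simp only [add_sub_cancel_right, mul_add, AddChar.map_add_eq_mul, Circle.coe_mul]
      ring
    · have hmem : (x, y, v + y ^ 2 / x) ∉ {p : F × F × F | 1 < ‖p.1‖ ∧ ‖p.2.1‖ ≤ ‖r * p.1‖} :=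
        fun hm => hy hm.2
      rw [shellFn, Set.indicator_of_notMem hmem,
        Set.indicator_of_notMem (s := closedBall _ _) (by simpa using hy)]
      ring
  · have hmem : (x, y, v + y ^ 2 / x) ∉ {p : F × F × F | 1 < ‖p.1‖ ∧ ‖p.2.1‖ ≤ ‖r * p.1‖} :=
      fun hm => hx hm.1
    rw [shellFn, Set.indicator_of_notMem hmem,
      Set.indicator_of_notMem (s := {x : F | 1 < ‖x‖}) hx]
    ring

/-- The y-integral has size |rx| and the v-integral is bounded by K, which leaves |x|^(1 - Re s).
Its integrability at infinity is the source of the condition Re s > 2. -/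
theorem integrable_shellFn_shear {s : ℂ} (hs : 2 < s.re) {r : F} (hr : r ≠ 0) (b b' : F)
    {V : F → F → ℂ} (hV : Measurable (Function.uncurry V)) {K : ENNReal} (hK : K ≠ ⊤)
    (hVK : ∀ x, 1 < ‖x‖ → ∫⁻ v, ‖V x v‖ₑ ∂haarF F ≤ K) :
    Integrable (fun p : F × F × F => shellFn π ψ s r b b' V (p.1, p.2.1, p.2.2 + p.2.1 ^ 2 / p.1))
      ((haarF F).prod ((haarF F).prod (haarF F))) := by
  have hmeas : Measurable fun p : F × F × F =>
      shellFn π ψ s r b b' V (p.1, p.2.1, p.2.2 + p.2.1 ^ 2 / p.1) :=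
    (h.measurable_shellFn s r b b' hV).comp (by fun_prop)
  refine ⟨hmeas.aestronglyMeasurable, ?_⟩
  rw [hasFiniteIntegral_iff_enorm, lintegral_prod _ hmeas.enorm.aemeasurable]
  have hbound : ∀ x : F, ∫⁻ p : F × F, ‖shellFn π ψ s r b b' V (x, p.1, p.2 + p.1 ^ 2 / x)‖ₑ
      ∂((haarF F).prod (haarF F)) ≤ {x : F | 1 < ‖x‖}.indicator
        (fun x => ENNReal.ofReal (‖x‖ ^ (-(s.re - 1))) * (ENNReal.ofReal ‖r‖ * K)) x := by
    intro x
    simp only [h.shellFn_shear]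
    by_cases hx : 1 < ‖x‖
    swap
    · rw [Set.indicator_of_notMem (s := {x : F | 1 < ‖x‖}) hx,
        Set.indicator_of_notMem (s := {x : F | 1 < ‖x‖}) hx]
      simp
    have hxpos := one_pos.trans hx
    have hx0 : x ≠ 0 := norm_pos_iff.1 hxpos
    rw [Set.indicator_of_mem (s := {x : F | 1 < ‖x‖}) hx,
      Set.indicator_of_mem (s := {x : F | 1 < ‖x‖}) hx]
    simp only [enorm_mul]
    have hmB : Measurable fun y : F =>
        ‖(closedBall (0 : F) ‖r * x‖).indicator (fun y => (ψ (b' * (y ^ 2 / x)) : ℂ)) y‖ₑ :=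
      ((h.measurable_psi.comp (by fun_prop : Measurable fun y : F => b' * (y ^ 2 / x))).indicator
        measurableSet_closedBall).enorm
    have hmC : Measurable fun v : F => ‖(ψ (b' * v) : ℂ)‖ₑ * ‖V x v‖ₑ :=
      (h.measurable_psi.comp (by fun_prop : Measurable fun v : F => b' * v)).enorm.mul
        (hV.comp (by fun_prop : Measurable fun v : F => (x, v))).enorm
    have hmBC : Measurable fun p : F × F =>
        ‖(closedBall (0 : F) ‖r * x‖).indicator (fun y => (ψ (b' * (y ^ 2 / x)) : ℂ)) p.1‖ₑ *
          (‖(ψ (b' * p.2) : ℂ)‖ₑ * ‖V x p.2‖ₑ) :=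
      (hmB.comp measurable_fst).mul (hmC.comp measurable_snd)
    rw [lintegral_const_mul _ hmBC,
      lintegral_prod_mul hmB.aemeasurable hmC.aemeasurable]
    have hψ (a : F) : ‖(ψ a : ℂ)‖ₑ = 1 := by
      rw [← ofReal_norm, Circle.norm_coe, ENNReal.ofReal_one]
    have hB : ∫⁻ y, ‖(closedBall (0 : F) ‖r * x‖).indicator
        (fun y => (ψ (b' * (y ^ 2 / x)) : ℂ)) y‖ₑ ∂haarF F = ENNReal.ofReal ‖r * x‖ := by
      simp only [enorm_indicator_eq_indicator_enorm, hψ]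
      rw [lintegral_indicator measurableSet_closedBall, setLIntegral_const, one_mul,
        h.haarF_closedBall_norm (mul_ne_zero hr hx0)]
    have hA : ‖chi π x‖ₑ * ‖normCpow s x‖ₑ * ‖(ψ (b * x) : ℂ)‖ₑ =
        ENNReal.ofReal (‖x‖ ^ (-s.re)) := by
      rw [hψ, mul_one, ← ofReal_norm, ← ofReal_norm, norm_chi,
        norm_normCpow s hx0, ENNReal.ofReal_one, one_mul]
    rw [hA, hB]
    simp only [hψ, one_mul]
    calc ENNReal.ofReal (‖x‖ ^ (-s.re)) * (ENNReal.ofReal ‖r * x‖ * ∫⁻ v, ‖V x v‖ₑ ∂haarF F)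
        ≤ ENNReal.ofReal (‖x‖ ^ (-s.re)) * (ENNReal.ofReal ‖r * x‖ * K) := by
          gcongr; exact hVK x hx
      _ = ENNReal.ofReal (‖x‖ ^ (-(s.re - 1))) * (ENNReal.ofReal ‖r‖ * K) := by
          rw [norm_mul, ENNReal.ofReal_mul (norm_nonneg _), neg_sub, sub_eq_add_neg,
            Real.rpow_add hxpos, Real.rpow_one, ENNReal.ofReal_mul hxpos.le]
          ring
  refine (lintegral_mono hbound).trans_lt ?_
  rw [lintegral_indicator measurableSet_one_lt_norm, lintegral_mul_const]
  · exact ENNReal.mul_lt_top (h.lintegral_norm_rpow_lt_top (by linarith))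
      (ENNReal.mul_lt_top ENNReal.ofReal_lt_top hK.lt_top)
  · exact (measurable_norm.pow_const _).ennreal_ofReal

theorem measurePreserving_shear_sq :
    MeasurePreserving (fun p : F × F × F => (p.1, p.2.1, p.2.2 + p.2.1 ^ 2 / p.1))
      ((haarF F).prod ((haarF F).prod (haarF F))) ((haarF F).prod ((haarF F).prod (haarF F))) :=
  measurePreserving_shear (g := fun x y => y ^ 2 / x)
    (by fun_prop : Measurable fun p : F × F => p.2 ^ 2 / p.1)

theorem integrable_shellFn {s : ℂ} (hs : 2 < s.re) {r : F} (hr : r ≠ 0) (b b' : F)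
    {V : F → F → ℂ} (hV : Measurable (Function.uncurry V)) {K : ENNReal} (hK : K ≠ ⊤)
    (hVK : ∀ x, 1 < ‖x‖ → ∫⁻ v, ‖V x v‖ₑ ∂haarF F ≤ K) :
    Integrable (shellFn π ψ s r b b' V) ((haarF F).prod ((haarF F).prod (haarF F))) :=
  (h.measurePreserving_shear_sq.integrable_comp
    (h.measurable_shellFn s r b b' hV).aestronglyMeasurable).1
      (h.integrable_shellFn_shear hs hr b b' hV hK hVK)

theorem integral_psi_sq_div {r x : F} (hr : r ≠ 0) (hx : x ≠ 0) (b' : F) :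
    ∫ y, (closedBall (0 : F) ‖r * x‖).indicator (fun y => (ψ (b' * (y ^ 2 / x)) : ℂ)) y ∂haarF F =
      ‖r * x‖ * quadInt ψ (b' * r ^ 2 * x) := by
  have hrx := mul_ne_zero hr hx
  rw [integral_indicator measurableSet_closedBall, h.integral_closedBall_mul hrx,
    inv_mul_cancel₀ (norm_ne_zero_iff.2 hrx), quadInt]
  congr 2
  ext y
  congr 2
  field_simp

/-- After the shear the integral factors over y and v for fixed x, and depends on x only through |x|
apart from the integrand of `mixedInt`. That integral vanishes beyond radius q^(e+1), so the sum
over spheres is finite. -/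
theorem integral_shellFn {s : ℂ} (hs : 2 < s.re) {r : F} (hr : r ≠ 0) {b b' : F} {e e' : ℕ}
    (hb : ‖b‖ = (q : ℝ) ^ (-(e : ℤ))) (hb' : ‖b' * r ^ 2‖ = (q : ℝ) ^ (-(e' : ℤ)))
    {V : F → F → ℂ} (hV : Measurable (Function.uncurry V)) {K : ENNReal} (hK : K ≠ ⊤)
    (hVK : ∀ x, 1 < ‖x‖ → ∫⁻ v, ‖V x v‖ₑ ∂haarF F ≤ K) {W : ℕ → ℂ}
    (hW : ∀ m : ℕ, 1 ≤ m → ∀ x, ‖x‖ = (q : ℝ) ^ m →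
      ∫ v, (ψ (b' * v) : ℂ) * V x v ∂haarF F = W m) :
    ∫ p, shellFn π ψ s r b b' V p ∂((haarF F).prod ((haarF F).prod (haarF F))) =
      ∑ m ∈ Finset.range (e + 1), ((q : ℂ) ^ (-s)) ^ (m + 1) * (‖r‖ * (q : ℂ) ^ (m + 1)) *
        W (m + 1) * mixedInt q π ψ (b' * r ^ 2) b ((m : ℤ) + 1) := by
  have hint := h.integrable_shellFn_shear hs hr b b' hV hK hVK
  have h1 : ∫ p, shellFn π ψ s r b b' V p ∂((haarF F).prod ((haarF F).prod (haarF F))) =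
      ∫ p : F × F × F, shellFn π ψ s r b b' V (p.1, p.2.1, p.2.2 + p.2.1 ^ 2 / p.1)
        ∂((haarF F).prod ((haarF F).prod (haarF F))) := by
    conv_lhs => rw [← h.measurePreserving_shear_sq.map_eq]
    rw [integral_map h.measurePreserving_shear_sq.measurable.aemeasurable
      (h.measurable_shellFn s r b b' hV).aestronglyMeasurable]
  have h2 : ∀ x : F, ∫ p : F × F, shellFn π ψ s r b b' V (x, p.1, p.2 + p.1 ^ 2 / x)
      ∂((haarF F).prod (haarF F)) = {x : F | 1 < ‖x‖}.indicator (fun x =>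
        chi π x * normCpow s x * (ψ (b * x) : ℂ) * (‖r * x‖ * quadInt ψ (b' * r ^ 2 * x) *
          ∫ v, (ψ (b' * v) : ℂ) * V x v ∂haarF F)) x := by
    intro x
    simp only [h.shellFn_shear]
    by_cases hx : 1 < ‖x‖
    swap
    · rw [Set.indicator_of_notMem (s := {x : F | 1 < ‖x‖}) hx,
        Set.indicator_of_notMem (s := {x : F | 1 < ‖x‖}) hx]
      simp
    have hx0 : x ≠ 0 := norm_pos_iff.1 (one_pos.trans hx)
    rw [Set.indicator_of_mem (s := {x : F | 1 < ‖x‖}) hx,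
      Set.indicator_of_mem (s := {x : F | 1 < ‖x‖}) hx, integral_const_mul,
      integral_prod_mul (fun y => (closedBall (0 : F) ‖r * x‖).indicator
        (fun y => (ψ (b' * (y ^ 2 / x)) : ℂ)) y) (fun v => (ψ (b' * v) : ℂ) * V x v),
      h.integral_psi_sq_div hr hx0]
  have hint2 := hint.integral_prod_left
  rw [h1, integral_prod _ hint]
  simp only [h2] at hint2 ⊢
  rw [integral_indicator measurableSet_one_lt_norm]
  have hsum := h.hasSum_integral_sphere
    ((integrable_indicator_iff measurableSet_one_lt_norm).1 hint2)
  refine hsum.unique ?_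
  have hterm : ∀ m : ℕ, ∫ x in sphere 0 ((q : ℝ) ^ ((m : ℤ) + 1)),
      chi π x * normCpow s x * (ψ (b * x) : ℂ) * (‖r * x‖ * quadInt ψ (b' * r ^ 2 * x) *
          ∫ v, (ψ (b' * v) : ℂ) * V x v ∂haarF F) ∂haarF F =
      ((q : ℂ) ^ (-s)) ^ (m + 1) * (‖r‖ * (q : ℂ) ^ (m + 1)) *
        W (m + 1) * mixedInt q π ψ (b' * r ^ 2) b ((m : ℤ) + 1) := by
    intro m
    rw [mixedInt, ← integral_const_mul]
    refine setIntegral_congr_fun isClosed_sphere.measurableSet fun x hx => ?_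
    have hx' : ‖x‖ = (q : ℝ) ^ (m + 1) := by
      have : ‖x‖ = (q : ℝ) ^ ((m : ℤ) + 1) := by simpa using hx
      exact_mod_cast this
    rw [hW (m + 1) (by omega) x hx', h.normCpow_of_norm_eq s hx', norm_mul, hx']
    push_cast
    ring
  simp only [hterm]
  refine hasSum_sum_of_ne_finset_zero fun m hm => ?_
  rw [Finset.mem_range, not_lt] at hm
  rw [h.mixedInt_eq_zero (e := e) (e' := e') hb hb' (by omega), mul_zero]

end IsNormalizedWith

end Shell

end RamifiedSiegel

namespace RamifiedSiegel

open Metric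

/-! ### Weights in the complementary variable, and the off-diagonal region. -/

section Pieces

variable {F : Type*} [NontriviallyNormedField F] [ProperSpace F] [MeasurableSpace F] [BorelSpace F]

/-- The weight `χ(v) ‖v‖ ^ (-s)` on `1 < ‖v‖ ≤ ‖r x‖`. -/
def ramifiedWeight (π : F) (s : ℂ) (r x v : F) : ℂ :=
  {p : F × F | 1 < ‖p.2‖ ∧ ‖p.2‖ ≤ ‖r * p.1‖}.indicator
    (fun p => chi π p.2 * normCpow s p.2) (x, v)

/-- The indicator function of the ring of integers in the second variable. -/
def integralWeight (_x v : F) : ℂ := (closedBall (0 : F) 1).indicator (fun _ => 1) v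

/-- The part of a Siegel integrand on which the off-diagonal entry `y` dominates; the arguments
are `(y, x, z)`. -/
def offDiagFn (π : F) (ψ : AddChar F Circle) (s : ℂ) (b b' : F) (p : F × F × F) : ℂ :=
  {p : F × F × F | 1 < ‖p.1‖ ∧ ‖p.2.1‖ ≤ ‖π * p.1‖ ∧ ‖p.2.2‖ ≤ ‖p.1‖}.indicator (fun p =>
    chi π (-1) * normCpow s (p.1 ^ 2) * (ψ (b * p.2.1 + b' * p.2.2) : ℂ)) p

theorem ramifiedWeight_of_mem {π : F} {s : ℂ} {r x v : F} (h1 : 1 < ‖v‖) (h2 : ‖v‖ ≤ ‖r * x‖) :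
    ramifiedWeight π s r x v = chi π v * normCpow s v :=
  Set.indicator_of_mem (s := {p : F × F | 1 < ‖p.2‖ ∧ ‖p.2‖ ≤ ‖r * p.1‖}) ⟨h1, h2⟩ _

theorem ramifiedWeight_of_notMem {π : F} {s : ℂ} {r x v : F} (h1 : ¬(1 < ‖v‖ ∧ ‖v‖ ≤ ‖r * x‖)) :
    ramifiedWeight π s r x v = 0 :=
  Set.indicator_of_notMem (s := {p : F × F | 1 < ‖p.2‖ ∧ ‖p.2‖ ≤ ‖r * p.1‖}) h1 _

theorem measurable_integralWeight :
    Measurable (Function.uncurry (integralWeight : F → F → ℂ)) :=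
  (measurable_const.indicator measurableSet_closedBall).comp measurable_snd

theorem lintegral_integralWeight (x : F) : ∫⁻ v, ‖integralWeight x v‖ₑ ∂haarF F ≤ 1 := by
  simp only [integralWeight, enorm_indicator_eq_indicator_enorm]
  rw [lintegral_indicator measurableSet_closedBall, setLIntegral_const, haarF_closedBall_one]
  simp

variable [IsUltrametricDist F] {q : ℕ} {π : F} {ψ : AddChar F Circle}

namespace IsNormalizedWith

variable (h : IsNormalizedWith q π ψ)
include h

theorem measurable_ramifiedWeight (s : ℂ) (r : F) :
    Measurable (Function.uncurry (ramifiedWeight π s r)) := by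
  have h1 : Measurable fun p : F × F => chi π p.2 := h.measurable_chi.comp measurable_snd
  have h2 : Measurable fun p : F × F => normCpow s p.2 :=
    (measurable_normCpow s).comp measurable_snd
  have h5 : MeasurableSet {p : F × F | 1 < ‖p.2‖} :=
    measurableSet_lt measurable_const (by fun_prop)
  have h6 : MeasurableSet {p : F × F | ‖p.2‖ ≤ ‖r * p.1‖} :=
    measurableSet_le (by fun_prop) (by fun_prop)
  exact (h1.mul h2).indicator (h5.inter h6)

theorem enorm_ramifiedWeight_le (s : ℂ) (r x v : F) : ‖ramifiedWeight π s r x v‖ₑ ≤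
    {v : F | 1 < ‖v‖}.indicator (fun v => ENNReal.ofReal (‖v‖ ^ (-s.re))) v := by
  by_cases hv : 1 < ‖v‖ ∧ ‖v‖ ≤ ‖r * x‖
  · rw [ramifiedWeight_of_mem hv.1 hv.2, Set.indicator_of_mem (s := {v : F | 1 < ‖v‖}) hv.1,
      ← ofReal_norm, norm_mul, norm_chi, one_mul, norm_normCpow s
        (norm_pos_iff.1 (one_pos.trans hv.1))]
  · rw [ramifiedWeight_of_notMem hv]
    simp

theorem lintegral_ramifiedWeight (s : ℂ) (r x : F) : ∫⁻ v, ‖ramifiedWeight π s r x v‖ₑ ∂haarF F ≤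
    ∫⁻ v in {v : F | 1 < ‖v‖}, ENNReal.ofReal (‖v‖ ^ (-s.re)) ∂haarF F := by
  rw [← lintegral_indicator measurableSet_one_lt_norm]
  exact lintegral_mono (h.enorm_ramifiedWeight_le s r x)

theorem integral_integralWeight {b' : F} (hb' : ‖b'‖ ≤ 1) (x : F) :
    ∫ v, (ψ (b' * v) : ℂ) * integralWeight x v ∂haarF F = 1 := by
  have h1 := h.integral_closedBall_psi b' 0
  rw [zpow_zero, mul_one, if_pos hb', zpow_zero, ← integral_indicator measurableSet_closedBall] at h1
  rw [← h1]
  congr 1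
  ext v
  by_cases hv : v ∈ closedBall (0 : F) 1
  · rw [integralWeight, Set.indicator_of_mem hv, Set.indicator_of_mem hv, mul_one]
  · rw [integralWeight, Set.indicator_of_notMem hv, Set.indicator_of_notMem hv, mul_zero]

/-- A Gauss integral sees only the sphere |v| = q^(e'+1), and this sphere lies in the support of the
weight exactly when q^(e'+1) ≤ |rx| = q^(m-ρ). -/
theorem integral_ramifiedWeight {s : ℂ} (hs : 1 < s.re) {b' : F} {e' ρ : ℕ}
    (hb' : ‖b'‖ = (q : ℝ) ^ (-(e' : ℤ))) {r : F} (hr : ‖r‖ = (q : ℝ) ^ (-(ρ : ℤ))) {m : ℕ} {x : F}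
    (hx : ‖x‖ = (q : ℝ) ^ m) :
    ∫ v, (ψ (b' * v) : ℂ) * ramifiedWeight π s r x v ∂haarF F =
      if e' + 1 + ρ ≤ m then ((q : ℂ) ^ (-s)) ^ (e' + 1) * ((q : ℂ) ^ e' * chi π b' * gaussInt π ψ)
      else 0 := by
  have hmeas : Measurable fun v => (ψ (b' * v) : ℂ) * ramifiedWeight π s r x v :=
    (h.measurable_psi.comp (by fun_prop : Measurable fun v : F => b' * v)).mul
      ((h.measurable_ramifiedWeight s r).comp (by fun_prop : Measurable fun v : F => (x, v)))
  have hint : Integrable (fun v => (ψ (b' * v) : ℂ) * ramifiedWeight π s r x v) (haarF F) := by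
    refine ⟨hmeas.aestronglyMeasurable, ?_⟩
    rw [hasFiniteIntegral_iff_enorm]
    refine lt_of_le_of_lt ?_ (h.lintegral_norm_rpow_lt_top hs)
    refine le_trans (lintegral_mono fun v => ?_) (h.lintegral_ramifiedWeight s r x)
    rw [enorm_mul, ← ofReal_norm, Circle.norm_coe, ENNReal.ofReal_one, one_mul]
  have hsum := h.hasSum_integral_sphere hint.integrableOn
  rw [setIntegral_eq_integral_of_forall_compl_eq_zero (s := {x : F | 1 < ‖x‖})] at hsum
  swap
  · intro v hv
    rw [ramifiedWeight_of_notMem (fun h1 => hv h1.1), mul_zero]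
  have hrx : ‖r * x‖ = (q : ℝ) ^ ((m : ℤ) - ρ) := by
    rw [norm_mul, hr, hx, ← zpow_natCast, ← zpow_add₀ h.pos.ne']
    congr 1; ring
  refine hsum.unique ?_
  have hterm : ∀ k : ℕ, ∫ v in sphere 0 ((q : ℝ) ^ ((k : ℤ) + 1)),
      (ψ (b' * v) : ℂ) * ramifiedWeight π s r x v ∂haarF F =
      if k = e' then (if e' + 1 + ρ ≤ m then
        ((q : ℂ) ^ (-s)) ^ (e' + 1) * ((q : ℂ) ^ e' * chi π b' * gaussInt π ψ) else 0) else 0 := by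
    intro k
    by_cases hk : k + 1 + ρ ≤ m
    · have h1 : Set.EqOn (fun v => (ψ (b' * v) : ℂ) * ramifiedWeight π s r x v)
          (fun v => ((q : ℂ) ^ (-s)) ^ (k + 1) * (chi π v * (ψ (b' * v) : ℂ)))
          (sphere 0 ((q : ℝ) ^ ((k : ℤ) + 1))) := by
        intro v hv
        have hv1 : ‖v‖ = (q : ℝ) ^ ((k : ℤ) + 1) := by simpa using hv
        have hv2 : ‖v‖ = (q : ℝ) ^ (k + 1) := by exact_mod_cast hv1
        beta_reduce
        rw [ramifiedWeight_of_mem, h.normCpow_of_norm_eq s hv2]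
        · ring
        · rw [hv1, ← zpow_zero (q : ℝ), h.zpow_lt_iff]; omega
        · rw [hv1, hrx, h.zpow_le_iff]; omega
      rw [setIntegral_congr_fun isClosed_sphere.measurableSet h1, integral_const_mul,
        h.integral_sphere_chi_psi hb']
      by_cases hke : k = e'
      · subst hke
        rw [if_pos rfl, if_pos rfl, if_pos hk, zpow_natCast]
      · rw [if_neg (by omega), if_neg hke, mul_zero]
    · rw [setIntegral_congr_fun (g := fun _ => 0) isClosed_sphere.measurableSet, integral_zero]
      · split_ifs with h1 h2
        · omega
        · rfl
        · rfl
      · intro v hv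
        have hv1 : ‖v‖ = (q : ℝ) ^ ((k : ℤ) + 1) := by simpa using hv
        beta_reduce
        rw [ramifiedWeight_of_notMem, mul_zero]
        rintro ⟨_, h2⟩
        rw [hv1, hrx, h.zpow_le_iff] at h2
        omega
  simp only [hterm]
  exact hasSum_ite_eq e' _

theorem offDiagFn_eq (s : ℂ) (b b' : F) (y x z : F) :
    offDiagFn π ψ s b b' (y, x, z) =
      {y : F | 1 < ‖y‖}.indicator (fun y => chi π (-1) * normCpow s (y ^ 2)) y *
        ((closedBall (0 : F) ‖π * y‖).indicator (fun x => (ψ (b * x) : ℂ)) x *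
          (closedBall (0 : F) ‖y‖).indicator (fun z => (ψ (b' * z) : ℂ)) z) := by
  by_cases hm : 1 < ‖y‖ ∧ ‖x‖ ≤ ‖π * y‖ ∧ ‖z‖ ≤ ‖y‖
  · rw [offDiagFn, Set.indicator_of_mem (s := {p : F × F × F |
        1 < ‖p.1‖ ∧ ‖p.2.1‖ ≤ ‖π * p.1‖ ∧ ‖p.2.2‖ ≤ ‖p.1‖}) hm,
      Set.indicator_of_mem (s := {y : F | 1 < ‖y‖}) hm.1,
      Set.indicator_of_mem (by simpa using hm.2.1), Set.indicator_of_mem (by simpa using hm.2.2)]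
    simp only [AddChar.map_add_eq_mul, Circle.coe_mul]
  · rw [offDiagFn, Set.indicator_of_notMem (s := {p : F × F × F |
        1 < ‖p.1‖ ∧ ‖p.2.1‖ ≤ ‖π * p.1‖ ∧ ‖p.2.2‖ ≤ ‖p.1‖}) hm]
    by_cases h1 : 1 < ‖y‖
    · by_cases h2 : ‖x‖ ≤ ‖π * y‖
      · have h3 : ¬‖z‖ ≤ ‖y‖ := fun h3 => hm ⟨h1, h2, h3⟩
        rw [Set.indicator_of_notMem (s := closedBall (0 : F) ‖y‖) (by simpa using h3)]
        simp
      · rw [Set.indicator_of_notMem (s := closedBall (0 : F) ‖π * y‖) (by simpa using h2)]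
        simp
    · rw [Set.indicator_of_notMem (s := {y : F | 1 < ‖y‖}) h1]
      simp

theorem measurable_offDiagFn (s : ℂ) (b b' : F) : Measurable (offDiagFn π ψ s b b') := by
  have h2 : Measurable fun p : F × F × F => normCpow s (p.1 ^ 2) :=
    (measurable_normCpow s).comp (by fun_prop : Measurable fun p : F × F × F => p.1 ^ 2)
  have h3 : Measurable fun p : F × F × F => (ψ (b * p.2.1 + b' * p.2.2) : ℂ) :=
    h.measurable_psi.comp (by fun_prop : Measurable fun p : F × F × F => b * p.2.1 + b' * p.2.2)
  have h5 : MeasurableSet {p : F × F × F | 1 < ‖p.1‖} :=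
    measurableSet_lt measurable_const (by fun_prop)
  have h6 : MeasurableSet {p : F × F × F | ‖p.2.1‖ ≤ ‖π * p.1‖} :=
    measurableSet_le (by fun_prop) (by fun_prop)
  have h7 : MeasurableSet {p : F × F × F | ‖p.2.2‖ ≤ ‖p.1‖} :=
    measurableSet_le (by fun_prop) (by fun_prop)
  exact ((measurable_const.mul h2).mul h3).indicator (h5.inter (h6.inter h7))

theorem integrable_offDiagFn {s : ℂ} (hs : 2 < s.re) (b b' : F) :
    Integrable (offDiagFn π ψ s b b') ((haarF F).prod ((haarF F).prod (haarF F))) := by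
  have hmeas := h.measurable_offDiagFn s b b'
  refine ⟨hmeas.aestronglyMeasurable, ?_⟩
  rw [hasFiniteIntegral_iff_enorm, lintegral_prod _ hmeas.enorm.aemeasurable]
  have hψ (a : F) : ‖(ψ a : ℂ)‖ₑ = 1 := by
    rw [← ofReal_norm, Circle.norm_coe, ENNReal.ofReal_one]
  have hball (b : F) {y : F} (hy : y ≠ 0) : ∫⁻ x, ‖(closedBall (0 : F) ‖y‖).indicator
      (fun x => (ψ (b * x) : ℂ)) x‖ₑ ∂haarF F = ENNReal.ofReal ‖y‖ := by
    simp only [enorm_indicator_eq_indicator_enorm, hψ]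
    rw [lintegral_indicator measurableSet_closedBall, setLIntegral_const, one_mul,
      h.haarF_closedBall_norm hy]
  have hmB (b : F) (R : ℝ) : Measurable fun x : F =>
      ‖(closedBall (0 : F) R).indicator (fun x => (ψ (b * x) : ℂ)) x‖ₑ :=
    ((h.measurable_psi.comp (by fun_prop : Measurable fun y : F => b * y)).indicator
        measurableSet_closedBall).enorm
  have hbound : ∀ y : F, ∫⁻ p : F × F, ‖offDiagFn π ψ s b b' (y, p.1, p.2)‖ₑ
      ∂((haarF F).prod (haarF F)) ≤ {y : F | 1 < ‖y‖}.indicator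
        (fun y => ENNReal.ofReal (‖y‖ ^ (-(2 * s.re - 2))) * ENNReal.ofReal ‖π‖) y := by
    intro y
    simp only [h.offDiagFn_eq]
    by_cases hy : 1 < ‖y‖
    swap
    · rw [Set.indicator_of_notMem (s := {x : F | 1 < ‖x‖}) hy,
        Set.indicator_of_notMem (s := {x : F | 1 < ‖x‖}) hy]
      simp
    have hypos := one_pos.trans hy
    have hy0 : y ≠ 0 := norm_pos_iff.1 hypos
    rw [Set.indicator_of_mem (s := {x : F | 1 < ‖x‖}) hy,
      Set.indicator_of_mem (s := {x : F | 1 < ‖x‖}) hy]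
    simp only [enorm_mul]
    have hmBC : Measurable fun p : F × F =>
        ‖(closedBall (0 : F) ‖π * y‖).indicator (fun x => (ψ (b * x) : ℂ)) p.1‖ₑ *
          ‖(closedBall (0 : F) ‖y‖).indicator (fun x => (ψ (b' * x) : ℂ)) p.2‖ₑ :=
      ((hmB b _).comp measurable_fst).mul ((hmB b' _).comp measurable_snd)
    rw [lintegral_const_mul _ hmBC,
      lintegral_prod_mul (hmB b _).aemeasurable (hmB b' _).aemeasurable, hball b' hy0,
      hball b (mul_ne_zero h.ne_zero hy0), ← ofReal_norm, ← ofReal_norm, norm_chi,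
      norm_normCpow s (pow_ne_zero _ hy0), ENNReal.ofReal_one, one_mul,
      ← ENNReal.ofReal_mul (norm_nonneg _), ← ENNReal.ofReal_mul (by positivity),
      ← ENNReal.ofReal_mul (by positivity)]
    apply ENNReal.ofReal_le_ofReal
    have h1 : (‖y‖ ^ 2) ^ (-s.re) * (‖y‖ * ‖y‖) = ‖y‖ ^ (-(2 * s.re - 2)) := by
      rw [← pow_two, ← Real.rpow_natCast, ← Real.rpow_mul hypos.le, ← Real.rpow_add hypos]
      congr 1
      push_cast
      ring
    rw [norm_mul, _root_.norm_pow, ← h1]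
    apply le_of_eq
    ring
  refine (lintegral_mono hbound).trans_lt ?_
  rw [lintegral_indicator measurableSet_one_lt_norm, lintegral_mul_const]
  · exact ENNReal.mul_lt_top (h.lintegral_norm_rpow_lt_top (by linarith)) ENNReal.ofReal_lt_top
  · exact (measurable_norm.pow_const _).ennreal_ofReal

/-- For |y| = q^(m+1) the entry x runs over a ball of radius q^m and z over one of radius q^(m+1).
Orthogonality keeps only m ≤ e and m + 1 ≤ e', whence the minimum. -/
theorem integral_offDiagFn {s : ℂ} (hs : 2 < s.re) {b b' : F} {e e' : ℕ}
    (hb : ‖b‖ = (q : ℝ) ^ (-(e : ℤ))) (hb' : ‖b'‖ = (q : ℝ) ^ (-(e' : ℤ))) :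
    ∫ p, offDiagFn π ψ s b b' p ∂((haarF F).prod ((haarF F).prod (haarF F))) =
      ∑ m ∈ Finset.range (min (e + 1) e'), chi π (-1) * ((q : ℂ) ^ (-s)) ^ (2 * (m + 1)) *
        (((q : ℂ) ^ (m + 1) - (q : ℂ) ^ m) * ((q : ℂ) ^ m * (q : ℂ) ^ (m + 1))) := by
  have hint := h.integrable_offDiagFn hs b b'
  have h2 : ∀ y : F, ∫ p : F × F, offDiagFn π ψ s b b' (y, p)
      ∂((haarF F).prod (haarF F)) = {y : F | 1 < ‖y‖}.indicator (fun y =>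
        chi π (-1) * normCpow s (y ^ 2) * ((∫ x in closedBall (0 : F) ‖π * y‖,
          (ψ (b * x) : ℂ) ∂haarF F) * ∫ z in closedBall (0 : F) ‖y‖, (ψ (b' * z) : ℂ) ∂haarF F)) y := by
    intro y
    have h3 (p : F × F) := h.offDiagFn_eq s b b' y p.1 p.2
    simp only [Prod.mk.eta] at h3
    simp only [h3]
    rw [integral_const_mul, integral_prod_mul
      (fun x => (closedBall (0 : F) ‖π * y‖).indicator (fun x => (ψ (b * x) : ℂ)) x)
      (fun z => (closedBall (0 : F) ‖y‖).indicator (fun z => (ψ (b' * z) : ℂ)) z),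
      integral_indicator measurableSet_closedBall, integral_indicator measurableSet_closedBall]
    by_cases hy : 1 < ‖y‖
    · rw [Set.indicator_of_mem (s := {x : F | 1 < ‖x‖}) hy,
        Set.indicator_of_mem (s := {x : F | 1 < ‖x‖}) hy]
    · rw [Set.indicator_of_notMem (s := {x : F | 1 < ‖x‖}) hy,
        Set.indicator_of_notMem (s := {x : F | 1 < ‖x‖}) hy, zero_mul]
  have hint2 := hint.integral_prod_left
  rw [integral_prod _ hint]
  simp only [h2] at hint2 ⊢
  rw [integral_indicator measurableSet_one_lt_norm]
  have hsum := h.hasSum_integral_sphere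
    ((integrable_indicator_iff measurableSet_one_lt_norm).1 hint2)
  refine hsum.unique ?_
  have hterm : ∀ m : ℕ, ∫ y in sphere 0 ((q : ℝ) ^ ((m : ℤ) + 1)),
      chi π (-1) * normCpow s (y ^ 2) * ((∫ x in closedBall (0 : F) ‖π * y‖,
          (ψ (b * x) : ℂ) ∂haarF F) * ∫ z in closedBall (0 : F) ‖y‖, (ψ (b' * z) : ℂ) ∂haarF F)
          ∂haarF F =
      if m < min (e + 1) e' then chi π (-1) * ((q : ℂ) ^ (-s)) ^ (2 * (m + 1)) *
        (((q : ℂ) ^ (m + 1) - (q : ℂ) ^ m) * ((q : ℂ) ^ m * (q : ℂ) ^ (m + 1))) else 0 := by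
    intro m
    have hle (k : ℕ) (j : ℤ) : (q : ℝ) ^ (-(k : ℤ)) * (q : ℝ) ^ j ≤ 1 ↔ j ≤ k := by
      rw [← zpow_add₀ h.pos.ne', ← zpow_zero (q : ℝ), h.zpow_le_iff]; omega
    have h1 : Set.EqOn (fun y => chi π (-1) * normCpow s (y ^ 2) *
          ((∫ x in closedBall (0 : F) ‖π * y‖, (ψ (b * x) : ℂ) ∂haarF F) *
            ∫ z in closedBall (0 : F) ‖y‖, (ψ (b' * z) : ℂ) ∂haarF F))
        (fun _ => chi π (-1) * ((q : ℂ) ^ (-s)) ^ (2 * (m + 1)) *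
          ((if (m : ℤ) ≤ e then (q : ℂ) ^ (m : ℤ) else 0) *
            (if (m : ℤ) + 1 ≤ e' then (q : ℂ) ^ ((m : ℤ) + 1) else 0)))
        (sphere 0 ((q : ℝ) ^ ((m : ℤ) + 1))) := by
      intro y hy
      have hy1 : ‖y‖ = (q : ℝ) ^ ((m : ℤ) + 1) := by simpa using hy
      have hy2 : ‖y ^ 2‖ = (q : ℝ) ^ (2 * (m + 1)) := by
        rw [_root_.norm_pow, hy1, mul_comm 2, pow_mul]
        congr 1
      have hπy : ‖π * y‖ = (q : ℝ) ^ (m : ℤ) := by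
        rw [norm_mul, h.norm, hy1, zpow_add_one₀ h.pos.ne', mul_comm, mul_assoc,
          mul_inv_cancel₀ h.pos.ne', mul_one]
      beta_reduce
      rw [h.normCpow_of_norm_eq s hy2, hπy, hy1, h.integral_closedBall_psi,
        h.integral_closedBall_psi, hb, hb']
      simp only [hle]
    rw [setIntegral_congr_fun isClosed_sphere.measurableSet h1, setIntegral_const, h.real_sphere,
      Complex.real_smul]
    by_cases hm : m < min (e + 1) e'
    · rw [if_pos hm, if_pos (by omega), if_pos (by omega), add_sub_cancel_right]
      push_cast
      have hz : (q : ℂ) ^ ((m : ℤ) + 1) = (q : ℂ) ^ (m + 1) := by exact_mod_cast rfl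
      rw [hz, zpow_natCast]
      ring
    · rw [if_neg hm]
      rcases Nat.lt_or_ge e m with h3 | h3
      · rw [if_neg (by omega)]; ring
      · rw [if_neg (c := (m : ℤ) + 1 ≤ e') (by omega)]; ring
  simp only [hterm]
  have h5 := hasSum_sum_of_ne_finset_zero (L := SummationFilter.unconditional ℕ)
    (s := Finset.range (min (e + 1) e')) (f := fun m =>
      if m < min (e + 1) e' then chi π (-1) * ((q : ℂ) ^ (-s)) ^ (2 * (m + 1)) *
        (((q : ℂ) ^ (m + 1) - (q : ℂ) ^ m) * ((q : ℂ) ^ m * (q : ℂ) ^ (m + 1))) else 0)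
    (fun m hm => if_neg (by simpa using hm))
  rwa [Finset.sum_congr rfl (fun m hm => if_pos (Finset.mem_range.1 hm))] at h5

end IsNormalizedWith

end Pieces

end RamifiedSiegel

namespace RamifiedSiegel

/-! ### Splitting the integrand by the dominant entry. -/

section Decomposition

variable {F : Type*} [NontriviallyNormedField F] [ProperSpace F] [MeasurableSpace F] [BorelSpace F]

/-- The weight attached to `f_t`, for `t ≤ 1`. -/
def sectionWeight (π : F) (s : ℂ) (t : ℕ) (r x v : F) : ℂ :=
  if t = 0 then ramifiedWeight π s r x v else integralWeight x v

theorem shellFn_of_mem {π : F} {ψ : AddChar F Circle} {s : ℂ} {r b b' x y z : F} {V : F → F → ℂ}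
    (hx : 1 < ‖x‖) (hy : ‖y‖ ≤ ‖r * x‖) :
    shellFn π ψ s r b b' V (x, y, z) =
      chi π x * normCpow s x * (ψ (b * x + b' * z) : ℂ) * V x (z - y ^ 2 / x) :=
  Set.indicator_of_mem (s := {p : F × F × F | 1 < ‖p.1‖ ∧ ‖p.2.1‖ ≤ ‖r * p.1‖}) ⟨hx, hy⟩ _

theorem shellFn_of_notMem {π : F} {ψ : AddChar F Circle} {s : ℂ} {r b b' x y z : F}
    {V : F → F → ℂ} (hxy : ¬(1 < ‖x‖ ∧ ‖y‖ ≤ ‖r * x‖)) :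
    shellFn π ψ s r b b' V (x, y, z) = 0 :=
  Set.indicator_of_notMem (s := {p : F × F × F | 1 < ‖p.1‖ ∧ ‖p.2.1‖ ≤ ‖r * p.1‖}) hxy _

theorem offDiagFn_of_mem {π : F} {ψ : AddChar F Circle} {s : ℂ} {b b' x y z : F}
    (hy : 1 < ‖y‖) (hx : ‖x‖ ≤ ‖π * y‖) (hz : ‖z‖ ≤ ‖y‖) :
    offDiagFn π ψ s b b' (y, x, z) =
      chi π (-1) * normCpow s (y ^ 2) * (ψ (b * x + b' * z) : ℂ) :=
  Set.indicator_of_mem (s := {p : F × F × F | 1 < ‖p.1‖ ∧ ‖p.2.1‖ ≤ ‖π * p.1‖ ∧ ‖p.2.2‖ ≤ ‖p.1‖})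
    ⟨hy, hx, hz⟩ _

theorem offDiagFn_of_notMem {π : F} {ψ : AddChar F Circle} {s : ℂ} {b b' x y z : F}
    (hm : ¬(1 < ‖y‖ ∧ ‖x‖ ≤ ‖π * y‖ ∧ ‖z‖ ≤ ‖y‖)) : offDiagFn π ψ s b b' (y, x, z) = 0 :=
  Set.indicator_of_notMem
    (s := {p : F × F × F | 1 < ‖p.1‖ ∧ ‖p.2.1‖ ≤ ‖π * p.1‖ ∧ ‖p.2.2‖ ≤ ‖p.1‖}) hm _

theorem sectionWeight_of_lt {π : F} {s : ℂ} {t : ℕ} {r x v : F} (hv : 1 < ‖v‖)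
    (hrv : ‖r * x‖ < ‖v‖) : sectionWeight π s t r x v = 0 := by
  rw [sectionWeight, ramifiedWeight_of_notMem (fun hm => hrv.not_ge hm.2), integralWeight,
    Set.indicator_of_notMem (by simpa using hv), ite_self]

/-- Inside a shell, |v| ≤ |rx| encodes |z| ≤ |rx|, because y²/x satisfies the same bound. Here the
truncated weight agrees with the value of the section. -/
theorem sectionWeight_of_le {π : F} {s : ℂ} {t : ℕ} (ht : t ≤ 1) {r x v : F}
    (hrv : ‖v‖ ≤ ‖r * x‖) : sectionWeight π s t r x v =
      if ‖v‖ ≤ 1 then if t = 1 then 1 else 0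
      else chi π v * normCpow s v * if t = 0 then 1 else 0 := by
  by_cases hv : ‖v‖ ≤ 1
  · rw [if_pos hv, sectionWeight, ramifiedWeight_of_notMem (fun hm => hv.not_gt hm.1),
      integralWeight, Set.indicator_of_mem (by simpa using hv)]
    interval_cases t <;> simp
  · rw [if_neg hv, sectionWeight, ramifiedWeight_of_mem (not_le.1 hv) hrv,
      integralWeight, Set.indicator_of_notMem (by simpa using hv)]
    interval_cases t <;> simp

variable [IsUltrametricDist F] {q : ℕ} {π : F} {ψ : AddChar F Circle}

namespace IsNormalized

variable (h : IsNormalized q π)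
include h

theorem norm_lt_iff {x y : F} (hy : y ≠ 0) : ‖x‖ < ‖y‖ ↔ ‖x‖ ≤ ‖π * y‖ := by
  have hy' := norm_pos_iff.2 hy
  rw [norm_mul]
  constructor
  · intro hxy
    have h1 : ‖x / y‖ < 1 := by rwa [norm_div, div_lt_one hy']
    have h2 := h.unif.2.2 _ h1
    rwa [norm_div, div_le_iff₀ hy'] at h2
  · intro hxy
    refine hxy.trans_lt ?_
    have h3 := h.unif.2.1
    nlinarith

variable (ψ) in
/-- The splitting of the integrand according to the entry of maximal norm. -/
theorem section_mul_psi_eq {s : ℂ} {t : ℕ} (ht : t ≤ 1) {f : Matrix.symplecticGroup (Fin 2) F → ℂ}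
    (hf : IsBasisSection (n := 2) (chi π) (s - (((2 : ℕ) : ℂ) + 1) / 2) t f) (b b' : F)
    {x y z : F} (hX : (!![x, y; y, z]).IsSymm) :
    f (w F 2 2 * unipotent !![x, y; y, z] hX) * (ψ (b * x + b' * z) : ℂ) =
      shellFn π ψ s 1 b b' (sectionWeight π s t 1) (x, y, z) +
      shellFn π ψ s π b' b (sectionWeight π s t π) (z, y, x) +
      (if t = 0 then 1 else 0) * offDiagFn π ψ s b b' (y, x, z) := by
  have hdiv {u y x : F} (hx : 0 < ‖x‖) (hy : ‖y‖ ≤ ‖u * x‖) (hu : ‖u‖ ≤ 1) :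
      ‖y ^ 2 / x‖ ≤ ‖u * x‖ := by
    rw [norm_div, _root_.norm_pow, div_le_iff₀ hx, pow_two]
    have : ‖y‖ ≤ ‖x‖ := hy.trans (by rw [norm_mul]; nlinarith)
    gcongr
  -- Here y²/x is too small to affect |z|, so |v| = |z| exceeds |x| and the weight is 0. Thus the
  -- shells need no explicit comparison of x with z.
  have hfirst (hxz : ‖x‖ < ‖z‖) :
      shellFn π ψ s 1 b b' (sectionWeight π s t 1) (x, y, z) = 0 := by
    by_cases hm : 1 < ‖x‖ ∧ ‖y‖ ≤ ‖1 * x‖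
    · have h1 := hdiv (one_pos.trans hm.1) hm.2 norm_one.le
      rw [one_mul] at h1
      have h2 : ‖z - y ^ 2 / x‖ = ‖z‖ := norm_sub_eq_left (h1.trans_lt hxz)
      rw [shellFn_of_mem hm.1 hm.2, sectionWeight_of_lt, mul_zero]
      · rw [h2]; exact hm.1.trans hxz
      · rwa [h2, one_mul]
    · exact shellFn_of_notMem hm
  -- The factor π in this shell makes the domination by z strict, so that ties are counted only in
  -- the shell of x.
  have hsecond (hzx : ‖z‖ ≤ ‖x‖) :
      shellFn π ψ s π b' b (sectionWeight π s t π) (z, y, x) = 0 := by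
    by_cases hm : 1 < ‖z‖ ∧ ‖y‖ ≤ ‖π * z‖
    · have hz0 : z ≠ 0 := norm_pos_iff.1 (one_pos.trans hm.1)
      have h1 := hdiv (one_pos.trans hm.1) hm.2 h.unif.2.1.le
      have h3 : ‖π * z‖ < ‖x‖ := ((h.norm_lt_iff hz0).2 le_rfl).trans_le hzx
      have h2 : ‖x - y ^ 2 / z‖ = ‖x‖ := norm_sub_eq_left (h1.trans_lt h3)
      rw [shellFn_of_mem hm.1 hm.2, sectionWeight_of_lt, mul_zero]
      · rw [h2]; exact hm.1.trans_le hzx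
      · rwa [h2]
    · exact shellFn_of_notMem hm
  have hval (c d v : F) : (if ‖v‖ ≤ 1 then chi π c * normCpow s c * (if t = 1 then 1 else 0 : ℂ)
      else chi π c * chi π v * (normCpow s c * normCpow s v) * if t = 0 then 1 else 0) =
      chi π c * normCpow s c * (if ‖v‖ ≤ 1 then if t = 1 then 1 else 0
      else chi π v * normCpow s v * if t = 0 then 1 else 0) := by
    split_ifs <;> ring
  by_cases h1 : 1 < ‖x‖ ∧ ‖y‖ ≤ ‖x‖ ∧ ‖z‖ ≤ ‖x‖
  · obtain ⟨hx, hy, hz⟩ := h1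
    have h1 : ‖y‖ ≤ ‖1 * x‖ := by rwa [one_mul]
    have h2 : ‖z - y ^ 2 / x‖ ≤ ‖1 * x‖ := by
      rw [one_mul]
      refine norm_sub_le_of_le hz ?_
      simpa using hdiv (one_pos.trans hx) h1 norm_one.le
    rw [hsecond hz, offDiagFn_of_notMem, shellFn_of_mem hx h1, sectionWeight_of_le ht h2,
      h.section_of_upper_left_max hf hx hy, hval _ x]
    · ring
    · rintro ⟨hy1, hxy, -⟩
      exact ((h.norm_lt_iff (norm_pos_iff.1 (one_pos.trans hy1))).2 hxy).not_ge hy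
  by_cases h2 : 1 < ‖z‖ ∧ ‖x‖ < ‖z‖ ∧ ‖y‖ < ‖z‖
  · obtain ⟨hz, hx, hy⟩ := h2
    have hz0 : z ≠ 0 := norm_pos_iff.1 (one_pos.trans hz)
    have h2 := (h.norm_lt_iff hz0).1 hy
    have h3 : ‖x - y ^ 2 / z‖ ≤ ‖π * z‖ :=
      norm_sub_le_of_le ((h.norm_lt_iff hz0).1 hx) (hdiv (one_pos.trans hz) h2 h.unif.2.1.le)
    rw [hfirst hx, offDiagFn_of_notMem, shellFn_of_mem hz h2, sectionWeight_of_le ht h3,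
      h.section_of_lower_right_max hf hz hy.le, hval _ x, add_comm (b * x)]
    · ring
    · exact fun hm => hy.not_ge hm.2.2
  have hfirst' : shellFn π ψ s 1 b b' (sectionWeight π s t 1) (x, y, z) = 0 := by
    by_cases hxz : ‖x‖ < ‖z‖
    · exact hfirst hxz
    · refine shellFn_of_notMem fun hm => h1 ⟨hm.1, ?_, not_lt.1 hxz⟩
      simpa using hm.2
  have hsecond' : shellFn π ψ s π b' b (sectionWeight π s t π) (z, y, x) = 0 := by
    by_cases hzx : ‖z‖ ≤ ‖x‖
    · exact hsecond hzx
    · refine shellFn_of_notMem fun hm => h2 ⟨hm.1, not_le.1 hzx, ?_⟩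
      exact (h.norm_lt_iff (norm_pos_iff.1 (one_pos.trans hm.1))).2 hm.2
  rw [hfirst', hsecond', zero_add, zero_add]
  by_cases h3 : 1 < ‖y‖ ∧ ‖x‖ < ‖y‖ ∧ ‖z‖ ≤ ‖y‖
  · obtain ⟨hy, hx, hz⟩ := h3
    have hy0 : y ≠ 0 := norm_pos_iff.1 (one_pos.trans hy)
    rw [h.section_of_off_diagonal_max hf hy hx hz,
      offDiagFn_of_mem hy ((h.norm_lt_iff hy0).1 hx) hz]
    ring
  -- Outside the three regions X is integral: an entry of norm above 1 would force some entry of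
  -- maximal norm to fall under one of the cases.
  · have hx : ‖x‖ ≤ 1 := by
      by_contra! hx
      rcases le_or_gt ‖z‖ ‖x‖ with hzx | hzx
      · have hy : ‖x‖ < ‖y‖ := by
          by_contra! hy
          exact h1 ⟨hx, hy, hzx⟩
        exact h3 ⟨hx.trans hy, hy, hzx.trans hy.le⟩
      · have hy : ‖z‖ ≤ ‖y‖ := by
          by_contra! hy
          exact h2 ⟨hx.trans hzx, hzx, hy⟩
        exact h3 ⟨(hx.trans hzx).trans_le hy, hzx.trans_le hy, hy⟩
    have hz : ‖z‖ ≤ 1 := by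
      by_contra! hz
      have hy : ‖z‖ ≤ ‖y‖ := by
        by_contra! hy
        exact h2 ⟨hz, hx.trans_lt hz, hy⟩
      exact h3 ⟨hz.trans_le hy, (hx.trans_lt hz).trans_le hy, hy⟩
    have hy : ‖y‖ ≤ 1 := by
      by_contra! hy
      exact h3 ⟨hy, hx.trans_lt hy, hz.trans hy.le⟩
    rw [h.section_of_integral hf hX, if_neg (by omega), zero_mul, offDiagFn_of_notMem, mul_zero]
    · exact fun hm => hy.not_gt hm.1
    · intro i j
      fin_cases i <;> fin_cases j <;> simpa

end IsNormalized

namespace IsNormalizedWith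

variable (h : IsNormalizedWith q π ψ)
include h

theorem measurable_sectionWeight (s : ℂ) (t : ℕ) (r : F) :
    Measurable (Function.uncurry (sectionWeight π s t r)) := by
  by_cases ht : t = 0
  · have : sectionWeight π s t r = ramifiedWeight π s r := by
      ext x v; rw [sectionWeight, if_pos ht]
    rw [this]
    exact h.measurable_ramifiedWeight s r
  · have : sectionWeight π s t r = integralWeight := by
      ext x v; rw [sectionWeight, if_neg ht]
    rw [this]
    exact measurable_integralWeight

theorem exists_lintegral_sectionWeight_le {s : ℂ} (hs : 1 < s.re) (t : ℕ) (r : F) :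
    ∃ K : ENNReal, K ≠ ⊤ ∧ ∀ x, 1 < ‖x‖ → ∫⁻ v, ‖sectionWeight π s t r x v‖ₑ ∂haarF F ≤ K := by
  by_cases ht : t = 0
  · refine ⟨_, (h.lintegral_norm_rpow_lt_top hs).ne, fun x _ => ?_⟩
    simp only [sectionWeight, if_pos ht]
    exact h.lintegral_ramifiedWeight s r x
  · refine ⟨1, ENNReal.one_ne_top, fun x _ => ?_⟩
    simp only [sectionWeight, if_neg ht]
    exact lintegral_integralWeight x

/-- The value of `∫ ψ(b' v) V(x, v) dv` for the weight `V` of `f_t`, where `‖x‖ = q ^ m`. -/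
def _root_.RamifiedSiegel.weightInt (q : ℕ) (π : F) (ψ : AddChar F Circle) (z : ℂ) (t : ℕ) (b' : F)
    (e' ρ m : ℕ) : ℂ :=
  if t = 0 then
    if e' + 1 + ρ ≤ m then z ^ (e' + 1) * ((q : ℂ) ^ e' * chi π b' * gaussInt π ψ) else 0
  else 1

/-- The Siegel series of `diag(b₁, b₂)`, as a polynomial in `z = q ^ (-s)`. -/
def _root_.RamifiedSiegel.siegelSum (q : ℕ) (π : F) (ψ : AddChar F Circle) (t : ℕ) (b₁ b₂ : F)
    (e₁ e₂ : ℕ) (z : ℂ) : ℂ :=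
  ∑ m ∈ Finset.range (e₁ + 1), z ^ (m + 1) * (q : ℂ) ^ (m + 1) *
    weightInt q π ψ z t (-b₂) e₂ 0 (m + 1) * mixedInt q π ψ (-b₂) (-b₁) ((m : ℤ) + 1) +
  ∑ m ∈ Finset.range (e₂ + 1), z ^ (m + 1) * ((q : ℂ)⁻¹ * (q : ℂ) ^ (m + 1)) *
    weightInt q π ψ z t (-b₁) e₁ 1 (m + 1) *
      mixedInt q π ψ (-b₁ * π ^ 2) (-b₂) ((m : ℤ) + 1) +
  (if t = 0 then 1 else 0) *
    ∑ m ∈ Finset.range (min (e₁ + 1) e₂), chi π (-1) * z ^ (2 * (m + 1)) *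
      (((q : ℂ) ^ (m + 1) - (q : ℂ) ^ m) * ((q : ℂ) ^ m * (q : ℂ) ^ (m + 1)))

theorem integral_sectionWeight {s : ℂ} (hs : 1 < s.re) (t : ℕ) {b' : F} {e' ρ : ℕ}
    (hb' : ‖b'‖ = (q : ℝ) ^ (-(e' : ℤ))) {r : F} (hr : ‖r‖ = (q : ℝ) ^ (-(ρ : ℤ))) {m : ℕ} {x : F}
    (hx : ‖x‖ = (q : ℝ) ^ m) :
    ∫ v, (ψ (b' * v) : ℂ) * sectionWeight π s t r x v ∂haarF F =
      weightInt q π ψ ((q : ℂ) ^ (-s)) t b' e' ρ m := by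
  by_cases ht : t = 0
  · simp only [sectionWeight, weightInt, if_pos ht]
    exact h.integral_ramifiedWeight hs hb' hr hx
  · simp only [sectionWeight, weightInt, if_neg ht]
    refine h.integral_integralWeight ?_ x
    rw [hb', zpow_neg]
    exact inv_le_one_of_one_le₀ (one_le_zpow₀ h.one_lt_real.le (by positivity))

theorem integrable_siegelIntegrand_and_integral_eq {s : ℂ} (hs : 2 < s.re) {t : ℕ} (ht : t ≤ 1)
    {b₁ b₂ : F} {e₁ e₂ : ℕ}
    (hb₁ : ‖b₁‖ = (q : ℝ) ^ (-(e₁ : ℤ))) (hb₂ : ‖b₂‖ = (q : ℝ) ^ (-(e₂ : ℤ))) :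
    Integrable (siegelIntegrand (chi π) ψ t (Matrix.diagonal ![b₁, b₂]) s) (haarSym F 2) ∧
    ∫ x, siegelIntegrand (chi π) ψ t (Matrix.diagonal ![b₁, b₂]) s x ∂haarSym F 2 =
      siegelSum q π ψ t b₁ b₂ e₁ e₂ ((q : ℂ) ^ (-s)) := by
  let i₀ : UpperIdx 2 := ⟨(0, 0), le_rfl⟩
  let i₁ : UpperIdx 2 := ⟨(0, 1), by decide⟩
  let i₂ : UpperIdx 2 := ⟨(1, 1), le_rfl⟩
  have h01 : i₀ ≠ i₁ := by decide
  have h02 : i₀ ≠ i₂ := by decide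
  have h12 : i₁ ≠ i₂ := by decide
  have hall : ∀ l, l = i₀ ∨ l = i₁ ∨ l = i₂ := by decide
  have hf := h.isBasisSection_basisSection (s - (((2 : ℕ) : ℂ) + 1) / 2) ht
  have hpt (x : UpperIdx 2 → F) :
      siegelIntegrand (chi π) ψ t (Matrix.diagonal ![b₁, b₂]) s x =
        shellFn π ψ s 1 (-b₁) (-b₂) (sectionWeight π s t 1) (x i₀, x i₁, x i₂) +
        shellFn π ψ s π (-b₂) (-b₁) (sectionWeight π s t π) (x i₂, x i₁, x i₀) +
        (if t = 0 then 1 else 0) * offDiagFn π ψ s (-b₁) (-b₂) (x i₁, x i₀, x i₂) := by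
    have hX : symMatrix x = !![x i₀, x i₁; x i₁, x i₂] := by
      ext i j; fin_cases i <;> fin_cases j <;> rfl
    have htr : -(Matrix.diagonal ![b₁, b₂] * symMatrix x).trace = -b₁ * x i₀ + -b₂ * x i₂ := by
      rw [hX, Matrix.trace_fin_two]
      simp [Matrix.diagonal_mul]
      ring
    rw [siegelIntegrand, htr, unipotent_congr (symMatrix_isSymm x) hX]
    exact h.section_mul_psi_eq ψ ht hf (-b₁) (-b₂) _
  have hc1 := measurePreserving_coordEquiv (F := F) i₀ i₁ i₂ h01 h02 h12 hall
  have hc2 := measurePreserving_coordEquiv (F := F) i₂ i₁ i₀ h12.symm h02.symm h01.symm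
    (fun l => by rcases hall l with h | h | h <;> simp [h])
  have hc3 := measurePreserving_coordEquiv (F := F) i₁ i₀ i₂ h01.symm h12 h02
    (fun l => by rcases hall l with h | h | h <;> simp [h])
  -- Each piece uses its own order of the variables, with the dominant entry first; permuting
  -- coordinates preserves the measure.
  have key (i j k : UpperIdx 2) (hij hik hjk hall)
      (hc : MeasurePreserving (coordEquiv F i j k hij hik hjk hall)
        ((haarF F).prod ((haarF F).prod (haarF F))) (haarSym F 2)) (g : F × F × F → ℂ)
      (hg : Integrable g ((haarF F).prod ((haarF F).prod (haarF F)))) :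
      Integrable (fun x : UpperIdx 2 → F => g (x i, x j, x k)) (haarSym F 2) ∧
      ∫ x : UpperIdx 2 → F, g (x i, x j, x k) ∂haarSym F 2 =
        ∫ p, g p ∂((haarF F).prod ((haarF F).prod (haarF F))) := by
    have hs := hc.symm
    exact ⟨(hs.integrable_comp_emb (MeasurableEquiv.measurableEmbedding _)).2 hg,
      hs.integral_comp (MeasurableEquiv.measurableEmbedding _) g⟩
  have hs1 : 1 < s.re := by linarith
  obtain ⟨K1, hK1, hV1⟩ := h.exists_lintegral_sectionWeight_le hs1 t 1
  obtain ⟨K2, hK2, hV2⟩ := h.exists_lintegral_sectionWeight_le hs1 t π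
  have hn (b : F) {e : ℕ} (hb : ‖b‖ = (q : ℝ) ^ (-(e : ℤ))) :
      ‖-b‖ = (q : ℝ) ^ (-(e : ℤ)) := by rwa [norm_neg]
  have hr1 : ‖(1 : F)‖ = (q : ℝ) ^ (-((0 : ℕ) : ℤ)) := by simp
  have hr2 : ‖π‖ = (q : ℝ) ^ (-((1 : ℕ) : ℤ)) := by simp [h.norm]
  have hb2' : ‖-b₂ * 1 ^ 2‖ = (q : ℝ) ^ (-(e₂ : ℤ)) := by rw [one_pow, mul_one, hn _ hb₂]
  have hb1' : ‖-b₁ * π ^ 2‖ = (q : ℝ) ^ (-((e₁ + 2 : ℕ) : ℤ)) := by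
    rw [norm_mul, hn _ hb₁, h.norm_pow, ← zpow_add₀ h.pos.ne']
    congr 1
    push_cast
    ring
  have hi1 := key i₀ i₁ i₂ _ _ _ _ hc1 _ (h.integrable_shellFn hs one_ne_zero (-b₁) (-b₂)
    (h.measurable_sectionWeight s t 1) hK1 hV1)
  have hi2 := key i₂ i₁ i₀ _ _ _ _ hc2 _ (h.integrable_shellFn hs h.ne_zero (-b₂) (-b₁)
    (h.measurable_sectionWeight s t π) hK2 hV2)
  have hi3 := key i₁ i₀ i₂ _ _ _ _ hc3 _ (h.integrable_offDiagFn hs (-b₁) (-b₂))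
  rw [h.integral_shellFn hs one_ne_zero (hn _ hb₁) hb2' (h.measurable_sectionWeight s t 1) hK1 hV1
    (fun m _ x hx => h.integral_sectionWeight hs1 t (hn _ hb₂) hr1 hx)] at hi1
  rw [h.integral_shellFn hs h.ne_zero (hn _ hb₂) hb1' (h.measurable_sectionWeight s t π) hK2 hV2
    (fun m _ x hx => h.integral_sectionWeight hs1 t (hn _ hb₁) hr2 hx)] at hi2
  rw [h.integral_offDiagFn hs (hn _ hb₁) (hn _ hb₂)] at hi3
  have hfun : siegelIntegrand (chi π) ψ t (Matrix.diagonal ![b₁, b₂]) s = _ := funext hpt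
  have hi3' := hi3.1.const_mul (if t = 0 then 1 else 0 : ℂ)
  rw [hfun]
  refine ⟨(hi1.1.add hi2.1).add hi3', ?_⟩
  refine (integral_add (hi1.1.add hi2.1) hi3').trans ?_
  refine (congrArg₂ (· + ·) (integral_add hi1.1 hi2.1) rfl).trans ?_
  rw [hi1.2, hi2.2, integral_const_mul, hi3.2, siegelSum]
  simp only [norm_one, one_pow, mul_one, Complex.ofReal_one, one_mul, h.norm, Complex.ofReal_inv,
    Complex.ofReal_natCast]

end IsNormalizedWith

end Decomposition

end RamifiedSiegel

namespace RamifiedSiegel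

/-! ### Evaluation of the shell sums. -/

section Evaluation

theorem sum_range_add_two_mul (f : ℕ → ℂ) (a K : ℕ) :
    ∑ m ∈ Finset.range (a + 2 * K), f m =
      ∑ m ∈ Finset.range a, f m + ∑ k ∈ Finset.range K, (f (a + 2 * k) + f (a + 2 * k + 1)) := by
  induction K with
  | zero => simp
  | succ K ih =>
    rw [Finset.sum_range_succ _ K, ← add_assoc, ← ih, show a + 2 * (K + 1) = a + 2 * K + 1 + 1 by ring,
      Finset.sum_range_succ, Finset.sum_range_succ]
    ring

variable {F : Type*} [NontriviallyNormedField F] [ProperSpace F] [MeasurableSpace F] [BorelSpace F]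

/-- The part of `siegelSum` coming from the matrices whose second diagonal entry dominates. -/
def secondShellSum (q : ℕ) (π : F) (ψ : AddChar F Circle) (t : ℕ) (b₁ b₂ : F)
    (e₁ e₂ : ℕ) (z : ℂ) : ℂ :=
  ∑ m ∈ Finset.range (e₂ + 1), z ^ (m + 1) * ((q : ℂ)⁻¹ * (q : ℂ) ^ (m + 1)) *
    weightInt q π ψ z t (-b₁) e₁ 1 (m + 1) *
      mixedInt q π ψ (-b₁ * π ^ 2) (-b₂) ((m : ℤ) + 1)

/-- The part of `siegelSum` coming from the matrices whose first diagonal entry dominates. -/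
def firstShellSum (q : ℕ) (π : F) (ψ : AddChar F Circle) (t : ℕ) (b₁ b₂ : F)
    (e₁ e₂ : ℕ) (z : ℂ) : ℂ :=
  ∑ m ∈ Finset.range (e₁ + 1), z ^ (m + 1) * (q : ℂ) ^ (m + 1) *
    weightInt q π ψ z t (-b₂) e₂ 0 (m + 1) * mixedInt q π ψ (-b₂) (-b₁) ((m : ℤ) + 1)

/-- The value of `weightInt` in the range where it does not vanish. -/
def weightConst (q : ℕ) (π : F) (ψ : AddChar F Circle) (z : ℂ) (t : ℕ) (b : F) (e : ℕ) : ℂ :=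
  if t = 0 then z ^ (e + 1) * ((q : ℂ) ^ e * chi π b * gaussInt π ψ) else 1

theorem weightInt_of_le {q : ℕ} {π : F} {ψ : AddChar F Circle} {z : ℂ} {t : ℕ} {b : F}
    {e ρ m : ℕ} (hm : e + 1 + ρ ≤ m) :
    weightInt q π ψ z t b e ρ m = weightConst q π ψ z t b e := by
  rw [weightInt, weightConst, if_pos hm]

theorem weightInt_zero_of_lt {q : ℕ} {π : F} {ψ : AddChar F Circle} {z : ℂ} {b : F}
    {e ρ m : ℕ} (hm : m < e + 1 + ρ) : weightInt q π ψ z 0 b e ρ m = 0 := by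
  rw [weightInt, if_pos rfl, if_neg hm.not_ge]

variable [IsUltrametricDist F] {q : ℕ} {π : F} {ψ : AddChar F Circle}

namespace IsNormalizedWith

variable (h : IsNormalizedWith q π ψ)
include h

theorem cast_ne_zero : (q : ℂ) ≠ 0 := by
  exact_mod_cast h.pos.ne'

variable {b₁ b₂ : F} {e₁ e₂ : ℕ} (hb₁ : ‖b₁‖ = (q : ℝ) ^ (-(e₁ : ℤ)))
  (hb₂ : ‖b₂‖ = (q : ℝ) ^ (-(e₂ : ℤ)))
include hb₁ hb₂

/-- All radii satisfy m + 1 ≤ e₂, so the quadratic integral is 1 and the Gauss integral selects m =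
e₁. For t = 0 the weight already vanishes, as it needs m + 1 ≥ e₂ + 1. -/
theorem firstShellSum_of_lt (he : e₁ < e₂) (t : ℕ) (z : ℂ) :
    firstShellSum q π ψ t b₁ b₂ e₁ e₂ z =
      if t = 0 then 0 else z ^ (e₁ + 1) * (q : ℂ) ^ (2 * e₁ + 1) * chi π (-b₁) * gaussInt π ψ := by
  have hb₁' : ‖-b₁‖ = (q : ℝ) ^ (-(e₁ : ℤ)) := by rwa [norm_neg]
  have hb₂' : ‖-b₂‖ = (q : ℝ) ^ (-(e₂ : ℤ)) := by rwa [norm_neg]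
  rw [firstShellSum]
  by_cases ht : t = 0
  · rw [if_pos ht, ht]
    refine Finset.sum_eq_zero fun m hm => ?_
    rw [Finset.mem_range] at hm
    rw [weightInt_zero_of_lt (by omega), mul_zero, zero_mul]
  · rw [if_neg ht, Finset.sum_range_succ, Finset.sum_eq_zero, zero_add, weightInt, if_neg ht,
      h.mixedInt_of_le hb₁' hb₂' (by omega), if_pos rfl, zpow_natCast]
    · ring
    · intro m hm
      rw [Finset.mem_range] at hm
      rw [h.mixedInt_of_le hb₁' hb₂' (by omega), if_neg (by omega), mul_zero]

/-- The last radius q^(e₁+1) now falls in the odd case and meets the boundary value -q^e of the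
ψ-integral; this is where the minus sign comes from. -/
theorem firstShellSum_of_eq (he : e₁ = e₂) (t : ℕ) (z : ℂ) :
    firstShellSum q π ψ t b₁ b₂ e₁ e₂ z =
      -(z ^ (e₁ + 1) * (q : ℂ) ^ (2 * e₁) * chi π (-b₂) * gaussInt π ψ *
        weightConst q π ψ z t (-b₂) e₁) := by
  have hb₁' : ‖-b₁‖ = (q : ℝ) ^ (-(e₁ : ℤ)) := by rwa [norm_neg]
  have hb₂' : ‖-b₂‖ = (q : ℝ) ^ (-(e₂ : ℤ)) := by rwa [norm_neg]
  subst he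
  rw [firstShellSum, Finset.sum_range_succ, Finset.sum_eq_zero, zero_add,
    weightInt_of_le (by omega), h.mixedInt_odd hb₁' hb₂' 0 (by simp), if_neg (by omega), if_pos rfl,
    zpow_natCast, zero_add, pow_one]
  · have := h.cast_ne_zero
    field_simp
    ring
  · intro m hm
    rw [Finset.mem_range] at hm
    rw [h.mixedInt_of_le hb₁' hb₂' (by omega), if_neg (by omega), mul_zero]

theorem norm_neg_mul_sq : ‖-b₁ * π ^ 2‖ = (q : ℝ) ^ (-((e₁ + 2 : ℕ) : ℤ)) := by
  rw [norm_mul, norm_neg, hb₁, h.norm_pow, ← zpow_add₀ h.pos.ne']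
  congr 1
  push_cast
  ring

theorem mixedInt_low {m : ℕ} (hm : m ≤ e₁) (hm' : m ≠ e₂) :
    mixedInt q π ψ (-b₁ * π ^ 2) (-b₂) ((m : ℤ) + 1) = 0 := by
  have hb₂' : ‖-b₂‖ = (q : ℝ) ^ (-(e₂ : ℤ)) := by rwa [norm_neg]
  rw [h.mixedInt_of_le hb₂' (h.norm_neg_mul_sq hb₁ hb₂) (by omega), if_neg (by omega)]

theorem mixedInt_high_even (k : ℕ) :
    mixedInt q π ψ (-b₁ * π ^ 2) (-b₂) (((e₁ + 1 + 2 * k : ℕ) : ℤ) + 1) =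
      (q : ℂ)⁻¹ ^ k *
        if e₁ + 1 + 2 * k = e₂ then (q : ℂ) ^ e₂ * chi π (-b₂) * gaussInt π ψ else 0 := by
  have hb₂' : ‖-b₂‖ = (q : ℝ) ^ (-(e₂ : ℤ)) := by rwa [norm_neg]
  rw [h.mixedInt_even hb₂' (h.norm_neg_mul_sq hb₁ hb₂) k (by push_cast; ring), zpow_natCast]
  congr 1
  exact if_congr (by omega) rfl rfl

theorem mixedInt_high_odd (k : ℕ) :
    mixedInt q π ψ (-b₁ * π ^ 2) (-b₂) (((e₁ + 1 + 2 * k + 1 : ℕ) : ℤ) + 1) =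
      (q : ℂ)⁻¹ ^ (k + 1) * chi π (-b₁) * gaussInt π ψ *
        if e₁ + 2 * k + 3 ≤ e₂ then (q : ℂ) ^ (e₁ + 2 * k + 3) - (q : ℂ) ^ (e₁ + 2 * k + 2) else
          if e₁ + 2 * k + 2 = e₂ then -(q : ℂ) ^ e₂ else 0 := by
  have hb₂' : ‖-b₂‖ = (q : ℝ) ^ (-(e₂ : ℤ)) := by rwa [norm_neg]
  rw [h.mixedInt_odd hb₂' (h.norm_neg_mul_sq hb₁ hb₂) k (by push_cast; ring), zpow_natCast,
    chi_mul_sq _ h.ne_zero]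
  have h1 : ((e₁ + 1 + 2 * k + 1 : ℕ) : ℤ) + 1 = ((e₁ + 2 * k + 3 : ℕ) : ℤ) := by push_cast; ring
  have h2 : ((e₁ + 2 * k + 3 : ℕ) : ℤ) - 1 = ((e₁ + 2 * k + 2 : ℕ) : ℤ) := by push_cast; ring
  rw [h1, h2, zpow_natCast, zpow_natCast]
  congr 1
  exact if_congr (by omega) rfl (if_congr (by omega) rfl rfl)

theorem secondShellSum_of_eq (he : e₁ = e₂) (t : ℕ) (z : ℂ) :
    secondShellSum q π ψ t b₁ b₂ e₁ e₂ z =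
      if t = 0 then 0 else z ^ (e₁ + 1) * (q : ℂ) ^ (2 * e₁) * chi π (-b₂) * gaussInt π ψ := by
  have hb₂' : ‖-b₂‖ = (q : ℝ) ^ (-(e₂ : ℤ)) := by rwa [norm_neg]
  rw [secondShellSum]
  by_cases ht : t = 0
  · rw [if_pos ht, ht]
    refine Finset.sum_eq_zero fun m hm => ?_
    rw [Finset.mem_range] at hm
    rw [weightInt_zero_of_lt (by omega), mul_zero, zero_mul]
  · rw [if_neg ht, Finset.sum_range_succ, Finset.sum_eq_zero, zero_add, weightInt, if_neg ht,
      h.mixedInt_of_le hb₂' (h.norm_neg_mul_sq hb₁ hb₂) (by omega), if_pos rfl, zpow_natCast, ← he]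
    · have := h.cast_ne_zero
      field_simp
      ring
    · intro m hm
      rw [Finset.mem_range] at hm
      rw [h.mixedInt_low hb₁ hb₂ (by omega) (by omega), mul_zero]

/-- The terms with m ≤ e₁ vanish and the rest are paired by parity: the Gauss terms vanish since
their radius is not critical, and each odd term contributes a difference of powers of q, hence the
factor q - 1. -/
theorem secondShellSum_bulk {K : ℕ} (hK : e₁ + 1 + 2 * K ≤ e₂) (t : ℕ) (z : ℂ) :
    ∑ m ∈ Finset.range (e₁ + 1 + 2 * K), z ^ (m + 1) * ((q : ℂ)⁻¹ * (q : ℂ) ^ (m + 1)) *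
      weightInt q π ψ z t (-b₁) e₁ 1 (m + 1) *
        mixedInt q π ψ (-b₁ * π ^ 2) (-b₂) ((m : ℤ) + 1) =
    weightConst q π ψ z t (-b₁) e₁ * (chi π (-b₁) * gaussInt π ψ *
      ∑ k ∈ Finset.range K, z ^ (e₁ + 2 * k + 3) * (((q : ℂ) - 1) * (q : ℂ) ^ (2 * e₁ + 3 * k + 3))) := by
  rw [sum_range_add_two_mul, Finset.sum_eq_zero, zero_add, Finset.mul_sum, Finset.mul_sum]
  · refine Finset.sum_congr rfl fun k hk => ?_
    rw [Finset.mem_range] at hk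
    rw [h.mixedInt_high_even hb₁ hb₂, if_neg (by omega), mul_zero, mul_zero, zero_add,
      h.mixedInt_high_odd hb₁ hb₂, if_pos (by omega), weightInt_of_le (by omega)]
    have := h.cast_ne_zero
    simp only [inv_pow]
    field_simp
    ring
  · intro m hm
    rw [Finset.mem_range] at hm
    rw [h.mixedInt_low hb₁ hb₂ (by omega) (by omega), mul_zero]

/-- The last radius q^(e₂+1) is of odd type and gives the boundary term with a minus sign. -/
theorem secondShellSum_even {K : ℕ} (hK : e₂ = e₁ + 2 * (K + 1)) (t : ℕ) (z : ℂ) :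
    secondShellSum q π ψ t b₁ b₂ e₁ e₂ z =
      weightConst q π ψ z t (-b₁) e₁ * (chi π (-b₁) * gaussInt π ψ *
        (∑ k ∈ Finset.range K, z ^ (e₁ + 2 * k + 3) *
          (((q : ℂ) - 1) * (q : ℂ) ^ (2 * e₁ + 3 * k + 3)) -
          z ^ (e₁ + 2 * K + 3) * (q : ℂ) ^ (2 * e₁ + 3 * K + 3))) := by
  rw [secondShellSum, show e₂ + 1 = e₁ + 1 + 2 * K + 1 + 1 by omega, Finset.sum_range_succ,
    Finset.sum_range_succ, h.secondShellSum_bulk hb₁ hb₂ (by omega), h.mixedInt_high_even hb₁ hb₂,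
    if_neg (by omega), h.mixedInt_high_odd hb₁ hb₂, if_neg (by omega), if_pos (by omega),
    weightInt_of_le (m := e₁ + 1 + 2 * K + 1 + 1) (by omega), hK]
  have := h.cast_ne_zero
  simp only [inv_pow]
  field_simp
  ring_nf

/-- The last radius q^(e₂+1) is of even type and is critical for the Gauss integral, which brings in
χ(-b₂). -/
theorem secondShellSum_odd {K : ℕ} (hK : e₂ = e₁ + 2 * K + 1) (t : ℕ) (z : ℂ) :
    secondShellSum q π ψ t b₁ b₂ e₁ e₂ z =
      weightConst q π ψ z t (-b₁) e₁ * (chi π (-b₁) * gaussInt π ψ *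
        ∑ k ∈ Finset.range K, z ^ (e₁ + 2 * k + 3) *
          (((q : ℂ) - 1) * (q : ℂ) ^ (2 * e₁ + 3 * k + 3)) +
        chi π (-b₂) * gaussInt π ψ * (z ^ (e₁ + 2 * K + 2) * (q : ℂ) ^ (2 * e₁ + 3 * K + 2))) := by
  rw [secondShellSum, show e₂ + 1 = e₁ + 1 + 2 * K + 1 by omega, Finset.sum_range_succ,
    h.secondShellSum_bulk hb₁ hb₂ (by omega), h.mixedInt_high_even hb₁ hb₂,
    if_pos (by omega), weightInt_of_le (by omega), hK]
  have := h.cast_ne_zero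
  simp only [inv_pow]
  field_simp
  ring_nf

end IsNormalizedWith

end Evaluation

end RamifiedSiegel

namespace RamifiedSiegel

/-! ### Closed forms as polynomials in z = q^(-s). -/

section ClosedForms

variable {F : Type*} [NontriviallyNormedField F] [ProperSpace F] [MeasurableSpace F] [BorelSpace F]

theorem offDiag_sum_eq (c Q z : ℂ) (N : ℕ) :
    ∑ m ∈ Finset.range N, c * z ^ (2 * (m + 1)) * ((Q ^ (m + 1) - Q ^ m) * (Q ^ m * Q ^ (m + 1))) =
      c * ((Q - 1) * ∑ m ∈ Finset.range N, z ^ (2 * m + 2) * Q ^ (3 * m + 1)) := by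
  rw [Finset.mul_sum, Finset.mul_sum]
  exact Finset.sum_congr rfl fun m _ => by ring

theorem shell_sum_eq (Q z : ℂ) (e K : ℕ) :
    ∑ k ∈ Finset.range K, z ^ (e + 2 * k + 3) * ((Q - 1) * Q ^ (2 * e + 3 * k + 3)) =
      z ^ (e + 3) * (Q - 1) * Q ^ (2 * e + 3) * ∑ k ∈ Finset.range K, (Q ^ 3 * z ^ 2) ^ k := by
  rw [Finset.mul_sum]
  exact Finset.sum_congr rfl fun m _ => by ring

/-- For t = 0 the weight shifts the progression of the second shell so that it continues the
off-diagonal one, which stops after e + 1 terms. -/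
theorem shell_sum_shift (Q z : ℂ) (e K : ℕ) :
    z ^ (e + 1) * Q ^ (e + 1) *
      ∑ k ∈ Finset.range K, z ^ (e + 2 * k + 3) * ((Q - 1) * Q ^ (2 * e + 3 * k + 3)) =
    (Q - 1) * ∑ k ∈ Finset.range K, z ^ (2 * (e + 1 + k) + 2) * Q ^ (3 * (e + 1 + k) + 1) := by
  rw [Finset.mul_sum, Finset.mul_sum]
  exact Finset.sum_congr rfl fun m _ => by ring

theorem differentiable_siegelSum (q : ℕ) (π : F) (ψ : AddChar F Circle) (t : ℕ) (b₁ b₂ : F)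
    (e₁ e₂ : ℕ) : Differentiable ℂ (siegelSum q π ψ t b₁ b₂ e₁ e₂) := by
  have hw (b : F) (e ρ m : ℕ) : Differentiable ℂ fun z => weightInt q π ψ z t b e ρ m := by
    unfold weightInt
    split_ifs <;> fun_prop
  unfold siegelSum
  fun_prop

variable [IsUltrametricDist F] {q : ℕ} {π : F} {ψ : AddChar F Circle}

namespace IsNormalizedWith

variable (h : IsNormalizedWith q π ψ)
include h

variable {b₁ b₂ : F} {e₁ e₂ : ℕ} (hb₁ : ‖b₁‖ = (q : ℝ) ^ (-(e₁ : ℤ)))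
  (hb₂ : ‖b₂‖ = (q : ℝ) ^ (-(e₂ : ℤ)))
include hb₁ hb₂

/-- For K = 0 the final negative term comes from the first shell; otherwise it comes from the
second, whose progression continues the off-diagonal sum. In both cases g² = χ(-1) q removes the
Gauss integrals. -/
theorem siegelSum_zero_even {K : ℕ} (hK : e₂ = e₁ + 2 * K) (z : ℂ) :
    siegelSum q π ψ 0 b₁ b₂ e₁ e₂ z =
      chi π (-1) * (((q : ℂ) - 1) *
          ∑ i ∈ Finset.range (e₁ + K), z ^ (2 * i + 2) * (q : ℂ) ^ (3 * i + 1) -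
        z ^ (2 * (e₁ + K) + 2) * (q : ℂ) ^ (3 * (e₁ + K) + 1)) := by
  have hg := h.gaussInt_sq
  change firstShellSum q π ψ 0 b₁ b₂ e₁ e₂ z + secondShellSum q π ψ 0 b₁ b₂ e₁ e₂ z + _ = _
  rw [if_pos rfl, one_mul, offDiag_sum_eq]
  cases K with
  | zero =>
    have hc := chi_mul_self (π := π) (-b₂)
    rw [h.firstShellSum_of_eq hb₁ hb₂ (by omega), h.secondShellSum_of_eq hb₁ hb₂ (by omega),
      if_pos rfl, weightConst, if_pos rfl, min_eq_right (by omega), hK]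
    simp only [mul_zero, add_zero]
    linear_combination (-z ^ (2 * e₁ + 2) * (q : ℂ) ^ (3 * e₁) * gaussInt π ψ ^ 2) * hc -
      z ^ (2 * e₁ + 2) * (q : ℂ) ^ (3 * e₁) * hg
  | succ K =>
    have hc := chi_mul_self (π := π) (-b₁)
    have hs := shell_sum_shift (q : ℂ) z e₁ K
    rw [h.firstShellSum_of_lt hb₁ hb₂ (by omega), h.secondShellSum_even hb₁ hb₂ hK,
      if_pos rfl, weightConst, if_pos rfl, min_eq_left (by omega),
      show e₁ + (K + 1) = e₁ + 1 + K by ring, Finset.sum_range_add _ (e₁ + 1) K]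
    set A := ∑ k ∈ Finset.range K, z ^ (e₁ + 2 * k + 3) *
          (((q : ℂ) - 1) * (q : ℂ) ^ (2 * e₁ + 3 * k + 3))
    linear_combination chi π (-1) * hs +
      z ^ (e₁ + 1) * (q : ℂ) ^ e₁ * (A - z ^ (e₁ + 2 * K + 3) * (q : ℂ) ^ (2 * e₁ + 3 * K + 3)) *
        (gaussInt π ψ ^ 2 * hc + hg)

theorem siegelSum_zero_odd {K : ℕ} (hK : e₂ = e₁ + 2 * K + 1) (z : ℂ) :
    siegelSum q π ψ 0 b₁ b₂ e₁ e₂ z =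
      chi π (-1) * (((q : ℂ) - 1) *
          ∑ i ∈ Finset.range (e₁ + K + 1), z ^ (2 * i + 2) * (q : ℂ) ^ (3 * i + 1) +
        chi π (-b₁) * chi π (-b₂) *
          (z ^ (2 * (e₁ + K) + 3) * (q : ℂ) ^ (3 * (e₁ + K) + 3))) := by
  have hg := h.gaussInt_sq
  have hc := chi_mul_self (π := π) (-b₁)
  have hs := shell_sum_shift (q : ℂ) z e₁ K
  change firstShellSum q π ψ 0 b₁ b₂ e₁ e₂ z + secondShellSum q π ψ 0 b₁ b₂ e₁ e₂ z + _ = _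
  rw [if_pos rfl, one_mul, offDiag_sum_eq, h.firstShellSum_of_lt hb₁ hb₂ (by omega),
    h.secondShellSum_odd hb₁ hb₂ hK, if_pos rfl, weightConst, if_pos rfl, min_eq_left (by omega),
    show e₁ + K + 1 = e₁ + 1 + K by ring, Finset.sum_range_add _ (e₁ + 1) K]
  set A := ∑ k ∈ Finset.range K, z ^ (e₁ + 2 * k + 3) *
        (((q : ℂ) - 1) * (q : ℂ) ^ (2 * e₁ + 3 * k + 3))
  linear_combination chi π (-1) * hs +
    z ^ (e₁ + 1) * (q : ℂ) ^ e₁ * A * (gaussInt π ψ ^ 2 * hc + hg) +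
    chi π (-b₁) * chi π (-b₂) * z ^ (2 * (e₁ + K) + 3) * (q : ℂ) ^ (3 * (e₁ + K) + 2) * hg

/-- Clearing the denominator makes this a polynomial identity. For K = 0 the two shells cancel, in
accordance with the factor 1 - (q³z²)^K. -/
theorem siegelSum_one_even {K : ℕ} (hK : e₂ = e₁ + 2 * K) (z : ℂ) :
    siegelSum q π ψ 1 b₁ b₂ e₁ e₂ z * (1 - (q : ℂ) ^ 3 * z ^ 2) =
      chi π (-b₁) * gaussInt π ψ * (z ^ (e₁ + 1) * (q : ℂ) ^ (2 * e₁ + 1)) *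
        ((1 - (q : ℂ) ^ 2 * z ^ 2) * (1 - ((q : ℂ) ^ 3 * z ^ 2) ^ K)) := by
  change (firstShellSum q π ψ 1 b₁ b₂ e₁ e₂ z + secondShellSum q π ψ 1 b₁ b₂ e₁ e₂ z + _) * _ = _
  rw [if_neg one_ne_zero, zero_mul, add_zero]
  cases K with
  | zero =>
    rw [h.firstShellSum_of_eq hb₁ hb₂ (by omega), h.secondShellSum_of_eq hb₁ hb₂ (by omega),
      if_neg one_ne_zero, weightConst, if_neg one_ne_zero]
    ring
  | succ K =>
    have hs := geom_sum_mul_neg ((q : ℂ) ^ 3 * z ^ 2) K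
    rw [h.firstShellSum_of_lt hb₁ hb₂ (by omega), h.secondShellSum_even hb₁ hb₂ hK,
      if_neg one_ne_zero, weightConst, if_neg one_ne_zero, shell_sum_eq]
    linear_combination chi π (-b₁) * gaussInt π ψ * z ^ (e₁ + 3) * ((q : ℂ) - 1) *
      (q : ℂ) ^ (2 * e₁ + 3) * hs

/-- The sign ε relates the first shell, which carries χ(-b₁), to the last term of the second, which
carries χ(-b₂); ε² = 1 is what permits the factorization. -/
theorem siegelSum_one_odd {K : ℕ} (hK : e₂ = e₁ + 2 * K + 1) (z : ℂ) {ε : ℂ}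
    (hε : ε = chi π (-b₁) * chi π (-b₂)) :
    siegelSum q π ψ 1 b₁ b₂ e₁ e₂ z * (1 - (q : ℂ) ^ 3 * z ^ 2) =
      chi π (-b₁) * gaussInt π ψ * (z ^ (e₁ + 1) * (q : ℂ) ^ (2 * e₁ + 1)) *
        ((1 + ε * (q * z)) * (1 - ε * (q * z) + ε * (((q : ℂ) ^ 3 * z ^ 2) ^ K * (q * z)) -
          ((q : ℂ) ^ 3 * z ^ 2) ^ (K + 1))) := by
  have hs := geom_sum_mul_neg ((q : ℂ) ^ 3 * z ^ 2) K
  have h1 := chi_mul_self (π := π) (-b₁)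
  have h2 := chi_mul_self (π := π) (-b₂)
  have hεε : ε * ε = 1 := by
    rw [hε]; linear_combination chi π (-b₂) * chi π (-b₂) * h1 + h2
  have hε2 : chi π (-b₂) = chi π (-b₁) * ε := by
    rw [hε]; linear_combination -chi π (-b₂) * h1
  change (firstShellSum q π ψ 1 b₁ b₂ e₁ e₂ z + secondShellSum q π ψ 1 b₁ b₂ e₁ e₂ z + _) * _ = _
  rw [if_neg one_ne_zero, zero_mul, add_zero, h.firstShellSum_of_lt hb₁ hb₂ (by omega),
    h.secondShellSum_odd hb₁ hb₂ hK, if_neg one_ne_zero, weightConst, if_neg one_ne_zero,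
    shell_sum_eq, hε2]
  linear_combination chi π (-b₁) * gaussInt π ψ * z ^ (e₁ + 3) * ((q : ℂ) - 1) *
      (q : ℂ) ^ (2 * e₁ + 3) * hs + chi π (-b₁) * gaussInt π ψ *
      (z ^ (e₁ + 1) * (q : ℂ) ^ (2 * e₁ + 1)) * ((q * z) ^ 2 * (1 - ((q : ℂ) ^ 3 * z ^ 2) ^ K)) * hεε

end IsNormalizedWith

end ClosedForms

/-! ### Meromorphic continuation. -/

section Continuation

/-- The difference has infinite order on a half plane, hence everywhere by connectedness. Normal
form upgrades equality on punctured neighbourhoods to equality at every point. -/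
theorem eq_of_meromorphicNFOn_of_eqOn_re {f g : ℂ → ℂ} (hf : MeromorphicNFOn f Set.univ)
    (hg : AnalyticOnNhd ℂ g Set.univ) {c : ℝ} (hfg : ∀ s : ℂ, c < s.re → f s = g s) : f = g := by
  have hd : MeromorphicOn (f - g) Set.univ := hf.meromorphicOn.sub hg.meromorphicOn
  have htop : ∀ x : ℂ, meromorphicOrderAt (f - g) x = ⊤ := by
    by_contra! hx
    obtain ⟨x, hx⟩ := hx
    have hp : ((c + 1 : ℝ) : ℂ) ∈ {s : ℂ | c < s.re} := by simp
    refine (hd.meromorphicOrderAt_ne_top_of_isPreconnected (y := ((c + 1 : ℝ) : ℂ))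
      isPreconnected_univ (Set.mem_univ x) (Set.mem_univ _) hx) ?_
    rw [meromorphicOrderAt_eq_top_iff]
    refine Filter.Eventually.filter_mono nhdsWithin_le_nhds ?_
    filter_upwards [(isOpen_lt continuous_const Complex.continuous_re).mem_nhds hp] with s hs
    rw [Pi.sub_apply, hfg s hs, sub_self]
  ext x
  have h1 : f =ᶠ[nhdsWithin x {x}ᶜ] g := by
    filter_upwards [meromorphicOrderAt_eq_top_iff.1 (htop x)] with y hy
    exact sub_eq_zero.1 hy
  have hg' : MeromorphicNFAt g x := (hg x (Set.mem_univ x)).meromorphicNFAt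
  exact (((hf (Set.mem_univ x)).eventuallyEq_nhdsNE_iff_eventuallyEq_nhds hg').1 h1).eq_of_nhds

/-- The entire function witnesses that a continuation exists, and uniqueness identifies it with the
chosen one even if the latter comes with a different half plane. -/
theorem siegelSeries_eq_of_analyticOnNhd {F : Type*} [NontriviallyNormedField F] [ProperSpace F]
    [MeasurableSpace F] [BorelSpace F] {n : ℕ} {ω : F → ℂ} {ψ : AddChar F Circle} {t : ℕ}
    {B : Matrix (Fin n) (Fin n) F} {g : ℂ → ℂ} (hg : AnalyticOnNhd ℂ g Set.univ) {c : ℝ}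
    (hgi : ∀ s : ℂ, c < s.re → Integrable (siegelIntegrand ω ψ t B s) (haarSym F n) ∧
      g s = ∫ x, siegelIntegrand ω ψ t B s x ∂haarSym F n) : siegelSeries ω ψ t B = g := by
  have hex : ∃ S : ℂ → ℂ, IsSiegelSeries ω ψ t B S := ⟨g, hg.meromorphicNFOn, c, hgi⟩
  rw [siegelSeries, dif_pos hex]
  obtain ⟨hS, c', hc'⟩ := hex.choose_spec
  refine eq_of_meromorphicNFOn_of_eqOn_re hS hg (c := max c c') fun s hs => ?_
  rw [(hc' s ((le_max_right _ _).trans_lt hs)).2, (hgi s ((le_max_left _ _).trans_lt hs)).2]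

variable {F : Type*} [NontriviallyNormedField F] [ProperSpace F] [MeasurableSpace F] [BorelSpace F]
  [IsUltrametricDist F] {q : ℕ} {π : F} {ψ : AddChar F Circle}

theorem IsNormalizedWith.siegelSeries_diagonal (h : IsNormalizedWith q π ψ) {t : ℕ} (ht : t ≤ 1)
    {b₁ b₂ : F} {e₁ e₂ : ℕ} (hb₁ : ‖b₁‖ = (q : ℝ) ^ (-(e₁ : ℤ)))
    (hb₂ : ‖b₂‖ = (q : ℝ) ^ (-(e₂ : ℤ))) (s : ℂ) :
    siegelSeries (chi π) ψ t (Matrix.diagonal ![b₁, b₂]) s =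
      siegelSum q π ψ t b₁ b₂ e₁ e₂ ((q : ℂ) ^ (-s)) := by
  have hd : Differentiable ℂ fun s : ℂ => siegelSum q π ψ t b₁ b₂ e₁ e₂ ((q : ℂ) ^ (-s)) := by
    refine (differentiable_siegelSum q π ψ t b₁ b₂ e₁ e₂).comp ?_
    exact fun s => differentiableAt_id.neg.const_cpow (Or.inl h.cast_ne_zero)
  have hg := hd.differentiableOn.analyticOnNhd (s := Set.univ) isOpen_univ
  refine congrFun (siegelSeries_eq_of_analyticOnNhd hg (c := 2) fun s hs => ?_) s
  obtain ⟨h1, h2⟩ := h.integrable_siegelIntegrand_and_integral_eq hs ht hb₁ hb₂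
  exact ⟨h1, h2.symm⟩

end Continuation

end RamifiedSiegel

/-! ### Translation into complex powers of q. -/

namespace RamifiedSiegel

theorem cpow_natCast_mul_neg_add {Q : ℂ} (hQ : Q ≠ 0) {s x : ℂ} (a b : ℕ)
    (hx : x = a * (-s) + b) : Q ^ x = (Q ^ (-s)) ^ a * Q ^ b := by
  rw [hx, Complex.cpow_add _ _ hQ, Complex.cpow_natCast, Complex.cpow_nat_mul]

namespace IsNormalizedWith

variable {F : Type*} [NontriviallyNormedField F] [ProperSpace F] [MeasurableSpace F] [BorelSpace F]
  [IsUltrametricDist F] {q : ℕ} {π : F} {ψ : AddChar F Circle}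
  (h : IsNormalizedWith q π ψ)
include h

theorem chi_neg_mul_pow {α : F} (hα : ‖α‖ = 1) (e : ℕ) :
    chi π (-(α * π ^ e)) = chi π (-1) ^ e * chi π (-α) := by
  have hα0 : -α ≠ 0 := neg_ne_zero.2 (norm_ne_zero_iff.1 (by rw [hα]; exact one_ne_zero))
  rw [← neg_mul, h.chi_mul hα0 (pow_ne_zero _ h.ne_zero), h.chi_pow h.ne_zero, h.chi_prime,
    mul_comm]

theorem norm_mul_pow {α : F} (hα : ‖α‖ = 1) (e : ℕ) :
    ‖α * π ^ e‖ = (q : ℝ) ^ (-(e : ℤ)) := by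
  rw [norm_mul, hα, one_mul, h.norm_pow]

/-- As χ(π) = χ(-1), the powers of π contribute χ(-1)^(e₁+e₂) = χ(-1), while the two signs cancel.
-/
theorem chi_mul_chi_of_odd {α₁ α₂ : F} (hα₁ : ‖α₁‖ = 1) (hα₂ : ‖α₂‖ = 1) {e₁ e₂ : ℕ}
    (he : Odd (e₁ + e₂)) : chi π (-(α₁ * π ^ e₁)) * chi π (-(α₂ * π ^ e₂)) =
      chi π (-(α₁ * α₂)) := by
  have h1 : α₁ ≠ 0 := norm_ne_zero_iff.1 (by rw [hα₁]; exact one_ne_zero)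
  have h2 : α₂ ≠ 0 := norm_ne_zero_iff.1 (by rw [hα₂]; exact one_ne_zero)
  obtain ⟨k, hk⟩ := he
  have hc := chi_mul_self (π := π) (-1)
  have hpow : chi π (-1) ^ e₁ * chi π (-1) ^ e₂ = chi π (-1) := by
    rw [← pow_add, hk, pow_succ, pow_mul, pow_two, hc, one_pow, one_mul]
  rw [h.chi_neg_mul_pow hα₁, h.chi_neg_mul_pow hα₂, h.chi_neg h1, h.chi_neg h2,
    h.chi_neg (mul_ne_zero h1 h2), h.chi_mul h1 h2]
  linear_combination chi π (-1) ^ 2 * chi π α₁ * chi π α₂ * hpow +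
    chi π (-1) * chi π α₁ * chi π α₂ * hc

/-- The prefactor of `S_1` in terms of `q ^ (-s)`. -/
theorem weilConstant_mul_cpow {α : F} (hα : ‖α‖ = 1) (e : ℕ) (s : ℂ) :
    weilConstant ψ π * chi π (-1) ^ (e + 1) * chi π (-α) *
        (q : ℂ) ^ ((3 / 2 - s) * ((e : ℂ) + 1) + (e : ℂ) / 2) =
      chi π (-(α * π ^ e)) * gaussInt π ψ *
        (((q : ℂ) ^ (-s)) ^ (e + 1) * (q : ℂ) ^ (2 * e + 1)) := by
  have hQ := h.cast_ne_zero
  have hc := chi_mul_self (π := π) (-1)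
  have hr : (((q : ℝ) ^ (1 / 2 : ℝ) : ℝ) : ℂ) * (q : ℂ) ^ (1 / 2 : ℂ) = q := by
    rw [Complex.ofReal_cpow h.pos.le, Complex.ofReal_natCast]
    push_cast
    rw [← Complex.cpow_add _ _ hQ, add_halves, Complex.cpow_one]
  -- The constant part of the exponent is 2e + 3/2; the half-integral power q^(1/2) is split off to
  -- cancel the q^(-1/2) of the Weil constant.
  have hexp : (q : ℂ) ^ ((3 / 2 - s) * ((e : ℂ) + 1) + (e : ℂ) / 2) =
      ((q : ℂ) ^ (-s)) ^ (e + 1) * (q : ℂ) ^ (2 * e + 1) * (q : ℂ) ^ (1 / 2 : ℂ) := by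
    rw [← cpow_natCast_mul_neg_add hQ (e + 1) (2 * e + 1) rfl, ← Complex.cpow_add _ _ hQ]
    congr 1
    push_cast
    ring
  rw [h.weilConstant_eq, hexp, h.chi_neg_mul_pow hα]
  set Z := (q : ℂ) ^ (-s)
  have hqi : (q : ℂ)⁻¹ * q = 1 := inv_mul_cancel₀ hQ
  linear_combination (q : ℂ)⁻¹ * chi π (-1) ^ (e + 2) * gaussInt π ψ * chi π (-α) * Z ^ (e + 1) *
      (q : ℂ) ^ (2 * e + 1) * hr +
    chi π (-1) ^ (e + 2) * gaussInt π ψ * chi π (-α) * Z ^ (e + 1) * (q : ℂ) ^ (2 * e + 1) * hqi +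
    chi π (-1) ^ e * gaussInt π ψ * chi π (-α) * Z ^ (e + 1) * (q : ℂ) ^ (2 * e + 1) * hc

end IsNormalizedWith

theorem sum_Icc_cpow {Q : ℂ} (hQ : Q ≠ 0) (s : ℂ) (N : ℕ) :
    ∑ i ∈ Finset.Icc 1 N, Q ^ ((3 - 2 * s) * (i : ℂ) - 2) =
      ∑ i ∈ Finset.range N, (Q ^ (-s)) ^ (2 * i + 2) * Q ^ (3 * i + 1) := by
  rw [← Finset.Ico_add_one_right_eq_Icc, Finset.sum_Ico_eq_sum_range, Nat.add_sub_cancel]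
  refine Finset.sum_congr rfl fun i _ => cpow_natCast_mul_neg_add hQ _ _ ?_
  push_cast
  ring

end RamifiedSiegel

end

theorem theorem6p2 {F : Type*} [NontriviallyNormedField F] [IsUltrametricDist F] [ProperSpace F]
    [CharZero F] [MeasurableSpace F] [BorelSpace F]
    (q : ℕ) (hq : q = RamifiedSiegel.residueCard F) (hodd : Odd q)
    (π : F) (hπ : RamifiedSiegel.IsUniformizer π)
    -- the norm of `F` is the normalized absolute value
    (hnorm : ‖π‖ = (q : ℝ)⁻¹)
    (ψ : AddChar F Circle) (hψc : Continuous ψ) (hψ : RamifiedSiegel.HasOrderZero ψ)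
    (χ : F → ℂ) (hχ : χ = RamifiedSiegel.chi π)
    (α₁ α₂ : F) (hα₁ : ‖α₁‖ = 1) (hα₂ : ‖α₂‖ = 1)
    (e₁ e₂ : ℕ) (he : e₁ ≤ e₂)
    (B : Matrix (Fin 2) (Fin 2) F)
    (hB : B = Matrix.diagonal ![α₁ * π ^ e₁, α₂ * π ^ e₂]) :
    -- absolute convergence
    (∀ t : ℕ, t ≤ 1 → ∀ s : ℂ, 2 < s.re →
      Integrable (RamifiedSiegel.siegelIntegrand χ ψ t B s) (RamifiedSiegel.haarSym F 2) ∧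
      RamifiedSiegel.siegelSeries χ ψ t B s =
        ∫ x, RamifiedSiegel.siegelIntegrand χ ψ t B s x ∂(RamifiedSiegel.haarSym F 2)) ∧
    (Even (e₁ + e₂) → ∀ s : ℂ,
      RamifiedSiegel.siegelSeries χ ψ 0 B s =
        χ (-1) * (((q : ℂ) - 1) * ∑ i ∈ Finset.Icc 1 ((e₁ + e₂) / 2),
              (q : ℂ) ^ ((3 - 2 * s) * (i : ℂ) - 2)
            - (q : ℂ) ^ ((3 - 2 * s) * (((e₁ : ℂ) + e₂) / 2 + 1) - 2)) ∧
      ((q : ℂ) ^ (3 - 2 * s) ≠ 1 →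
        RamifiedSiegel.siegelSeries χ ψ 1 B s =
          RamifiedSiegel.weilConstant ψ π * χ (-1) ^ (e₁ + 1) * χ (-α₁) *
            (q : ℂ) ^ ((3 / 2 - s) * ((e₁ : ℂ) + 1) + (e₁ : ℂ) / 2) *
            ((1 - (q : ℂ) ^ (2 - 2 * s)) * (1 - (q : ℂ) ^ ((3 / 2 - s) * ((e₂ : ℂ) - e₁))) /
              (1 - (q : ℂ) ^ (3 - 2 * s))))) ∧
    (Odd (e₁ + e₂) → ∀ s : ℂ,
      RamifiedSiegel.siegelSeries χ ψ 0 B s =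
        χ (-1) * (((q : ℂ) - 1) * ∑ i ∈ Finset.Icc 1 ((e₁ + e₂ + 1) / 2),
              (q : ℂ) ^ ((3 - 2 * s) * (i : ℂ) - 2)
            + χ (π * α₁ * α₂) *
              (q : ℂ) ^ ((3 - 2 * s) * (((e₁ : ℂ) + e₂) / 2 + 1) - 3 / 2)) ∧
      ((q : ℂ) ^ (3 - 2 * s) ≠ 1 →
        RamifiedSiegel.siegelSeries χ ψ 1 B s =
          RamifiedSiegel.weilConstant ψ π * χ (-1) ^ (e₁ + 1) * χ (-α₁) *
            (q : ℂ) ^ ((3 / 2 - s) * ((e₁ : ℂ) + 1) + (e₁ : ℂ) / 2) *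
            ((1 + χ (-(α₁ * α₂)) * (q : ℂ) ^ (1 - s)) / (1 - (q : ℂ) ^ (3 - 2 * s))) *
            (1 - χ (-(α₁ * α₂)) * (q : ℂ) ^ (1 - s)
              + χ (-(α₁ * α₂)) * (q : ℂ) ^ ((3 / 2 - s) * ((e₂ : ℂ) - e₁) - 1 / 2)
              - (q : ℂ) ^ ((3 / 2 - s) * ((e₂ : ℂ) - e₁ + 1))))) := by
  open RamifiedSiegel in
  subst hχ hB
  have h : IsNormalizedWith q π ψ := ⟨⟨hq, hodd, hπ, hnorm⟩, hψc, hψ⟩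
  have hb₁ := h.norm_mul_pow hα₁ e₁
  have hb₂ := h.norm_mul_pow hα₂ e₂
  have hQ := h.cast_ne_zero
  -- The ratio of the geometric progression: excluding q^(3-2s) = 1 is what allows division in the
  -- formulas for S_1.
  have hR (s : ℂ) : (q : ℂ) ^ (3 - 2 * s) = (q : ℂ) ^ 3 * ((q : ℂ) ^ (-s)) ^ 2 := by
    rw [cpow_natCast_mul_neg_add hQ (s := s) 2 3 (by push_cast; ring), mul_comm]
  refine ⟨fun t ht s hs => ?_, fun heven s => ⟨?_, fun hs => ?_⟩, fun hodd' s => ⟨?_, fun hs => ?_⟩⟩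
  · obtain ⟨h1, h2⟩ := h.integrable_siegelIntegrand_and_integral_eq hs ht hb₁ hb₂
    exact ⟨h1, by rw [h2, h.siegelSeries_diagonal ht hb₁ hb₂]⟩
  · obtain ⟨K, hK⟩ : ∃ K, e₂ = e₁ + 2 * K := by
      obtain ⟨k, hk⟩ := heven
      exact ⟨(e₂ - e₁) / 2, by omega⟩
    have hpow : (q : ℂ) ^ ((3 - 2 * s) * (((e₁ : ℂ) + e₂) / 2 + 1) - 2) =
        ((q : ℂ) ^ (-s)) ^ (2 * (e₁ + K) + 2) * (q : ℂ) ^ (3 * (e₁ + K) + 1) := by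
      refine cpow_natCast_mul_neg_add hQ _ _ ?_
      rw [hK]
      push_cast
      ring
    rw [h.siegelSeries_diagonal zero_le_one hb₁ hb₂, h.siegelSum_zero_even hb₁ hb₂ hK,
      show (e₁ + e₂) / 2 = e₁ + K by omega, sum_Icc_cpow hQ, hpow]
  · obtain ⟨K, hK⟩ : ∃ K, e₂ = e₁ + 2 * K := by
      obtain ⟨k, hk⟩ := heven
      exact ⟨(e₂ - e₁) / 2, by omega⟩
    have hs' : 1 - (q : ℂ) ^ 3 * ((q : ℂ) ^ (-s)) ^ 2 ≠ 0 := by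
      rw [← hR, sub_ne_zero]; exact hs.symm
    have hpow : (q : ℂ) ^ ((3 / 2 - s) * ((e₂ : ℂ) - e₁)) =
        ((q : ℂ) ^ 3 * ((q : ℂ) ^ (-s)) ^ 2) ^ K := by
      rw [← hR, ← Complex.cpow_nat_mul, hK]
      congr 1
      push_cast
      ring
    have hT : (q : ℂ) ^ (2 - 2 * s) = (q : ℂ) ^ 2 * ((q : ℂ) ^ (-s)) ^ 2 := by
      rw [cpow_natCast_mul_neg_add hQ (s := s) 2 2 (by push_cast; ring), mul_comm]
    rw [h.siegelSeries_diagonal le_rfl hb₁ hb₂, h.weilConstant_mul_cpow hα₁, hR, hpow, hT,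
      ← mul_div_assoc, eq_div_iff hs', h.siegelSum_one_even hb₁ hb₂ hK]
  · obtain ⟨K, hK⟩ : ∃ K, e₂ = e₁ + 2 * K + 1 := by
      obtain ⟨k, hk⟩ := hodd'
      exact ⟨(e₂ - e₁) / 2, by omega⟩
    have h1 : α₁ ≠ 0 := norm_ne_zero_iff.1 (by rw [hα₁]; exact one_ne_zero)
    have h2 : α₂ ≠ 0 := norm_ne_zero_iff.1 (by rw [hα₂]; exact one_ne_zero)
    -- The sign in the statement differs from the one in the computation only through χ(π) = χ(-1).
    have hε : chi π (π * α₁ * α₂) = chi π (-(α₁ * α₂)) := by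
      rw [mul_assoc, h.chi_mul h.ne_zero (mul_ne_zero h1 h2), h.chi_prime,
        h.chi_neg (mul_ne_zero h1 h2)]
    have hpow : (q : ℂ) ^ ((3 - 2 * s) * (((e₁ : ℂ) + e₂) / 2 + 1) - 3 / 2) =
        ((q : ℂ) ^ (-s)) ^ (2 * (e₁ + K) + 3) * (q : ℂ) ^ (3 * (e₁ + K) + 3) := by
      refine cpow_natCast_mul_neg_add hQ _ _ ?_
      rw [hK]
      push_cast
      ring
    rw [h.siegelSeries_diagonal zero_le_one hb₁ hb₂, h.siegelSum_zero_odd hb₁ hb₂ hK,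
      h.chi_mul_chi_of_odd hα₁ hα₂ hodd', hε,
      show (e₁ + e₂ + 1) / 2 = e₁ + K + 1 by omega, sum_Icc_cpow hQ, hpow]
  · obtain ⟨K, hK⟩ : ∃ K, e₂ = e₁ + 2 * K + 1 := by
      obtain ⟨k, hk⟩ := hodd'
      exact ⟨(e₂ - e₁) / 2, by omega⟩
    have hs' : 1 - (q : ℂ) ^ 3 * ((q : ℂ) ^ (-s)) ^ 2 ≠ 0 := by
      rw [← hR, sub_ne_zero]; exact hs.symm
    have hT : (q : ℂ) ^ (1 - s) = (q : ℂ) * (q : ℂ) ^ (-s) := by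
      rw [cpow_natCast_mul_neg_add hQ (s := s) 1 1 (by push_cast; ring), pow_one, pow_one, mul_comm]
    have hpow1 : (q : ℂ) ^ ((3 / 2 - s) * ((e₂ : ℂ) - e₁ + 1)) =
        ((q : ℂ) ^ 3 * ((q : ℂ) ^ (-s)) ^ 2) ^ (K + 1) := by
      rw [← hR, ← Complex.cpow_nat_mul, hK]
      congr 1
      push_cast
      ring
    have hpow2 : (q : ℂ) ^ ((3 / 2 - s) * ((e₂ : ℂ) - e₁) - 1 / 2) =
        ((q : ℂ) ^ 3 * ((q : ℂ) ^ (-s)) ^ 2) ^ K * ((q : ℂ) * (q : ℂ) ^ (-s)) := by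
      rw [← hR, ← hT, ← Complex.cpow_nat_mul, ← Complex.cpow_add _ _ hQ, hK]
      congr 1
      push_cast
      ring
    rw [h.siegelSeries_diagonal le_rfl hb₁ hb₂, h.weilConstant_mul_cpow hα₁, hT, hpow1, hpow2, hR,
      ← mul_div_assoc, div_mul_eq_mul_div, eq_div_iff hs',
      h.siegelSum_one_odd hb₁ hb₂ hK _ (h.chi_mul_chi_of_odd hα₁ hα₂ hodd').symm, ← mul_assoc]
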